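/- Let $q:\mathbb R\to\mathbb C$ be $1$-periodic and Lebesgue integrable on $[0,1]$. Let $H$ be the Hill operator generated by $-y''+qy$ in $L_2(\mathbb R)$ (domain: all $y\in L_2(\mathbb R)$ with $y,y'$ locally absolutely continuous and $-y''+qy\in L_2(\mathbb R)$). For $t\in\mathbb R$ let $H_t$ be the operator generated in $L_2(0,1)$ by $-y''+qy$ and the boundary conditions $y(1)=e^{it}y(0)$, $y'(1)=e^{it}y'(0)$. Call an eigenvalue of $H_t$ simple if its algebraic multiplicity (the dimension of its root subspace $\bigcup_n\ker(H_t-\lambda)^n$) is $1$, and multiple if it is at least $2$. A point $\lambda_0\in\sigma(H)$ is a *spectral singularity* of $H$ if for every $\varepsilon>0$ the spectral projections $$-\frac1{2\pi i}\oint_{|z-\lambda|=r}(H_t-z)^{-1}\,dz$$ of the operators $H_t$, $t\in[0,2\pi)$, for the simple eigenvalues $\lambda$ of $H_t$ with $|\lambda-\lambda_0|<\varepsilon$ ($r>0$ so small that $\lambda$ is the only point of $\sigma(H_t)$ in $|z-\lambda|\le r$) are not uniformly bounded in norm. For $s\in\mathbb R$ and $\delta>0$ put $D(s,\delta)=(s-\delta,s)\cup(s,s+\delta)$.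 A point $\lambda_0\in\sigma(H)$ is an *essential spectral singularity* of $H$ if there are $s\in(-\pi,\pi]$ with $\lambda_0\in\sigma(H_s)$, a number $\delta>0$ and a continuous function $t\mapsto\lambda(t)$ on $D(s,\delta)$ such that $\lambda(t)$ is a simple eigenvalue of $H_t$ for every $t\in D(s,\delta)$, $\lambda(t)\to\lambda_0$ as $t\to s$, and $$\int_{D(s,\eta)}\frac{dt}{|\alpha(t)|}=\infty\quad\text{for all }\eta\in(0,\delta],\qquad \alpha(t)=(\Psi_t^*,\Psi_t),$$ where $\Psi_t$ and $\Psi_t^*$ are normalized eigenfunctions of $H_t$ and of its adjoint $H_t^*$ for the eigenvalues $\lambda(t)$ and $\overline{\lambda(t)}$ (so $|\alpha(t)|$ does not depend on their choice). **Theorem.** Let $t_0\in\mathbb R$ be not an integer multiple of $\pi$ (for $t_0\in(-\pi,\pi]$: $t_0\ne0,\pi$), and let $\lambda_0$ be a multiple eigenvalue of $H_{t_0}$. Then $\lambda_0$ is a spectral singularity of $H$, but not an essential spectral singularity of $H$. -/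

import Mathlib

open MeasureTheory Set Filter Topology

/-! ### Spectral theory of (unbounded) linear operators -/

namespace UnboundedOp

variable {E : Type*} [NormedAddCommGroup E] [NormedSpace ℂ E]

/-- `R` is the bounded resolvent `(T - z)⁻¹` of the unbounded operator `T`. -/
def IsResolvent (T : E →ₗ.[ℂ] E) (z : ℂ) (R : E →L[ℂ] E) : Prop :=
  (∀ f : E, ∃ h : R f ∈ T.domain, T ⟨R f, h⟩ - z • R f = f) ∧
    ∀ y : T.domain, R (T y - z • (y : E)) = y

/-- The resolvent set of an unbounded operator. -/
def resolventSet (T : E →ₗ.[ℂ] E) : Set ℂ := {z | ∃ R : E →L[ℂ] E, IsResolvent T z R}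

/-- The spectrum of an unbounded operator. -/
def spectrum (T : E →ₗ.[ℂ] E) : Set ℂ := (resolventSet T)ᶜ

/-- `ker (T - z)ⁿ`, on the natural domain of `(T - z)ⁿ`. -/
def kerPow (T : E →ₗ.[ℂ] E) (z : ℂ) : ℕ → Submodule ℂ E
  | 0 => ⊥
  | n + 1 => ((kerPow T z n).comap (T.toFun - z • T.domain.subtype)).map T.domain.subtype

/-- The root subspace `⋃ₙ ker (T - z)ⁿ`, spanned by eigenvectors and associated vectors. -/
def rootSpace (T : E →ₗ.[ℂ] E) (z : ℂ) : Submodule ℂ E := ⨆ n, kerPow T z n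

/-- The algebraic multiplicity of `z` as an eigenvalue of `T` (`0` if `z` is no eigenvalue). -/
noncomputable def algMult (T : E →ₗ.[ℂ] E) (z : ℂ) : ℕ∞ :=
  Cardinal.toENat (Module.rank ℂ (rootSpace T z))

/-- `z` is a simple eigenvalue of `T`. -/
def IsSimpleEigenvalue (T : E →ₗ.[ℂ] E) (z : ℂ) : Prop := algMult T z = 1

/-- `z` is a multiple eigenvalue of `T`. -/
def IsMultipleEigenvalue (T : E →ₗ.[ℂ] E) (z : ℂ) : Prop := 2 ≤ algMult T z

/-- `v` is a normalized eigenvector of `T` for the eigenvalue `z`. -/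
def IsNormalizedEigenvector (T : E →ₗ.[ℂ] E) (z : ℂ) (v : E) : Prop :=
  ‖v‖ = 1 ∧ ∃ h : v ∈ T.domain, T ⟨v, h⟩ = z • v

/-- `P` is the spectral projection `-(2πi)⁻¹ ∮ (T - z)⁻¹ dz` of `T` for the isolated point `w`,
the contour being a circle about `w` that encloses no other point of the spectrum. -/
def IsSpectralProjection (T : E →ₗ.[ℂ] E) (w : ℂ) (P : E →L[ℂ] E) : Prop :=
  ∃ r : ℝ, 0 < r ∧ Metric.closedBall w r ∩ spectrum T ⊆ {w} ∧
    ∃ R : ℂ → E →L[ℂ] E, (∀ z ∈ Metric.sphere w r, IsResolvent T z (R z)) ∧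
      P = -(2 * (Real.pi : ℂ) * Complex.I)⁻¹ • ∮ z in C(w, r), R z

end UnboundedOp

/-! ### The Hill operator and its quasiperiodic fibres -/

namespace Hill

/-- `f` and its derivative `f₁` are absolutely continuous on `[a, b]`, and `f₂` is the (almost
everywhere defined, integrable) second derivative of `f`. -/
structure TwiceAC (a b : ℝ) (f f₁ f₂ : ℝ → ℂ) : Prop where
  integrable : IntervalIntegrable f₂ volume a b
  deriv_eq : ∀ x ∈ Icc a b, f₁ x = f₁ a + ∫ s in a..x, f₂ s
  eq : ∀ x ∈ Icc a b, f x = f a + ∫ s in a..x, f₁ s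

theorem TwiceAC.deriv_integrable {a b : ℝ} {f f₁ f₂ : ℝ → ℂ} (hab : a ≤ b)
    (h : TwiceAC a b f f₁ f₂) : IntervalIntegrable f₁ volume a b := by
  apply ContinuousOn.intervalIntegrable
  rw [uIcc_of_le hab]
  have h1 : ContinuousOn (fun x => f₁ a + ∫ s in a..x, f₂ s) (Icc a b) := by
    have := intervalIntegral.continuousOn_primitive_interval'
      (h.integrable) (left_mem_uIcc)
    rw [uIcc_of_le hab] at this
    exact continuousOn_const.add this
  exact h1.congr h.deriv_eq

theorem TwiceAC.add {a b : ℝ} {f f₁ f₂ g g₁ g₂ : ℝ → ℂ} (hab : a ≤ b)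
    (hf : TwiceAC a b f f₁ f₂) (hg : TwiceAC a b g g₁ g₂) :
    TwiceAC a b (f + g) (f₁ + g₁) (f₂ + g₂) := by
  have sub : ∀ x ∈ Icc a b, uIcc a x ⊆ uIcc a b := fun x hx => by
    rw [uIcc_of_le hab, uIcc_of_le hx.1]; exact Icc_subset_Icc_right hx.2
  refine ⟨hf.integrable.add hg.integrable, fun x hx => ?_, fun x hx => ?_⟩
  · have := intervalIntegral.integral_add (hf.integrable.mono_set (sub x hx))
      (hg.integrable.mono_set (sub x hx))
    simp only [Pi.add_apply]
    rw [this, hf.deriv_eq x hx, hg.deriv_eq x hx]; ring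
  · have := intervalIntegral.integral_add ((hf.deriv_integrable hab).mono_set (sub x hx))
      ((hg.deriv_integrable hab).mono_set (sub x hx))
    simp only [Pi.add_apply]
    rw [this, hf.eq x hx, hg.eq x hx]; ring

theorem TwiceAC.smul {a b : ℝ} {f f₁ f₂ : ℝ → ℂ} (c : ℂ)
    (hf : TwiceAC a b f f₁ f₂) : TwiceAC a b (c • f) (c • f₁) (c • f₂) := by
  refine ⟨hf.integrable.smul c, fun x hx => ?_, fun x hx => ?_⟩
  · simp only [Pi.smul_apply, intervalIntegral.integral_smul]
    rw [hf.deriv_eq x hx, smul_add]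
  · simp only [Pi.smul_apply, intervalIntegral.integral_smul]
    rw [hf.eq x hx, smul_add]

theorem TwiceAC.zero (a b : ℝ) : TwiceAC a b 0 0 0 :=
  ⟨intervalIntegrable_const (c := (0 : ℂ)), by simp, by simp⟩

theorem ae_zero_of_primitive {a b : ℝ} (hab : a ≤ b) {u : ℝ → ℂ} {c : ℂ}
    (hu : IntervalIntegrable u volume a b)
    (h : ∀ᵐ x ∂volume.restrict (Ioc a b), c + ∫ s in a..x, u s = 0) :
    ∀ᵐ x ∂volume.restrict (Ioc a b), u x = 0 := by
  rcases hab.eq_or_lt with rfl | hlt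
  · simp
  have hc : ContinuousOn (fun x => c + ∫ s in a..x, u s) (Icc a b) := by
    have := intervalIntegral.continuousOn_primitive_interval' hu left_mem_uIcc
    rw [uIcc_of_le hab] at this
    exact continuousOn_const.add this
  have h0 : EqOn (fun x => c + ∫ s in a..x, u s) (fun _ => 0) (Icc a b) := by
    refine Measure.eqOn_Icc_of_ae_eq volume hlt.ne ?_ hc continuousOn_const
    rw [← restrict_Ioc_eq_restrict_Icc]
    exact h
  have hd := hu.ae_hasDerivAt_integral
  rw [ae_restrict_iff' measurableSet_Ioc]
  have hb : ∀ᵐ x : ℝ, x ≠ b := by simp [ae_iff, measure_singleton]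
  filter_upwards [hd, hb] with x hx hxb hxm
  have hxI : x ∈ Ioo a b := ⟨hxm.1, lt_of_le_of_ne hxm.2 hxb⟩
  have h1 := hx (by rw [uIcc_of_le hab]; exact Ioo_subset_Icc_self hxI) a left_mem_uIcc
  have h2 : HasDerivAt (fun x => ∫ s in a..x, u s) 0 x := by
    refine (hasDerivAt_const x (-c)).congr_of_eventuallyEq ?_
    filter_upwards [Ioo_mem_nhds hxI.1 hxI.2] with y hy
    exact eq_neg_of_add_eq_zero_right (h0 (Ioo_subset_Icc_self hy))
  exact h1.unique h2

theorem TwiceAC.ae_zero {a b : ℝ} (hab : a ≤ b) {f f₁ f₂ : ℝ → ℂ} (h : TwiceAC a b f f₁ f₂)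
    (h0 : ∀ᵐ x ∂volume.restrict (Ioc a b), f x = 0) :
    ∀ᵐ x ∂volume.restrict (Ioc a b), f₂ x = 0 := by
  have h1 : ∀ᵐ x ∂volume.restrict (Ioc a b), f₁ x = 0 := by
    refine ae_zero_of_primitive hab (c := f a) (h.deriv_integrable hab) ?_
    filter_upwards [h0, ae_restrict_mem measurableSet_Ioc] with x hx hm
    rw [← h.eq x (Ioc_subset_Icc_self hm), hx]
  refine ae_zero_of_primitive hab (c := f₁ a) h.integrable ?_
  filter_upwards [h1, ae_restrict_mem measurableSet_Ioc] with x hx hm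
  rw [← h.deriv_eq x (Ioc_subset_Icc_self hm), hx]

/-- The Hilbert space `L²(0, 1)`. -/
abbrev L2Unit : Type := Lp ℂ 2 (volume.restrict (Ioc (0 : ℝ) 1))

/-- The Hilbert space `L²(ℝ)`. -/
abbrev L2Line : Type := Lp ℂ 2 (volume : Measure ℝ)

/-- The graph of the operator `H_t`: the pairs `(y, -y'' + q y)` in `L²(0, 1)` with `y`, `y'`
absolutely continuous on `[0, 1]`, `y(1) = e^{it} y(0)` and `y'(1) = e^{it} y'(0)`. -/
def fibreGraph (q : ℝ → ℂ) (t : ℝ) : Submodule ℂ (L2Unit × L2Unit) where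
  carrier := {p | ∃ f f₁ f₂ : ℝ → ℂ, TwiceAC 0 1 f f₁ f₂ ∧
    f 1 = Complex.exp (Complex.I * t) * f 0 ∧
    f₁ 1 = Complex.exp (Complex.I * t) * f₁ 0 ∧
    (∀ᵐ x ∂volume.restrict (Ioc (0 : ℝ) 1), p.1 x = f x) ∧
    ∀ᵐ x ∂volume.restrict (Ioc (0 : ℝ) 1), p.2 x = -f₂ x + q x * f x}
  zero_mem' := by
    refine ⟨0, 0, 0, TwiceAC.zero 0 1, by simp, by simp, ?_, ?_⟩
    · filter_upwards [Lp.coeFn_zero ℂ 2 (volume.restrict (Ioc (0 : ℝ) 1))] with x hx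
      simpa using hx
    · filter_upwards [Lp.coeFn_zero ℂ 2 (volume.restrict (Ioc (0 : ℝ) 1))] with x hx
      simpa using hx
  add_mem' := by
    rintro p r ⟨f, f₁, f₂, hf, hf0, hf1, hp1, hp2⟩ ⟨g, g₁, g₂, hg, hg0, hg1, hr1, hr2⟩
    refine ⟨f + g, f₁ + g₁, f₂ + g₂, hf.add zero_le_one hg, ?_, ?_, ?_, ?_⟩
    · simp only [Pi.add_apply, hf0, hg0]; ring
    · simp only [Pi.add_apply, hf1, hg1]; ring
    · filter_upwards [Lp.coeFn_add p.1 r.1, hp1, hr1] with x hx h1 h2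
      simp only [Prod.fst_add, hx, Pi.add_apply, h1, h2]
    · filter_upwards [Lp.coeFn_add p.2 r.2, hp2, hr2] with x hx h1 h2
      simp only [Prod.snd_add, hx, Pi.add_apply, h1, h2]; ring
  smul_mem' := by
    rintro c p ⟨f, f₁, f₂, hf, hf0, hf1, hp1, hp2⟩
    refine ⟨c • f, c • f₁, c • f₂, hf.smul c, ?_, ?_, ?_, ?_⟩
    · simp only [Pi.smul_apply, smul_eq_mul, hf0]; ring
    · simp only [Pi.smul_apply, smul_eq_mul, hf1]; ring
    · filter_upwards [Lp.coeFn_smul c p.1, hp1] with x hx h1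
      simp only [Prod.smul_fst, hx, Pi.smul_apply, h1]
    · filter_upwards [Lp.coeFn_smul c p.2, hp2] with x hx h1
      simp only [Prod.smul_snd, hx, Pi.smul_apply, h1, smul_eq_mul]; ring

/-- The graph of the operator `H`: the pairs `(y, -y'' + q y)` in `L²(ℝ)` with `y`, `y'` locally
absolutely continuous. -/
def lineGraph (q : ℝ → ℂ) : Submodule ℂ (L2Line × L2Line) where
  carrier := {p | ∃ f f₁ f₂ : ℝ → ℂ, (∀ a b : ℝ, a ≤ b → TwiceAC a b f f₁ f₂) ∧
    (∀ᵐ x : ℝ, p.1 x = f x) ∧ ∀ᵐ x : ℝ, p.2 x = -f₂ x + q x * f x}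
  zero_mem' := by
    refine ⟨0, 0, 0, fun a b _ => TwiceAC.zero a b, ?_, ?_⟩
    · filter_upwards [Lp.coeFn_zero ℂ 2 (volume : Measure ℝ)] with x hx
      simpa using hx
    · filter_upwards [Lp.coeFn_zero ℂ 2 (volume : Measure ℝ)] with x hx
      simpa using hx
  add_mem' := by
    rintro p r ⟨f, f₁, f₂, hf, hp1, hp2⟩ ⟨g, g₁, g₂, hg, hr1, hr2⟩
    refine ⟨f + g, f₁ + g₁, f₂ + g₂, fun a b hab => (hf a b hab).add hab (hg a b hab), ?_, ?_⟩
    · filter_upwards [Lp.coeFn_add p.1 r.1, hp1, hr1] with x hx h1 h2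
      simp only [Prod.fst_add, hx, Pi.add_apply, h1, h2]
    · filter_upwards [Lp.coeFn_add p.2 r.2, hp2, hr2] with x hx h1 h2
      simp only [Prod.snd_add, hx, Pi.add_apply, h1, h2]; ring
  smul_mem' := by
    rintro c p ⟨f, f₁, f₂, hf, hp1, hp2⟩
    refine ⟨c • f, c • f₁, c • f₂, fun a b hab => (hf a b hab).smul c, ?_, ?_⟩
    · filter_upwards [Lp.coeFn_smul c p.1, hp1] with x hx h1
      simp only [Prod.smul_fst, hx, Pi.smul_apply, h1]
    · filter_upwards [Lp.coeFn_smul c p.2, hp2] with x hx h1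
      simp only [Prod.smul_snd, hx, Pi.smul_apply, h1, smul_eq_mul]; ring

/-- The operator `H_t` in `L²(0, 1)`, generated by `-y'' + q y` and the boundary conditions
`y(1) = e^{it} y(0)`, `y'(1) = e^{it} y'(0)`. -/
noncomputable def fibreOp (q : ℝ → ℂ) (t : ℝ) : L2Unit →ₗ.[ℂ] L2Unit :=
  (fibreGraph q t).toLinearPMap

/-- The Hill operator `H` generated by `-y'' + q y` in `L²(ℝ)`. -/
noncomputable def lineOp (q : ℝ → ℂ) : L2Line →ₗ.[ℂ] L2Line :=
  (lineGraph q).toLinearPMap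

theorem fibreOp_graph (q : ℝ → ℂ) (t : ℝ) : (fibreOp q t).graph = fibreGraph q t := by
  refine Submodule.toLinearPMap_graph_eq _ ?_
  rintro ⟨y, z⟩ ⟨f, f₁, f₂, hf, -, -, h1, h2⟩ (rfl : y = 0)
  have h0 : ∀ᵐ x ∂volume.restrict (Ioc (0 : ℝ) 1), f x = 0 := by
    filter_upwards [h1, Lp.coeFn_zero ℂ 2 (volume.restrict (Ioc (0 : ℝ) 1))] with x hx hx0
    rw [← hx]; simpa using hx0
  apply Lp.ext
  filter_upwards [h2, h0, hf.ae_zero zero_le_one h0,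
    Lp.coeFn_zero ℂ 2 (volume.restrict (Ioc (0 : ℝ) 1))] with x hx hx0 hx2 hz
  rw [hz, hx, hx0, hx2]; simp

theorem lineOp_graph (q : ℝ → ℂ) : (lineOp q).graph = lineGraph q := by
  refine Submodule.toLinearPMap_graph_eq _ ?_
  rintro ⟨y, z⟩ ⟨f, f₁, f₂, hf, h1, h2⟩ (rfl : y = 0)
  have h0 : ∀ᵐ x : ℝ, f x = 0 := by
    filter_upwards [h1, Lp.coeFn_zero ℂ 2 (volume : Measure ℝ)] with x hx hx0
    rw [← hx]; simpa using hx0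
  have hn : ∀ᵐ x : ℝ, ∀ n : ℕ, x ∈ Ioc (-(n : ℝ)) n → f₂ x = 0 := by
    rw [ae_all_iff]
    intro n
    rw [← ae_restrict_iff' measurableSet_Ioc]
    have hnn : -(n : ℝ) ≤ n := by linarith [(Nat.cast_nonneg n : (0 : ℝ) ≤ n)]
    exact (hf _ _ hnn).ae_zero hnn (ae_restrict_of_ae h0)
  apply Lp.ext
  filter_upwards [h2, h0, hn, Lp.coeFn_zero ℂ 2 (volume : Measure ℝ)] with x hx hx0 hx2 hz
  obtain ⟨n, hn⟩ := exists_nat_gt |x|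
  rw [hz, hx, hx0, hx2 n ⟨(abs_lt.1 hn).1, (abs_lt.1 hn).2.le⟩]; simp

/-- `w` is a spectral singularity of `H`: it lies in the spectrum of `H` and, in every disc about
`w`, the spectral projections of the operators `H_t`, `t ∈ [0, 2π)`, for the simple eigenvalues in
that disc are not uniformly bounded. -/
def IsSpectralSingularity (q : ℝ → ℂ) (w : ℂ) : Prop :=
  w ∈ UnboundedOp.spectrum (lineOp q) ∧
    ∀ ε : ℝ, 0 < ε → ¬ ∃ C : ℝ, ∀ t ∈ Ico (0 : ℝ) (2 * Real.pi), ∀ z ∈ Metric.ball w ε,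
      UnboundedOp.IsSimpleEigenvalue (fibreOp q t) z →
        ∀ P : L2Unit →L[ℂ] L2Unit, UnboundedOp.IsSpectralProjection (fibreOp q t) z P → ‖P‖ ≤ C

/-- The punctured interval `(s - δ, s) ∪ (s, s + δ)`. -/
def puncturedNhd (s δ : ℝ) : Set ℝ := Ioo (s - δ) s ∪ Ioo s (s + δ)

/-- `ev` is a continuous branch, on the punctured `δ`-neighbourhood of `s`, of simple eigenvalues
`ev t` of `H_t`, with normalized eigenfunctions `Ψ t` of `H_t` and `Ψs t` of the adjoint of `H_t`
(for the eigenvalue conjugate to `ev t`). -/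
structure IsSimpleBranch (q : ℝ → ℂ) (s δ : ℝ) (ev : ℝ → ℂ) (Ψ Ψs : ℝ → L2Unit) : Prop where
  continuousOn : ContinuousOn ev (puncturedNhd s δ)
  simple : ∀ t ∈ puncturedNhd s δ, UnboundedOp.IsSimpleEigenvalue (fibreOp q t) (ev t)
  eigen : ∀ t ∈ puncturedNhd s δ, UnboundedOp.IsNormalizedEigenvector (fibreOp q t) (ev t) (Ψ t)
  adjoint_eigen : ∀ t ∈ puncturedNhd s δ, UnboundedOp.IsNormalizedEigenvector
    (fibreOp q t).adjoint (starRingEnd ℂ (ev t)) (Ψs t)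

/-- `w` is an essential spectral singularity of `H`: it lies in the spectrum of `H`, and for some
quasimomentum `s ∈ (-π, π]` with `w ∈ σ(H_s)` there is a branch of simple eigenvalues near `s`
that tends to `w` and for which `1 / |α|`, where `α(t) = (Ψs t, Ψ t)`, is not integrable on any
punctured neighbourhood of `s`. -/
def IsEssentialSpectralSingularity (q : ℝ → ℂ) (w : ℂ) : Prop :=
  w ∈ UnboundedOp.spectrum (lineOp q) ∧
    ∃ s ∈ Ioc (-Real.pi) Real.pi, w ∈ UnboundedOp.spectrum (fibreOp q s) ∧
      ∃ δ : ℝ, 0 < δ ∧ ∃ (ev : ℝ → ℂ) (Ψ Ψs : ℝ → L2Unit), IsSimpleBranch q s δ ev Ψ Ψs ∧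
        Tendsto ev (𝓝[≠] s) (𝓝 w) ∧
        ∀ η ∈ Ioc 0 δ, ∫⁻ t in puncturedNhd s η, ‖inner ℂ (Ψs t) (Ψ t)‖ₑ⁻¹ = ⊤

end Hill

namespace Hill

/-! ### Primitives of integrable functions -/

/-! Let M(z) be the monodromy map of -y'' + qy = zy, F = tr M the discriminant and μ = e^{it}. The
Wronskian gives det M = 1, so the characteristic polynomial of M at μ is μ(2 cos t - F(z)), and z
lies in σ(H_t) exactly when F(z) = 2 cos t. Everything is read off from the adjugate of M - μ. Its
values are initial data of Bloch solutions when F(z) = 2 cos t, and Jacobi's formula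
(`adjugate_monodromyDeriv`) says that for an eigenvector a of M the vector M'(z)a is sent to
-μF'(z)a. Since M'(z)a is also the end value of the problem whose source is the eigenfunction
itself, F'(z) ≠ 0 excludes associated functions. Hence a multiple eigenvalue λ₀ is a zero of F'.

Spectral singularity. If sin t₀ ≠ 0, then M(λ₀) ≠ μ, because otherwise the real number F(λ₀) would
equal 2μ. So some adjugate value is nonzero at λ₀, and it yields Bloch functions ψ(z, t), jointly
continuous and nonzero at (λ₀, t₀). As F'(λ₀) = 0, for t near t₀ the value 2 cos t is taken at two
distinct points z₁, z₂ near λ₀ (`exists_two_preimages`). The projection at z₁ fixes ψ(z₁, t) and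
kills ψ(z₂, t), while both vectors are close to ψ(λ₀, t₀); its norm therefore blows up
(`not_bounded_projections`).

Not essential. On a branch λ(t) one has |F'(λ(t))| ≤ B|α(t)| with B locally bounded
(`norm_deriv_discriminant_le`). An analytic function satisfies |F - F(λ₀)|^p ≤ C|F'| near λ₀ with
some p < 1 (`exists_rpow_norm_sub_le_norm_deriv`). On the branch |F - F(λ₀)| = |2 cos t - 2 cos s| ≥
|sin s| |t - s|, so 1/|α(t)| ≤ K|t - s|^{-p}, which is integrable.

Two facts about the operators are needed besides. The adjoint of H_t is meaningful because the
domain is dense, which follows from the Lagrange identity and from a real half-line free of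
eigenvalues. Membership in σ(H) comes from cutting off a Bloch wave (`mem_spectrum_lineOp`). -/

theorem absolutelyContinuousOnInterval_primitive
    {𝕜 : Type*} [RCLike 𝕜] {a b : ℝ} {W : ℝ → 𝕜} (hW : IntervalIntegrable W volume a b) :
    AbsolutelyContinuousOnInterval (fun x => ∫ s in a..x, W s) a b := by
  have h := hW.norm.absolutelyContinuousOnInterval_intervalIntegral left_mem_uIcc
  unfold AbsolutelyContinuousOnInterval at h ⊢
  -- The increments of the primitive of W are dominated by those of the primitive of ‖W‖, whose
  -- absolute continuity is available.
  refine squeeze_zero' (Eventually.of_forall fun _ => Finset.sum_nonneg fun i _ => dist_nonneg) ?_ h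
  rw [eventually_inf_principal]
  filter_upwards with E hE
  have hI : ∀ {x y}, x ∈ uIcc a b → y ∈ uIcc a b → IntervalIntegrable W volume x y :=
    fun hx hy => hW.mono_set (uIcc_subset_uIcc hx hy)
  refine Finset.sum_le_sum fun i hi => ?_
  obtain ⟨h1, h2⟩ := hE.1 i hi
  rw [dist_eq_norm, dist_eq_norm, intervalIntegral.integral_interval_sub_left
    (hI left_mem_uIcc h1) (hI left_mem_uIcc h2), intervalIntegral.integral_interval_sub_left
    (hI left_mem_uIcc h1).norm (hI left_mem_uIcc h2).norm]
  exact intervalIntegral.norm_integral_le_abs_integral_norm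

/-- `u` is a primitive of the integrable function `U` on `[a, b]`. -/
structure IsPrimitiveOn {𝕜 : Type*} [RCLike 𝕜] (a b : ℝ) (u U : ℝ → 𝕜) : Prop where
  integrable : IntervalIntegrable U volume a b
  eq : ∀ x ∈ Icc a b, u x = u a + ∫ s in a..x, U s

namespace IsPrimitiveOn

variable {𝕜 : Type*} [RCLike 𝕜] {a b : ℝ} {u U v V : ℝ → 𝕜}

theorem continuousOn (hab : a ≤ b) (h : IsPrimitiveOn a b u U) : ContinuousOn u (Icc a b) := by
  have h1 : ContinuousOn (fun x => u a + ∫ s in a..x, U s) (Icc a b) := by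
    have := intervalIntegral.continuousOn_primitive_interval' h.integrable left_mem_uIcc
    rw [uIcc_of_le hab] at this
    exact continuousOn_const.add this
  exact h1.congr h.eq

theorem of_integral (hU : IntervalIntegrable U volume a b) (c : 𝕜) :
    IsPrimitiveOn a b (fun x => c + ∫ s in a..x, U s) U :=
  ⟨hU, fun x _ => by simp⟩

theorem congr (h : IsPrimitiveOn a b u U) (hab : a ≤ b) (hu : ∀ x ∈ Icc a b, v x = u x)
    (hU : ∀ᵐ x ∂volume.restrict (Ioc a b), V x = U x) : IsPrimitiveOn a b v V := by
  have hU' : U =ᵐ[volume.restrict (Ioc a b)] V := by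
    filter_upwards [hU] with x hx using hx.symm
  refine ⟨?_, fun x hx => ?_⟩
  · refine h.integrable.congr_ae ?_
    rwa [uIoc_of_le hab]
  · rw [hu x hx, hu a (left_mem_Icc.2 hab), h.eq x hx]
    congr 1
    refine intervalIntegral.integral_congr_ae_restrict ?_
    rw [uIoc_of_le hx.1]
    exact ae_restrict_of_ae_restrict_of_subset (Ioc_subset_Ioc_right hx.2) hU'

/-- The product rule. -/
theorem mul (hab : a ≤ b) (hu : IsPrimitiveOn a b u U) (hv : IsPrimitiveOn a b v V) :
    IsPrimitiveOn a b (fun x => u x * v x) (fun x => U x * v x + u x * V x) := by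
  have hcu : ContinuousOn u (uIcc a b) := by rw [uIcc_of_le hab]; exact hu.continuousOn hab
  have hcv : ContinuousOn v (uIcc a b) := by rw [uIcc_of_le hab]; exact hv.continuousOn hab
  have hI : IntervalIntegrable (fun x => U x * v x + u x * V x) volume a b :=
    (hu.integrable.mul_continuousOn hcv).add (hv.integrable.continuousOn_mul hcu)
  refine ⟨hI, ?_⟩
  have hac : ∀ {W : ℝ → 𝕜} (c : 𝕜), IntervalIntegrable W volume a b →
      AbsolutelyContinuousOnInterval (fun x => c + ∫ s in a..x, W s) a b := fun {W} c hW => by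
    have h1 : AbsolutelyContinuousOnInterval (fun _ : ℝ => c) a b :=
      (LipschitzOnWith.absolutelyContinuousOnInterval (K := 0)
        (LipschitzWith.const c).lipschitzOnWith)
    exact h1.fun_add (absolutelyContinuousOnInterval_primitive hW)
  obtain ⟨iu, hiu⟩ : ∃ iu : ℝ → 𝕜, iu = fun x => u a + ∫ s in a..x, U s := ⟨_, rfl⟩
  obtain ⟨iv, hiv⟩ : ∃ iv : ℝ → 𝕜, iv = fun x => v a + ∫ s in a..x, V s := ⟨_, rfl⟩
  obtain ⟨iw, hiw⟩ : ∃ iw : ℝ → 𝕜, iw = fun x => 0 + ∫ s in a..x, (U s * v s + u s * V s) :=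
    ⟨_, rfl⟩
  have hu1 : AbsolutelyContinuousOnInterval iu a b := by rw [hiu]; exact hac _ hu.integrable
  have hv1 : AbsolutelyContinuousOnInterval iv a b := by rw [hiv]; exact hac _ hv.integrable
  have hw1 : AbsolutelyContinuousOnInterval iw a b := by rw [hiw]; exact hac _ hI
  have hu2 : ∀ x ∈ Icc a b, u x = iu x := by rw [hiu]; exact hu.eq
  have hv2 : ∀ x ∈ Icc a b, v x = iv x := by rw [hiv]; exact hv.eq
  -- The difference between the product and the candidate primitive is absolutely continuous with
  -- derivative zero almost everywhere, hence constant. The integrals `iu`, `iv` stand in for u, v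
  -- because these are controlled only on [a, b], which gives no two-sided derivative at the ends.
  have hg : AbsolutelyContinuousOnInterval (fun x => iu x • iv x - iw x) a b :=
    (hu1.fun_smul hv1).fun_sub hw1
  have hd : ∀ᵐ x, x ∈ uIcc a b → HasDerivAt (fun x => iu x • iv x - iw x) 0 x := by
    filter_upwards [hu.integrable.ae_hasDerivAt_integral, hv.integrable.ae_hasDerivAt_integral,
      hI.ae_hasDerivAt_integral] with x h1 h2 h3 hx
    have e1 : HasDerivAt iu (U x) x := by
      rw [hiu]; exact (h1 hx a left_mem_uIcc).const_add (u a)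
    have e2 : HasDerivAt iv (V x) x := by
      rw [hiv]; exact (h2 hx a left_mem_uIcc).const_add (v a)
    have e3 : HasDerivAt iw (U x * v x + u x * V x) x := by
      rw [hiw]; exact (h3 hx a left_mem_uIcc).const_add 0
    have hx' : x ∈ Icc a b := by rwa [uIcc_of_le hab] at hx
    have := (e1.fun_mul e2).fun_sub e3
    rw [← hu2 x hx', ← hv2 x hx', sub_self] at this
    exact this
  obtain ⟨C, hC⟩ := hg.const_of_ae_hasDerivAt_zero hd
  intro x hx
  have ha : a ∈ Icc a b := left_mem_Icc.2 hab
  have h1 := hC x (by rwa [uIcc_of_le hab])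
  have h2 := hC a left_mem_uIcc
  simp only [smul_eq_mul] at h1 h2
  rw [← hu2 x hx, ← hv2 x hx] at h1
  rw [← hu2 a ha, ← hv2 a ha] at h2
  simp only [hiw, intervalIntegral.integral_same, zero_add] at h1 h2
  linear_combination h1 - h2

theorem add (hab : a ≤ b) (hu : IsPrimitiveOn a b u U) (hv : IsPrimitiveOn a b v V) :
    IsPrimitiveOn a b (fun x => u x + v x) (fun x => U x + V x) := by
  have sub : ∀ x ∈ Icc a b, uIcc a x ⊆ uIcc a b := fun x hx => by
    rw [uIcc_of_le hab, uIcc_of_le hx.1]; exact Icc_subset_Icc_right hx.2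
  refine ⟨hu.integrable.add hv.integrable, fun x hx => ?_⟩
  rw [intervalIntegral.integral_add (hu.integrable.mono_set (sub x hx))
    (hv.integrable.mono_set (sub x hx)), hu.eq x hx, hv.eq x hx]
  ring

theorem const_mul (c : 𝕜) (hu : IsPrimitiveOn a b u U) :
    IsPrimitiveOn a b (fun x => c * u x) (fun x => c * U x) := by
  refine ⟨hu.integrable.const_mul c, fun x hx => ?_⟩
  simp only [intervalIntegral.integral_const_mul]
  rw [hu.eq x hx, mul_add]

theorem sub (hab : a ≤ b) (hu : IsPrimitiveOn a b u U) (hv : IsPrimitiveOn a b v V) :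
    IsPrimitiveOn a b (fun x => u x - v x) (fun x => U x - V x) := by
  have := hu.add hab (hv.const_mul (-1))
  simpa [sub_eq_add_neg] using this

theorem integral_eq (hab : a ≤ b) (hu : IsPrimitiveOn a b u U) :
    ∫ s in a..b, U s = u b - u a := by
  rw [hu.eq b (right_mem_Icc.2 hab)]; ring

/-- The power rule. -/
theorem pow_succ (hab : a ≤ b) (hu : IsPrimitiveOn a b u U) (n : ℕ) :
    IsPrimitiveOn a b (fun x => u x ^ (n + 1)) (fun x => (n + 1) * (u x ^ n * U x)) := by
  induction n with
  | zero => simpa using hu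
  | succ n ih =>
    have := ih.mul hab hu
    refine this.congr hab (fun x _ => by ring) (ae_of_all _ fun x => ?_)
    push_cast; ring

theorem mono {c d : ℝ} (hu : IsPrimitiveOn a b u U) (hac : a ≤ c) (hcd : c ≤ d) (hdb : d ≤ b) :
    IsPrimitiveOn c d u U := by
  have hI : ∀ {x y}, x ∈ Icc a b → y ∈ Icc a b → IntervalIntegrable U volume x y :=
    fun hx hy => hu.integrable.mono_set (by
      rw [uIcc_of_le (hac.trans (hcd.trans hdb))]
      exact uIcc_subset_Icc hx hy)
  have hc : c ∈ Icc a b := ⟨hac, hcd.trans hdb⟩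
  refine ⟨hI hc ⟨hac.trans hcd, hdb⟩, fun x hx => ?_⟩
  have hx' : x ∈ Icc a b := ⟨hac.trans hx.1, hx.2.trans hdb⟩
  have ha : a ∈ Icc a b := left_mem_Icc.2 (hac.trans (hcd.trans hdb))
  rw [hu.eq x hx', hu.eq c hc, add_assoc,
    intervalIntegral.integral_add_adjacent_intervals (hI ha hc) (hI hc hx')]

end IsPrimitiveOn

theorem IsPrimitiveOn.conj {a b : ℝ} {u U : ℝ → ℂ} (hu : IsPrimitiveOn a b u U) :
    IsPrimitiveOn a b (fun x => starRingEnd ℂ (u x)) (fun x => starRingEnd ℂ (U x)) := by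
  refine ⟨?_, fun x hx => ?_⟩
  · exact ⟨Complex.conjCLE.toContinuousLinearMap.integrable_comp hu.integrable.1,
      Complex.conjCLE.toContinuousLinearMap.integrable_comp hu.integrable.2⟩
  · rw [hu.eq x hx, map_add, intervalIntegral.integral_of_le hx.1,
      intervalIntegral.integral_of_le hx.1, integral_conj]

theorem TwiceAC.isPrimitiveOn_deriv {a b : ℝ} {f f₁ f₂ : ℝ → ℂ} (h : TwiceAC a b f f₁ f₂) :
    IsPrimitiveOn a b f₁ f₂ := ⟨h.integrable, h.deriv_eq⟩

theorem TwiceAC.isPrimitiveOn {a b : ℝ} {f f₁ f₂ : ℝ → ℂ} (hab : a ≤ b)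
    (h : TwiceAC a b f f₁ f₂) : IsPrimitiveOn a b f f₁ := ⟨h.deriv_integrable hab, h.eq⟩

theorem IsPrimitiveOn.twiceAC {a b : ℝ} {f f₁ f₂ : ℝ → ℂ} (h : IsPrimitiveOn a b f f₁)
    (h₁ : IsPrimitiveOn a b f₁ f₂) : TwiceAC a b f f₁ f₂ := ⟨h₁.integrable, h₁.eq, h.eq⟩

end Hill

namespace Hill

/-! ### Volterra operators on `C[0, 1]` and the initial value problem -/

/-- The Banach space `C[0, 1]`. -/
def CUnit : Type := C(Icc (0 : ℝ) 1, ℂ)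

namespace CUnit

noncomputable instance : NormedAddCommGroup CUnit :=
  inferInstanceAs (NormedAddCommGroup C(Icc (0 : ℝ) 1, ℂ))

noncomputable instance : NormedSpace ℂ CUnit :=
  inferInstanceAs (NormedSpace ℂ C(Icc (0 : ℝ) 1, ℂ))

instance : CompleteSpace CUnit := inferInstanceAs (CompleteSpace C(Icc (0 : ℝ) 1, ℂ))

instance : FunLike CUnit (Icc (0 : ℝ) 1) ℂ :=
  inferInstanceAs (FunLike C(Icc (0 : ℝ) 1, ℂ) (Icc (0 : ℝ) 1) ℂ)

@[ext]
theorem ext_apply {y z : CUnit} (h : ∀ x, y x = z x) : y = z := DFunLike.ext _ _ h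

@[simp]
theorem add_apply (y z : CUnit) (x : Icc (0 : ℝ) 1) : (y + z) x = y x + z x := rfl

@[simp]
theorem sub_apply (y z : CUnit) (x : Icc (0 : ℝ) 1) : (y - z) x = y x - z x := rfl

@[simp]
theorem smul_apply (c : ℂ) (y : CUnit) (x : Icc (0 : ℝ) 1) : (c • y) x = c * y x := rfl

protected theorem continuous (y : CUnit) : Continuous y := ContinuousMap.continuous y

theorem norm_apply_le (y : CUnit) (x : Icc (0 : ℝ) 1) : ‖y x‖ ≤ ‖y‖ :=
  ContinuousMap.norm_coe_le_norm y x

protected theorem norm_le (y : CUnit) {C : ℝ} (hC : 0 ≤ C) (h : ∀ x, ‖y x‖ ≤ C) : ‖y‖ ≤ C :=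
  (ContinuousMap.norm_le y hC).2 h

end CUnit

/-- The extension of a function in `C[0, 1]` by its end values. -/
noncomputable def ext (y : CUnit) : ℝ → ℂ := IccExtend zero_le_one y

theorem continuous_ext (y : CUnit) : Continuous (ext y) := y.continuous.Icc_extend'

theorem ext_of_mem (y : CUnit) {x : ℝ} (hx : x ∈ Icc (0 : ℝ) 1) : ext y x = y ⟨x, hx⟩ :=
  IccExtend_of_mem _ _ hx

theorem ext_add (y z : CUnit) (x : ℝ) : ext (y + z) x = ext y x + ext z x := rfl

theorem ext_smul (c : ℂ) (y : CUnit) (x : ℝ) : ext (c • y) x = c * ext y x := rfl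

theorem norm_ext_le (y : CUnit) (x : ℝ) : ‖ext y x‖ ≤ ‖y‖ := y.norm_apply_le _

theorem intervalIntegrable_mul_ext {g : ℝ → ℂ} (hg : IntervalIntegrable g volume 0 1)
    (y : CUnit) : IntervalIntegrable (fun s => g s * ext y s) volume 0 1 :=
  hg.mul_continuousOn (continuous_ext y).continuousOn

theorem intervalIntegrable_of_mem {g : ℝ → ℂ} (hg : IntervalIntegrable g volume 0 1)
    {x : ℝ} (hx : x ∈ Icc (0 : ℝ) 1) : IntervalIntegrable g volume 0 x :=
  hg.mono_set (by rw [uIcc_of_le hx.1, uIcc_of_le zero_le_one]; exact Icc_subset_Icc_right hx.2)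

/-- The primitive `x ↦ ∫₀ˣ g` as an element of `C[0, 1]`. -/
noncomputable def primitive (g : ℝ → ℂ) (hg : IntervalIntegrable g volume 0 1) : CUnit :=
  ContinuousMap.mk (fun x : Icc (0 : ℝ) 1 => ∫ s in (0 : ℝ)..x, g s) <| by
    have := intervalIntegral.continuousOn_primitive_interval' hg left_mem_uIcc
    rw [uIcc_of_le zero_le_one] at this
    exact continuousOn_iff_continuous_domRestrict.1 this

theorem primitive_apply {g : ℝ → ℂ} (hg : IntervalIntegrable g volume 0 1) (x : Icc (0 : ℝ) 1) :
    primitive g hg x = ∫ s in (0 : ℝ)..x, g s := rfl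

theorem norm_integral_mul_ext_le {g : ℝ → ℂ} (hg : IntervalIntegrable g volume 0 1) (y : CUnit)
    {x : ℝ} (hx : x ∈ Icc (0 : ℝ) 1) :
    ‖∫ s in (0 : ℝ)..x, g s * ext y s‖ ≤ (∫ s in (0 : ℝ)..1, ‖g s‖) * ‖y‖ := by
  have h1 : ‖∫ s in (0 : ℝ)..x, g s * ext y s‖ ≤ ∫ s in (0 : ℝ)..x, ‖g s‖ * ‖y‖ := by
    refine intervalIntegral.norm_integral_le_of_norm_le hx.1 (ae_of_all _ fun s _ => ?_)
      ((intervalIntegrable_of_mem hg hx).norm.mul_const _)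
    rw [norm_mul]
    gcongr
    exact norm_ext_le y s
  rw [intervalIntegral.integral_mul_const] at h1
  refine h1.trans (mul_le_mul_of_nonneg_right ?_ (norm_nonneg _))
  exact intervalIntegral.integral_mono_interval le_rfl hx.1 hx.2
    (ae_of_all _ fun _ => norm_nonneg _) hg.norm

/-- The Volterra operator `y ↦ ∫₀ˣ g y` on `C[0, 1]`. -/
noncomputable def mulPrimitive (g : ℝ → ℂ) (hg : IntervalIntegrable g volume 0 1) :
    CUnit →L[ℂ] CUnit :=
  LinearMap.mkContinuous
    { toFun := fun y => primitive (fun s => g s * ext y s) (intervalIntegrable_mul_ext hg y)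
      map_add' := fun y z => by
        ext x
        have hx := x.2
        simp only [primitive_apply, CUnit.add_apply, ext_add, mul_add]
        exact intervalIntegral.integral_add
          (intervalIntegrable_of_mem (intervalIntegrable_mul_ext hg y) hx)
          (intervalIntegrable_of_mem (intervalIntegrable_mul_ext hg z) hx)
      map_smul' := fun c y => by
        ext x
        simp only [primitive_apply, CUnit.smul_apply, ext_smul, RingHom.id_apply]
        rw [← intervalIntegral.integral_const_mul]
        congr 1; ext s; ring }
    (∫ s in (0 : ℝ)..1, ‖g s‖) fun y => by
      refine CUnit.norm_le _ ?_ fun x => ?_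
      · exact mul_nonneg (intervalIntegral.integral_nonneg zero_le_one
          fun _ _ => norm_nonneg _) (norm_nonneg _)
      · exact norm_integral_mul_ext_le hg y x.2

theorem mulPrimitive_apply {g : ℝ → ℂ} (hg : IntervalIntegrable g volume 0 1) (y : CUnit)
    (x : Icc (0 : ℝ) 1) : mulPrimitive g hg y x = ∫ s in (0 : ℝ)..x, g s * ext y s := rfl

/-- The state space of the first order system for `(y, y')`. -/
abbrev State : Type := CUnit × CUnit

theorem intervalIntegrable_one : IntervalIntegrable (fun _ : ℝ => (1 : ℂ)) volume 0 1 :=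
  intervalIntegrable_const

/-- The operator `y ↦ ∫₀ˣ y` on `C[0, 1]`. -/
noncomputable def integ : CUnit →L[ℂ] CUnit := mulPrimitive (fun _ => 1) intervalIntegrable_one

/-- The part of the Volterra operator of the system for `(y, y')` that multiplies `-z`. -/
noncomputable def spectralPart : State →L[ℂ] State :=
  ContinuousLinearMap.prod 0 (integ.comp (ContinuousLinearMap.fst ℂ CUnit CUnit))

variable {q : ℝ → ℂ} (hq : IntervalIntegrable q volume 0 1)

/-- The Volterra operator `(y, y₁) ↦ (∫₀ˣ y₁, ∫₀ˣ (q - z) y)`. -/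
noncomputable def volterra (z : ℂ) : State →L[ℂ] State :=
  ContinuousLinearMap.prod (integ.comp (ContinuousLinearMap.snd ℂ CUnit CUnit))
    ((mulPrimitive q hq).comp (ContinuousLinearMap.fst ℂ CUnit CUnit)) - z • spectralPart

theorem volterra_fst (z : ℂ) (Y : State) (x : Icc (0 : ℝ) 1) :
    (volterra hq z Y).1 x = ∫ s in (0 : ℝ)..x, ext Y.2 s := by
  simp [volterra, spectralPart, integ, mulPrimitive_apply]

theorem volterra_snd (z : ℂ) (Y : State) (x : Icc (0 : ℝ) 1) :
    (volterra hq z Y).2 x = ∫ s in (0 : ℝ)..x, (q s - z) * ext Y.1 s := by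
  have h1 := intervalIntegrable_of_mem (intervalIntegrable_mul_ext hq Y.1) x.2
  have h2 := intervalIntegrable_of_mem
    ((intervalIntegrable_mul_ext intervalIntegrable_one Y.1).const_mul z) x.2
  simp only [volterra, spectralPart, integ, sub_apply,
    ContinuousLinearMap.prod_apply, smul_apply, Prod.snd_sub, Prod.smul_snd,
    ContinuousLinearMap.comp_apply, ContinuousLinearMap.coe_fst', CUnit.sub_apply,
    CUnit.smul_apply, mulPrimitive_apply]
  rw [← intervalIntegral.integral_const_mul, ← intervalIntegral.integral_sub h1 h2]
  congr 1; ext s; ring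

theorem weight_integrable (hq : IntervalIntegrable q volume 0 1) (z : ℂ) :
    IntervalIntegrable (fun s => 1 + ‖q s‖ + ‖z‖) volume 0 1 :=
  (intervalIntegrable_const.add hq.norm).add intervalIntegrable_const

/-- Iterates of the Volterra operator decay factorially. -/
theorem norm_volterra_pow_apply_le (z : ℂ) (Y : State) (n : ℕ) :
    ∀ x : Icc (0 : ℝ) 1,
      ‖((volterra hq z ^ n) Y).1 x‖ ≤
        (∫ s in (0 : ℝ)..x, (1 + ‖q s‖ + ‖z‖)) ^ n / n.factorial * ‖Y‖ ∧
      ‖((volterra hq z ^ n) Y).2 x‖ ≤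
        (∫ s in (0 : ℝ)..x, (1 + ‖q s‖ + ‖z‖)) ^ n / n.factorial * ‖Y‖ := by
  have hw := weight_integrable hq z
  set A : ℝ → ℝ := fun x => ∫ s in (0 : ℝ)..x, (1 + ‖q s‖ + ‖z‖) with hA
  have hprim : IsPrimitiveOn 0 1 A (fun s => 1 + ‖q s‖ + ‖z‖) :=
    ⟨hw, fun x _ => by simp [hA]⟩
  induction n with
  | zero =>
    intro x
    simp only [pow_zero, Nat.factorial_zero, Nat.cast_one, div_one, one_mul]
    exact ⟨(Y.1.norm_apply_le x).trans (norm_fst_le Y),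
      (Y.2.norm_apply_le x).trans (norm_snd_le Y)⟩
  | succ n ih =>
    intro x
    have hx := x.2
    -- The weight A' = 1 + |q| + |z| dominates both kernels, 1 and q - z. Integrating A^n A' / n!
    -- gives A^(n+1) / (n+1)!, which is the induction step for either component.
    have hp := (hprim.pow_succ zero_le_one n).mono le_rfl hx.1 hx.2
    have hA0 : A 0 = 0 := by simp [hA]
    have hint : ∫ s in (0 : ℝ)..x, ((n + 1 : ℝ) * (A s ^ n * (1 + ‖q s‖ + ‖z‖)))
        = A x ^ (n + 1) := by
      rw [hp.integral_eq hx.1, hA0]; simp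
    have hI : IntervalIntegrable
        (fun s => A s ^ n * (1 + ‖q s‖ + ‖z‖) * (‖Y‖ / n.factorial)) volume 0 x := by
      have := (hp.integrable.const_mul ((n + 1 : ℝ)⁻¹)).mul_const (‖Y‖ / n.factorial)
      refine this.congr fun s _ => ?_
      have : (n + 1 : ℝ) ≠ 0 := by positivity
      field_simp
    have hval : ∫ s in (0 : ℝ)..x, A s ^ n * (1 + ‖q s‖ + ‖z‖) * (‖Y‖ / n.factorial)
        = A x ^ (n + 1) / (n + 1).factorial * ‖Y‖ := by
      rw [← hint, intervalIntegral.integral_const_mul, intervalIntegral.integral_mul_const,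
        Nat.factorial_succ]
      push_cast
      have : (n + 1 : ℝ) ≠ 0 := by positivity
      have : (n.factorial : ℝ) ≠ 0 := by positivity
      field_simp
    have hAnn : ∀ s ∈ Ioc (0 : ℝ) x, 0 ≤ A s := fun s hs =>
      intervalIntegral.integral_nonneg hs.1.le fun _ _ => by positivity
    rw [pow_succ', mul_apply_eq_comp, volterra_fst, volterra_snd, ← hval]
    constructor
    · refine intervalIntegral.norm_integral_le_of_norm_le hx.1 (ae_of_all _ fun s hs => ?_) hI
      have hs' : s ∈ Icc (0 : ℝ) 1 := ⟨hs.1.le, hs.2.trans hx.2⟩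
      rw [ext_of_mem _ hs']
      refine (ih ⟨s, hs'⟩).2.trans ?_
      have h0 := pow_nonneg (hAnn s hs) n
      calc A s ^ n / n.factorial * ‖Y‖ = A s ^ n * 1 * (‖Y‖ / n.factorial) := by ring
        _ ≤ _ := by
          gcongr
          linarith [norm_nonneg (q s), norm_nonneg z]
    · refine intervalIntegral.norm_integral_le_of_norm_le hx.1 (ae_of_all _ fun s hs => ?_) hI
      have hs' : s ∈ Icc (0 : ℝ) 1 := ⟨hs.1.le, hs.2.trans hx.2⟩
      rw [ext_of_mem _ hs', norm_mul]
      have h0 := pow_nonneg (hAnn s hs) n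
      calc ‖q s - z‖ * _ ≤ (1 + ‖q s‖ + ‖z‖) * (A s ^ n / n.factorial * ‖Y‖) := by
            refine mul_le_mul ?_ (ih ⟨s, hs'⟩).1 (norm_nonneg _) (by positivity)
            linarith [norm_sub_le (q s) z]
        _ = _ := by ring

/-- 1 - xⁿ is the product of the commuting factors 1 - x and 1 + x + ... + xⁿ⁻¹, so its
invertibility passes to 1 - x. The norm of x itself may be large. -/
theorem isUnit_one_sub_of_norm_pow_lt_one {R : Type*} [NormedRing R] [HasSummableGeomSeries R]
    {x : R} {n : ℕ} (h : ‖x ^ n‖ < 1) : IsUnit (1 - x) := by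
  have h1 : IsUnit (1 - x ^ n) := isUnit_one_sub_of_norm_lt_one (R := R) h
  rw [← mul_neg_geom_sum] at h1
  refine ((Commute.isUnit_mul_iff ?_).1 h1).1
  exact (Commute.sum_right _ _ _ fun i _ =>
    ((Commute.one_left x).sub_left (Commute.refl x)).pow_right i)

/-- The bound aⁿ/n! on the powers drops below 1 for some n. Thus the initial value problem is
uniquely solvable for every z, with no smallness assumption on q. -/
theorem isUnit_one_sub_volterra (z : ℂ) : IsUnit (1 - volterra hq z) := by
  set a : ℝ := ∫ s in (0 : ℝ)..1, (1 + ‖q s‖ + ‖z‖)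
  have ha : 0 ≤ a := intervalIntegral.integral_nonneg zero_le_one fun _ _ => by positivity
  obtain ⟨n, hn⟩ := ((FloorSemiring.tendsto_pow_div_factorial_atTop a).eventually
    (gt_mem_nhds zero_lt_one)).exists
  refine isUnit_one_sub_of_norm_pow_lt_one (n := n) (lt_of_le_of_lt ?_ hn)
  refine ContinuousLinearMap.opNorm_le_bound _ (by positivity) fun Y => ?_
  have hle : ∀ x : Icc (0 : ℝ) 1, (∫ s in (0 : ℝ)..x, (1 + ‖q s‖ + ‖z‖)) ^ n / n.factorial * ‖Y‖
      ≤ a ^ n / n.factorial * ‖Y‖ := fun x => by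
    have h0 : 0 ≤ ∫ s in (0 : ℝ)..x, (1 + ‖q s‖ + ‖z‖) :=
      intervalIntegral.integral_nonneg x.2.1 fun _ _ => by positivity
    have : ∫ s in (0 : ℝ)..x, (1 + ‖q s‖ + ‖z‖) ≤ a :=
      intervalIntegral.integral_mono_interval le_rfl x.2.1 x.2.2
        (ae_of_all _ fun _ => by positivity) (weight_integrable hq z)
    gcongr
  rw [Prod.norm_def]
  refine max_le ?_ ?_
  · exact CUnit.norm_le _ (by positivity) fun x =>
      (norm_volterra_pow_apply_le hq z Y n x).1.trans (hle x)
  · exact CUnit.norm_le _ (by positivity) fun x =>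
      (norm_volterra_pow_apply_le hq z Y n x).2.trans (hle x)

/-- The solution operator `(1 - V)⁻¹` of the Volterra equation `Y = Y₀ + V Y`. -/
noncomputable def solver (z : ℂ) : State →L[ℂ] State := Ring.inverse (1 - volterra hq z)

theorem eq_solver_iff (z : ℂ) (Y Y₀ : State) :
    Y = solver hq z Y₀ ↔ Y = Y₀ + volterra hq z Y := by
  have hu := isUnit_one_sub_volterra hq z
  constructor
  · rintro rfl
    have := congrArg (fun L : State →L[ℂ] State => L Y₀) (Ring.mul_inverse_cancel _ hu)
    simp only [mul_apply_eq_comp, sub_apply,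
      one_apply_eq_self] at this
    rw [← sub_eq_iff_eq_add]
    exact this
  · intro h
    have := congrArg (fun L : State →L[ℂ] State => L Y) (Ring.inverse_mul_cancel _ hu)
    simp only [mul_apply_eq_comp, sub_apply,
      one_apply_eq_self] at this
    rw [← this, solver]
    congr 1
    nth_rewrite 1 [h]
    abel

theorem hasDerivAt_volterra (z : ℂ) : HasDerivAt (volterra hq) (-spectralPart) z := by
  have h := (hasDerivAt_id z).smul_const spectralPart
  rw [one_smul] at h
  exact h.const_sub (ContinuousLinearMap.prod
    (integ.comp (ContinuousLinearMap.snd ℂ CUnit CUnit))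
    ((mulPrimitive q hq).comp (ContinuousLinearMap.fst ℂ CUnit CUnit)))

/-- The operator depends affinely on z, and the derivative of an inverse is S ↦ -S(1 - V)'S. This is
the source of all analyticity in z. -/
theorem hasDerivAt_solver (z : ℂ) :
    HasDerivAt (solver hq) (-(solver hq z * spectralPart * solver hq z)) z := by
  obtain ⟨u, hu⟩ := isUnit_one_sub_volterra hq z
  have h1 : HasDerivAt (fun z => 1 - volterra hq z) spectralPart z := by
    simpa using (hasDerivAt_volterra hq z).const_sub (1 : State →L[ℂ] State)
  have h2 := hasFDerivAt_ringInverse (𝕜 := ℂ) u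
  rw [hu] at h2
  have h3 := h2.comp_hasDerivAt z h1
  have : solver hq z = ↑u⁻¹ := by rw [solver, ← hu, Ring.inverse_unit]
  rw [this]
  exact h3

theorem continuous_solver : Continuous (solver hq) :=
  continuous_iff_continuousAt.2 fun z => (hasDerivAt_solver hq z).continuousAt

end Hill

namespace Hill

/-! ### The initial value problem with a source in `L²(0, 1)` -/

theorem memLp_ext (y : CUnit) : MemLp (ext y) 2 (volume.restrict (Ioc (0 : ℝ) 1)) :=
  MemLp.of_bound (continuous_ext y).aestronglyMeasurable ‖y‖ (ae_of_all _ (norm_ext_le y))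

/-- The embedding `C[0, 1] → L²(0, 1)`. -/
noncomputable def toL2 : CUnit →L[ℂ] L2Unit :=
  LinearMap.mkContinuous
    { toFun := fun y => (memLp_ext y).toLp (ext y)
      map_add' := fun y z => (memLp_ext y).toLp_add (memLp_ext z)
      map_smul' := fun c y => (memLp_ext y).toLp_const_smul c }
    1 fun y => by
      have h := Lp.norm_le_of_ae_bound (f := (memLp_ext y).toLp (ext y)) (norm_nonneg y) (by
        filter_upwards [(memLp_ext y).coeFn_toLp] with x hx
        rw [hx]
        exact norm_ext_le y x)
      have h1 : (measureUnivNNReal (volume.restrict (Ioc (0 : ℝ) 1)) : ℝ) = 1 := by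
        simp [measureUnivNNReal]
      rw [h1, Real.one_rpow] at h
      exact h

theorem toL2_coeFn (y : CUnit) :
    ∀ᵐ x ∂volume.restrict (Ioc (0 : ℝ) 1), toL2 y x = ext y x := (memLp_ext y).coeFn_toLp

theorem L2Unit.integrable (h : L2Unit) : Integrable h (volume.restrict (Ioc (0 : ℝ) 1)) :=
  (Lp.memLp h).integrable one_le_two

theorem L2Unit.intervalIntegrable (h : L2Unit) : IntervalIntegrable h volume 0 1 :=
  (intervalIntegrable_iff_integrableOn_Ioc_of_le zero_le_one).2 (L2Unit.integrable h)

theorem L2Unit.integral_norm_le (h : L2Unit) : ∫ s in (0 : ℝ)..1, ‖h s‖ ≤ ‖h‖ := by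
  rw [intervalIntegral.integral_of_le zero_le_one, integral_norm_eq_lintegral_enorm
    (L2Unit.integrable h).1, Lp.norm_def, ← eLpNorm_one_eq_lintegral_enorm]
  have : IsProbabilityMeasure (volume.restrict (Ioc (0 : ℝ) 1)) := ⟨by simp⟩
  exact ENNReal.toReal_mono (Lp.eLpNorm_ne_top h)
    (eLpNorm_le_eLpNorm_of_exponent_le one_le_two (L2Unit.integrable h).1)

theorem intervalIntegral_congr_ae_unit {f g : ℝ → ℂ}
    (h : ∀ᵐ x ∂volume.restrict (Ioc (0 : ℝ) 1), f x = g x) {x : ℝ} (hx : x ∈ Icc (0 : ℝ) 1) :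
    ∫ s in (0 : ℝ)..x, f s = ∫ s in (0 : ℝ)..x, g s := by
  refine intervalIntegral.integral_congr_ae_restrict ?_
  rw [uIoc_of_le hx.1]
  exact ae_restrict_of_ae_restrict_of_subset (Ioc_subset_Ioc_right hx.2) h

/-- The operator `h ↦ ∫₀ˣ h` from `L²(0, 1)` to `C[0, 1]`. -/
noncomputable def integL2 : L2Unit →L[ℂ] CUnit :=
  LinearMap.mkContinuous
    { toFun := fun h => primitive h (L2Unit.intervalIntegrable h)
      map_add' := fun f g => by
        ext x
        rw [CUnit.add_apply, primitive_apply, primitive_apply, primitive_apply,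
          ← intervalIntegral.integral_add
            (intervalIntegrable_of_mem (L2Unit.intervalIntegrable f) x.2)
            (intervalIntegrable_of_mem (L2Unit.intervalIntegrable g) x.2)]
        exact intervalIntegral_congr_ae_unit (Lp.coeFn_add f g) x.2
      map_smul' := fun c f => by
        ext x
        rw [RingHom.id_apply, CUnit.smul_apply, primitive_apply, primitive_apply,
          ← intervalIntegral.integral_const_mul]
        exact intervalIntegral_congr_ae_unit (Lp.coeFn_smul c f) x.2 }
    1 fun h => by
      rw [one_mul]
      refine CUnit.norm_le _ (norm_nonneg _) fun x => ?_
      refine le_trans ?_ (L2Unit.integral_norm_le h)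
      refine (intervalIntegral.norm_integral_le_integral_norm x.2.1).trans ?_
      exact intervalIntegral.integral_mono_interval le_rfl x.2.1 x.2.2
        (ae_of_all _ fun _ => norm_nonneg _) (L2Unit.intervalIntegrable h).norm

theorem integL2_apply (h : L2Unit) (x : Icc (0 : ℝ) 1) :
    integL2 h x = ∫ s in (0 : ℝ)..x, h s := rfl

/-- The constants in `C[0, 1]`. -/
noncomputable def constC : ℂ →L[ℂ] CUnit :=
  LinearMap.mkContinuous
    { toFun := fun c => ContinuousMap.const (Icc (0 : ℝ) 1) c
      map_add' := fun _ _ => rfl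
      map_smul' := fun _ _ => rfl }
    1 fun c => by
      rw [one_mul]
      exact CUnit.norm_le _ (norm_nonneg _) fun x => le_rfl

@[simp]
theorem constC_apply (c : ℂ) (x : Icc (0 : ℝ) 1) : constC c x = c := rfl

/-- The constant states. -/
noncomputable def initial : ℂ × ℂ →L[ℂ] State := constC.prodMap constC

/-- The inhomogeneity `(0, -∫₀ˣ h)` of the system that belongs to `-y'' + (q - z) y = h`. -/
noncomputable def source : L2Unit →L[ℂ] State := ContinuousLinearMap.prod 0 (-integL2)

@[simp]
theorem initial_fst_apply (c : ℂ × ℂ) (x : Icc (0 : ℝ) 1) : (initial c).1 x = c.1 := rfl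

@[simp]
theorem initial_snd_apply (c : ℂ × ℂ) (x : Icc (0 : ℝ) 1) : (initial c).2 x = c.2 := rfl

@[simp]
theorem source_fst_apply (h : L2Unit) (x : Icc (0 : ℝ) 1) : (source h).1 x = 0 := rfl

@[simp]
theorem source_snd_apply (h : L2Unit) (x : Icc (0 : ℝ) 1) :
    (source h).2 x = -∫ s in (0 : ℝ)..x, h s := rfl

/-- The values `(y(1), y'(1))` of a state at the right end point. -/
noncomputable def endpoint : State →L[ℂ] ℂ × ℂ :=
  LinearMap.mkContinuous
    { toFun := fun Y => (Y.1 ⟨1, right_mem_Icc.2 zero_le_one⟩, Y.2 ⟨1, right_mem_Icc.2 zero_le_one⟩)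
      map_add' := fun _ _ => rfl
      map_smul' := fun _ _ => rfl }
    1 fun Y => by
      rw [one_mul, Prod.norm_def]
      exact max_le ((Y.1.norm_apply_le _).trans (norm_fst_le Y))
        ((Y.2.norm_apply_le _).trans (norm_snd_le Y))

theorem endpoint_apply (Y : State) : endpoint Y = (ext Y.1 1, ext Y.2 1) := by
  rw [ext_of_mem _ (right_mem_Icc.2 zero_le_one), ext_of_mem _ (right_mem_Icc.2 zero_le_one)]
  rfl

variable {q : ℝ → ℂ} (hq : IntervalIntegrable q volume 0 1)

/-- The solution `(y, y')` of `-y'' + (q - z) y = h` with `(y(0), y'(0)) = c`. -/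
noncomputable def sol (z : ℂ) (c : ℂ × ℂ) (h : L2Unit) : State :=
  solver hq z (initial c + source h)

theorem sol_fst_apply (z : ℂ) (c : ℂ × ℂ) (h : L2Unit) {x : ℝ} (hx : x ∈ Icc (0 : ℝ) 1) :
    ext (sol hq z c h).1 x = c.1 + ∫ s in (0 : ℝ)..x, ext (sol hq z c h).2 s := by
  have := (eq_solver_iff hq z (sol hq z c h) _).1 rfl
  have h1 := congrArg (fun Y : State => Y.1 ⟨x, hx⟩) this
  simp only [Prod.fst_add, CUnit.add_apply, volterra_fst] at h1
  rw [ext_of_mem _ hx, h1]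
  simp

theorem integrable_rhs (hq : IntervalIntegrable q volume 0 1) (z : ℂ) (y : CUnit)
    (h : L2Unit) :
    IntervalIntegrable (fun s => (q s - z) * ext y s - h s) volume 0 1 :=
  (intervalIntegrable_mul_ext (hq.sub intervalIntegrable_const) y).sub
    (L2Unit.intervalIntegrable h)

theorem sol_snd_apply (z : ℂ) (c : ℂ × ℂ) (h : L2Unit) {x : ℝ} (hx : x ∈ Icc (0 : ℝ) 1) :
    ext (sol hq z c h).2 x =
      c.2 + ∫ s in (0 : ℝ)..x, ((q s - z) * ext (sol hq z c h).1 s - h s) := by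
  have := (eq_solver_iff hq z (sol hq z c h) _).1 rfl
  have h1 := congrArg (fun Y : State => Y.2 ⟨x, hx⟩) this
  simp only [Prod.snd_add, CUnit.add_apply, volterra_snd] at h1
  rw [ext_of_mem _ hx, h1, intervalIntegral.integral_sub
    (intervalIntegrable_of_mem (intervalIntegrable_mul_ext
      (hq.sub intervalIntegrable_const) _) hx)
    (intervalIntegrable_of_mem (L2Unit.intervalIntegrable h) hx)]
  simp only [initial_snd_apply, source_snd_apply]
  ring

theorem sol_fst_zero (z : ℂ) (c : ℂ × ℂ) (h : L2Unit) : ext (sol hq z c h).1 0 = c.1 := by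
  rw [sol_fst_apply hq z c h (left_mem_Icc.2 zero_le_one)]; simp

theorem sol_snd_zero (z : ℂ) (c : ℂ × ℂ) (h : L2Unit) : ext (sol hq z c h).2 0 = c.2 := by
  rw [sol_snd_apply hq z c h (left_mem_Icc.2 zero_le_one)]; simp

theorem sol_twiceAC (z : ℂ) (c : ℂ × ℂ) (h : L2Unit) :
    TwiceAC 0 1 (ext (sol hq z c h).1) (ext (sol hq z c h).2)
      (fun s => (q s - z) * ext (sol hq z c h).1 s - h s) := by
  refine ⟨integrable_rhs hq z _ h, fun x hx => ?_, fun x hx => ?_⟩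
  · rw [sol_snd_zero, ← sol_snd_apply hq z c h hx]
  · rw [sol_fst_zero, ← sol_fst_apply hq z c h hx]

/-- Uniqueness in the initial value problem. -/
theorem TwiceAC.eq_sol {f f₁ f₂ : ℝ → ℂ} (hf : TwiceAC 0 1 f f₁ f₂) (z : ℂ) (h : L2Unit)
    (h2 : ∀ᵐ x ∂volume.restrict (Ioc (0 : ℝ) 1), f₂ x = (q x - z) * f x - h x) :
    ∀ x ∈ Icc (0 : ℝ) 1, f x = ext (sol hq z (f 0, f₁ 0) h).1 x ∧
      f₁ x = ext (sol hq z (f 0, f₁ 0) h).2 x := by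
  have hc := (hf.isPrimitiveOn zero_le_one).continuousOn zero_le_one
  have hc1 := hf.isPrimitiveOn_deriv.continuousOn zero_le_one
  let Y : State := (ContinuousMap.mk _ (continuousOn_iff_continuous_domRestrict.1 hc),
    ContinuousMap.mk _ (continuousOn_iff_continuous_domRestrict.1 hc1))
  have e1 : ∀ x ∈ Icc (0 : ℝ) 1, ext Y.1 x = f x := fun x hx => ext_of_mem _ hx
  have e2 : ∀ x ∈ Icc (0 : ℝ) 1, ext Y.2 x = f₁ x := fun x hx => ext_of_mem _ hx
  have hsub : ∀ {x}, x ∈ Icc (0 : ℝ) 1 → uIcc 0 x ⊆ Icc (0 : ℝ) 1 := fun {x} hx => by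
    rw [uIcc_of_le hx.1]; exact Icc_subset_Icc_right hx.2
  have hY : Y = sol hq z (f 0, f₁ 0) h := by
    rw [sol, eq_solver_iff]
    refine Prod.ext ?_ ?_
    · ext x
      simp only [Prod.fst_add, CUnit.add_apply, volterra_fst]
      rw [intervalIntegral.integral_congr (g := f₁) fun s hs => e2 s (hsub x.2 hs)]
      simp only [initial_fst_apply, source_fst_apply, add_zero]
      exact hf.eq x x.2
    · ext x
      simp only [Prod.snd_add, CUnit.add_apply, volterra_snd]
      have h3 : ∫ s in (0 : ℝ)..x, f₂ s
          = ∫ s in (0 : ℝ)..x, ((q s - z) * ext Y.1 s - h s) := by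
        refine intervalIntegral_congr_ae_unit ?_ x.2
        filter_upwards [h2, ae_restrict_mem measurableSet_Ioc] with s hs hm
        rw [hs, e1 s (Ioc_subset_Icc_self hm)]
      rw [intervalIntegral.integral_sub
        (intervalIntegrable_of_mem (intervalIntegrable_mul_ext
          (hq.sub intervalIntegrable_const) _) x.2)
        (intervalIntegrable_of_mem (L2Unit.intervalIntegrable h) x.2)] at h3
      have h4 := hf.deriv_eq x x.2
      rw [h3] at h4
      simp only [initial_snd_apply, source_snd_apply]
      refine Eq.trans h4 ?_
      ring
  intro x hx
  rw [← hY, e1 x hx, e2 x hx]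
  exact ⟨rfl, rfl⟩

/-- The graph of `H_t` in terms of the initial value problem. -/
theorem mem_fibreGraph_iff (t : ℝ) (z : ℂ) (y g : L2Unit) :
    (y, g) ∈ fibreGraph q t ↔ ∃ c : ℂ × ℂ, y = toL2 (sol hq z c (g - z • y)).1 ∧
      endpoint (sol hq z c (g - z • y)) = Complex.exp (Complex.I * t) • c := by
  -- For any fixed z the relation -y'' + qy = g reads -y'' + (q - z)y = g - zy, so the initial value
  -- problem at z applies with source g - zy. The point z stays free and is chosen to suit each use.
  have hcoe : ∀ᵐ x ∂volume.restrict (Ioc (0 : ℝ) 1), (g - z • y) x = g x - z * y x := by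
    filter_upwards [Lp.coeFn_sub g (z • y), Lp.coeFn_smul z y] with x h1 h2
    rw [h1, Pi.sub_apply, h2]; rfl
  constructor
  · rintro ⟨f, f₁, f₂, hf, h0, h1, hy, hg⟩
    have := hf.eq_sol hq z (g - z • y) (by
      filter_upwards [hcoe, hy, hg] with x e1 e2 e3
      rw [e1, e2, e3]; ring)
    refine ⟨(f 0, f₁ 0), ?_, ?_⟩
    · apply Lp.ext
      filter_upwards [hy, toL2_coeFn (sol hq z (f 0, f₁ 0) (g - z • y)).1,
        ae_restrict_mem measurableSet_Ioc] with x e1 e2 hx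
      rw [e2, ← (this x (Ioc_subset_Icc_self hx)).1]
      exact e1
    · have h := this 1 (right_mem_Icc.2 zero_le_one)
      rw [endpoint_apply, ← h.1, ← h.2, h0, h1]
      rfl
  · rintro ⟨c, hy, he⟩
    set Y := sol hq z c (g - z • y) with hY
    rw [endpoint_apply] at he
    refine ⟨_, _, _, sol_twiceAC hq z c (g - z • y), ?_, ?_, ?_, ?_⟩
    · rw [sol_fst_zero]; exact congrArg Prod.fst he
    · rw [sol_snd_zero]; exact congrArg Prod.snd he
    · filter_upwards [toL2_coeFn Y.1] with x hx
      rw [← hx]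
      exact congrArg (fun y : L2Unit => y x) hy
    · filter_upwards [toL2_coeFn Y.1, hcoe] with x hx h1
      rw [h1, ← hY, ← hx, ← hy]
      ring

/-- A solution with vanishing source that vanishes in `L²(0, 1)` has vanishing initial values. -/
theorem initial_eq_zero_of_toL2_sol_eq_zero {z : ℂ} {c : ℂ × ℂ}
    (h : toL2 (sol hq z c 0).1 = 0) : c = 0 := by
  have h0 : EqOn (ext (sol hq z c 0).1) (fun _ => 0) (Icc 0 1) := by
    refine Measure.eqOn_Icc_of_ae_eq volume zero_ne_one ?_ (continuous_ext _).continuousOn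
      continuousOn_const
    rw [← restrict_Ioc_eq_restrict_Icc]
    filter_upwards [toL2_coeFn (sol hq z c 0).1,
      Lp.coeFn_zero ℂ 2 (volume.restrict (Ioc (0 : ℝ) 1))] with x h1 h2
    rw [← h1, h, h2]; rfl
  have hz : ∀ᵐ x ∂volume.restrict (Ioc (0 : ℝ) 1),
      (q x - z) * ext (sol hq z c 0).1 x - (0 : L2Unit) x = 0 := by
    filter_upwards [Lp.coeFn_zero ℂ 2 (volume.restrict (Ioc (0 : ℝ) 1)),
      ae_restrict_mem measurableSet_Ioc] with x h2 hx
    rw [h0 (Ioc_subset_Icc_self hx), h2]; simp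
  -- Once y vanishes identically, the integral equation makes y' the constant c.2. Then y(1) = c.1 +
  -- c.2 and y(0) = c.1 are both zero.
  have h1 : ∀ x ∈ Icc (0 : ℝ) 1, ext (sol hq z c 0).2 x = c.2 := fun x hx => by
    rw [sol_snd_apply hq z c 0 hx, intervalIntegral_congr_ae_unit hz hx]; simp
  have e0 : c.1 = 0 := by
    rw [← sol_fst_zero hq z c 0]; exact h0 (left_mem_Icc.2 zero_le_one)
  have h2 : ext (sol hq z c 0).1 1 = c.1 + c.2 := by
    rw [sol_fst_apply hq z c 0 (right_mem_Icc.2 zero_le_one),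
      intervalIntegral.integral_congr (g := fun _ => c.2) fun s hs => h1 s (by
        rwa [uIcc_of_le zero_le_one] at hs)]
    simp
  rw [h0 (right_mem_Icc.2 zero_le_one), e0, zero_add] at h2
  exact Prod.ext e0 h2.symm

theorem integral_norm_sq_sol_pos {z : ℂ} {c : ℂ × ℂ} (hc : c ≠ 0) :
    0 < ∫ s in (0 : ℝ)..1, ‖ext (sol hq z c 0).1 s‖ ^ 2 := by
  have hcont : Continuous (ext (sol hq z c 0).1) := continuous_ext _
  refine lt_of_le_of_ne (intervalIntegral.integral_nonneg zero_le_one fun _ _ => by positivity)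
    fun h => hc (initial_eq_zero_of_toL2_sol_eq_zero hq (z := z) ?_)
  rw [eq_comm, intervalIntegral.integral_of_le zero_le_one, integral_eq_zero_iff_of_nonneg
    (fun _ => by positivity) ((Continuous.intervalIntegrable (by fun_prop) 0 1).1)] at h
  apply Lp.ext
  filter_upwards [h, toL2_coeFn (sol hq z c 0).1,
    Lp.coeFn_zero ℂ 2 (volume.restrict (Ioc (0 : ℝ) 1))] with s h1 h2 h3
  rw [h2, h3]
  simpa using h1

end Hill

namespace Hill

/-! ### Linear algebra in `ℂ²` -/

/-- The trace of an endomorphism of `ℂ²`. -/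
noncomputable def tr (L : ℂ × ℂ →L[ℂ] ℂ × ℂ) : ℂ := (L (1, 0)).1 + (L (0, 1)).2

/-- The determinant of an endomorphism of `ℂ²`. -/
noncomputable def det (L : ℂ × ℂ →L[ℂ] ℂ × ℂ) : ℂ :=
  (L (1, 0)).1 * (L (0, 1)).2 - (L (0, 1)).1 * (L (1, 0)).2

/-- The adjugate of `L - μ` for an endomorphism `L` of `ℂ²`. -/
noncomputable def adjugate (L : ℂ × ℂ →L[ℂ] ℂ × ℂ) (μ : ℂ) : ℂ × ℂ →L[ℂ] ℂ × ℂ :=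
  ContinuousLinearMap.prod
    (((L (0, 1)).2 - μ) • ContinuousLinearMap.fst ℂ ℂ ℂ -
      (L (0, 1)).1 • ContinuousLinearMap.snd ℂ ℂ ℂ)
    (((L (1, 0)).1 - μ) • ContinuousLinearMap.snd ℂ ℂ ℂ -
      (L (1, 0)).2 • ContinuousLinearMap.fst ℂ ℂ ℂ)

section LinearAlgebra

variable (L : ℂ × ℂ →L[ℂ] ℂ × ℂ) (μ : ℂ)

theorem adjugate_apply (v : ℂ × ℂ) : adjugate L μ v =
    (((L (0, 1)).2 - μ) * v.1 - (L (0, 1)).1 * v.2,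
      ((L (1, 0)).1 - μ) * v.2 - (L (1, 0)).2 * v.1) := rfl

theorem apply_eq (v : ℂ × ℂ) : L v =
    ((L (1, 0)).1 * v.1 + (L (0, 1)).1 * v.2, (L (1, 0)).2 * v.1 + (L (0, 1)).2 * v.2) := by
  have h : v = v.1 • ((1, 0) : ℂ × ℂ) + v.2 • ((0, 1) : ℂ × ℂ) := by ext <;> simp
  conv_lhs => rw [h, map_add, map_smul, map_smul]
  ext <;> simp [mul_comm]

theorem apply_eq_smul_iff (v : ℂ × ℂ) : L v = μ • v ↔
    (L (1, 0)).1 * v.1 + (L (0, 1)).1 * v.2 = μ * v.1 ∧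
      (L (1, 0)).2 * v.1 + (L (0, 1)).2 * v.2 = μ * v.2 := by
  rw [apply_eq, Prod.ext_iff]; rfl

variable {L μ}

/-- This and the next lemma are the two halves of adj(L - μ)(L - μ) = (L - μ)adj(L - μ) = det(L -
μ), with det(L - μ) written out as the characteristic polynomial. -/
theorem adjugate_apply_sub (v : ℂ × ℂ) :
    adjugate L μ (L v - μ • v) = (det L - tr L * μ + μ ^ 2) • v := by
  rw [apply_eq L v, adjugate_apply]
  ext <;> simp [det, tr] <;> ring

theorem apply_adjugate (v : ℂ × ℂ) :
    L (adjugate L μ v) = μ • adjugate L μ v + (det L - tr L * μ + μ ^ 2) • v := by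
  rw [apply_eq L (adjugate L μ v), adjugate_apply]
  ext <;> simp [det, tr] <;> ring

/-- On `ker (L - μ)` the operator `adj (L - μ) X` is the multiplication by its trace. -/
theorem adjugate_apply_apply_of_eigen {X : ℂ × ℂ →L[ℂ] ℂ × ℂ} {a : ℂ × ℂ} (ha : L a = μ • a) :
    adjugate L μ (X a) = (((L (0, 1)).2 - μ) * (X (1, 0)).1 - (L (0, 1)).1 * (X (1, 0)).2
      - (L (1, 0)).2 * (X (0, 1)).1 + ((L (1, 0)).1 - μ) * (X (0, 1)).2) • a := by
  obtain ⟨h1, h2⟩ := (apply_eq_smul_iff L μ a).1 ha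
  rw [apply_eq X a, adjugate_apply]
  ext
  · simp only [Prod.smul_fst, smul_eq_mul]
    linear_combination (-(X (0, 1)).2) * h1 + (X (0, 1)).1 * h2
  · simp only [Prod.smul_snd, smul_eq_mul]
    linear_combination (X (1, 0)).2 * h1 - (X (1, 0)).1 * h2

/-- When det(L - μ) = 0, every nonzero value of the adjugate is an eigenvector. If the adjugate
vanishes, then L = μ and any vector serves. -/
theorem exists_eigen (h : det L - tr L * μ + μ ^ 2 = 0) : ∃ a : ℂ × ℂ, a ≠ 0 ∧ L a = μ • a := by
  by_cases hA : ∃ v, adjugate L μ v ≠ 0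
  · obtain ⟨v, hv⟩ := hA
    exact ⟨_, hv, by rw [apply_adjugate, h, zero_smul, add_zero]⟩
  · push Not at hA
    have h1 := hA (1, 0)
    have h2 := hA (0, 1)
    simp only [adjugate_apply, Prod.mk_eq_zero, mul_one, mul_zero, sub_zero, zero_sub,
      neg_eq_zero] at h1 h2
    refine ⟨(1, 0), by simp, ?_⟩
    rw [apply_eq_smul_iff]
    simp only [mul_one, mul_zero, add_zero]
    exact ⟨sub_eq_zero.1 h2.2, h1.2⟩

/-- Two independent eigenvectors would force L = μ on all of ℂ², and the adjugate would vanish. -/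
theorem exists_smul_of_eigen {a b : ℂ × ℂ} (hA : adjugate L μ ≠ 0) (ha0 : a ≠ 0)
    (ha : L a = μ • a) (hb : L b = μ • b) : ∃ k : ℂ, b = k • a := by
  obtain ⟨h1, h2⟩ := (apply_eq_smul_iff L μ a).1 ha
  obtain ⟨h3, h4⟩ := (apply_eq_smul_iff L μ b).1 hb
  have hw : a.1 * b.2 = a.2 * b.1 := by
    by_contra hne
    have hne' : a.1 * b.2 - a.2 * b.1 ≠ 0 := sub_ne_zero.2 hne
    refine hA (ContinuousLinearMap.ext fun v => ?_)
    have e1 : ((L (1, 0)).1 - μ) = 0 := by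
      refine (mul_eq_zero.1 ?_).resolve_right hne'
      linear_combination b.2 * h1 - a.2 * h3
    have e2 : (L (0, 1)).1 = 0 := by
      refine (mul_eq_zero.1 ?_).resolve_right hne'
      linear_combination a.1 * h3 - b.1 * h1
    have e3 : (L (1, 0)).2 = 0 := by
      refine (mul_eq_zero.1 ?_).resolve_right hne'
      linear_combination b.2 * h2 - a.2 * h4
    have e4 : ((L (0, 1)).2 - μ) = 0 := by
      refine (mul_eq_zero.1 ?_).resolve_right hne'
      linear_combination a.1 * h4 - b.1 * h2
    simp [adjugate_apply, e1, e2, e3, e4]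
  by_cases h0 : a.1 = 0
  · have h0' : a.2 ≠ 0 := fun h => ha0 (Prod.ext h0 h)
    refine ⟨b.2 / a.2, Prod.ext ?_ ?_⟩
    · rw [h0, zero_mul] at hw
      have := (mul_eq_zero.1 hw.symm).resolve_left h0'
      simp [this, h0]
    · simp [h0']
  · refine ⟨b.1 / a.1, Prod.ext ?_ ?_⟩
    · simp [h0]
    · simp only [Prod.smul_snd, smul_eq_mul]
      field_simp
      linear_combination hw

/-- The range of L - μ is the kernel of the adjugate: the kernel is 0 in the invertible case, and
otherwise both are lines because the adjugate is nonzero. A solution is found explicitly from any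
nonzero entry of L - μ, with the other coordinate of b set to 0. -/
theorem exists_apply_sub_eq (hA : adjugate L μ ≠ 0)
    {v : ℂ × ℂ} (hv : adjugate L μ v = 0) : ∃ b, L b - μ • b = v := by
  have key : ∀ b : ℂ × ℂ, ((L (1, 0)).1 - μ) * b.1 + (L (0, 1)).1 * b.2 = v.1 →
      (L (1, 0)).2 * b.1 + ((L (0, 1)).2 - μ) * b.2 = v.2 → L b - μ • b = v := fun b h1 h2 => by
    rw [apply_eq L b]
    ext
    · simp only [Prod.fst_sub, Prod.smul_fst, smul_eq_mul]; linear_combination h1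
    · simp only [Prod.snd_sub, Prod.smul_snd, smul_eq_mul]; linear_combination h2
  rw [adjugate_apply, Prod.mk_eq_zero] at hv
  obtain ⟨h1, h2⟩ := hv
  by_cases e1 : (L (1, 0)).1 - μ = 0
  · by_cases e2 : (L (0, 1)).1 = 0
    · have hv1 : (L (1, 0)).2 * v.1 = 0 := by linear_combination v.2 * e1 - h2
      have hv2 : ((L (0, 1)).2 - μ) * v.1 = 0 := by linear_combination h1 + v.2 * e2
      by_cases e3 : (L (1, 0)).2 = 0
      · by_cases e4 : (L (0, 1)).2 - μ = 0
        · exact absurd (ContinuousLinearMap.ext fun v => by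
            simp [adjugate_apply, e1, e2, e3, e4]) hA
        · have := (mul_eq_zero.1 hv2).resolve_left e4
          refine ⟨(0, v.2 / ((L (0, 1)).2 - μ)), key _ ?_ ?_⟩
          · simp [e2, this]
          · simp only; field_simp; ring
      · have := (mul_eq_zero.1 hv1).resolve_left e3
        refine ⟨(v.2 / (L (1, 0)).2, 0), key _ ?_ ?_⟩
        · simp [e1, this]
        · simp only; field_simp; ring
    · refine ⟨(0, v.1 / (L (0, 1)).1), key _ ?_ ?_⟩
      · simp only; field_simp; ring
      · simp only; field_simp; linear_combination h1
  · refine ⟨(v.1 / ((L (1, 0)).1 - μ), 0), key _ ?_ ?_⟩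
    · simp only; field_simp; ring
    · simp only; field_simp; linear_combination -h2

end LinearAlgebra

/-! ### The monodromy map and the discriminant -/

variable {q : ℝ → ℂ} (hq : IntervalIntegrable q volume 0 1)

/-- The monodromy map `(y(0), y'(0)) ↦ (y(1), y'(1))` of `-y'' + q y = z y`. -/
noncomputable def monodromy (z : ℂ) : ℂ × ℂ →L[ℂ] ℂ × ℂ :=
  endpoint.comp ((solver hq z).comp initial)

/-- The end values of the solution of `-y'' + (q - z) y = h` with vanishing initial values. -/
noncomputable def endSource (z : ℂ) : L2Unit →L[ℂ] ℂ × ℂ :=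
  endpoint.comp ((solver hq z).comp source)

/-- The Hill discriminant. -/
noncomputable def discriminant (z : ℂ) : ℂ := tr (monodromy hq z)

theorem endpoint_sol (z : ℂ) (c : ℂ × ℂ) (h : L2Unit) :
    endpoint (sol hq z c h) = monodromy hq z c + endSource hq z h := by
  rw [sol, map_add, map_add]; rfl

/-- The Wronskian is constant. -/
theorem det_monodromy (z : ℂ) : det (monodromy hq z) = 1 := by
  have h1 := sol_twiceAC hq z (1, 0) 0
  have h2 := sol_twiceAC hq z (0, 1) 0
  have m1 : monodromy hq z (1, 0) = endpoint (sol hq z (1, 0) 0) := by simp [endpoint_sol]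
  have m2 : monodromy hq z (0, 1) = endpoint (sol hq z (0, 1) 0) := by simp [endpoint_sol]
  have hp := (((h1.isPrimitiveOn zero_le_one).mul zero_le_one h2.isPrimitiveOn_deriv).sub
    zero_le_one ((h2.isPrimitiveOn zero_le_one).mul zero_le_one h1.isPrimitiveOn_deriv)).integral_eq
    zero_le_one
  rw [intervalIntegral.integral_congr_ae (g := fun _ => 0)] at hp
  · simp only [sol_fst_zero, sol_snd_zero] at hp
    rw [det, m1, m2, endpoint_apply, endpoint_apply]
    simp only
    simp only [intervalIntegral.integral_zero] at hp
    linear_combination -hp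
  · have h0 := Lp.coeFn_zero ℂ 2 (volume.restrict (Ioc (0 : ℝ) 1))
    rw [Filter.EventuallyEq, ae_restrict_iff' measurableSet_Ioc] at h0
    filter_upwards [h0] with x hx hm
    rw [uIoc_of_le zero_le_one] at hm
    rw [hx hm]
    simp only [Pi.zero_apply]
    ring

theorem integL2_toL2 (y : CUnit) : integL2 (toL2 y) = integ y := by
  ext x
  rw [integL2_apply, integ, mulPrimitive_apply]
  refine intervalIntegral_congr_ae_unit ?_ x.2
  filter_upwards [toL2_coeFn y] with s hs
  rw [hs, one_mul]

/-- The z-derivative of the Volterra operator is `-spectralPart`, so differentiating a solution in z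
amounts to feeding the solution back in as the source. -/
theorem source_toL2 (Y : State) : source (toL2 Y.1) = -spectralPart Y := by
  refine Prod.ext ?_ ?_
  · simp [source, spectralPart]
  · simp [source, spectralPart, integL2_toL2]

/-- The derivative of the monodromy map with respect to the spectral parameter. -/
noncomputable def monodromyDeriv (z : ℂ) : ℂ × ℂ →L[ℂ] ℂ × ℂ :=
  endpoint.comp ((-(solver hq z * spectralPart * solver hq z)).comp initial)

theorem hasDerivAt_monodromy (z : ℂ) : HasDerivAt (monodromy hq) (monodromyDeriv hq z) z := by
  have h := hasDerivAt_solver hq z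
  have h1 := h.clm_comp (hasDerivAt_const z initial)
  have h2 := (hasDerivAt_const z endpoint).clm_comp h1
  rw [ContinuousLinearMap.zero_comp, zero_add, ContinuousLinearMap.comp_zero, add_zero] at h2
  exact h2

/-- Differentiating -y'' + (q - z)y = 0 in z shows that u = ∂y/∂z solves -u'' + (q - z)u = y with
vanishing initial values. This links F' to the solvability of (H_t - z)v = y. -/
theorem monodromyDeriv_apply (z : ℂ) (c : ℂ × ℂ) :
    monodromyDeriv hq z c = endSource hq z (toL2 (sol hq z c 0).1) := by
  have h : sol hq z c 0 = solver hq z (initial c) := by simp [sol]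
  rw [endSource, ContinuousLinearMap.comp_apply, ContinuousLinearMap.comp_apply, source_toL2, h]
  simp [monodromyDeriv]

theorem hasDerivAt_monodromy_apply (z : ℂ) (c : ℂ × ℂ) :
    HasDerivAt (fun z => monodromy hq z c) (monodromyDeriv hq z c) z := by
  simpa using (hasDerivAt_monodromy hq z).clm_apply (hasDerivAt_const z c)

theorem hasDerivAt_monodromy_apply_fst (z : ℂ) (c : ℂ × ℂ) :
    HasDerivAt (fun z => (monodromy hq z c).1) (monodromyDeriv hq z c).1 z :=
  (ContinuousLinearMap.fst ℂ ℂ ℂ).hasFDerivAt.comp_hasDerivAt z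
    (hasDerivAt_monodromy_apply hq z c)

theorem hasDerivAt_monodromy_apply_snd (z : ℂ) (c : ℂ × ℂ) :
    HasDerivAt (fun z => (monodromy hq z c).2) (monodromyDeriv hq z c).2 z :=
  (ContinuousLinearMap.snd ℂ ℂ ℂ).hasFDerivAt.comp_hasDerivAt z
    (hasDerivAt_monodromy_apply hq z c)

theorem hasDerivAt_discriminant (z : ℂ) :
    HasDerivAt (discriminant hq) (tr (monodromyDeriv hq z)) z :=
  (hasDerivAt_monodromy_apply_fst hq z (1, 0)).add (hasDerivAt_monodromy_apply_snd hq z (0, 1))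

theorem differentiable_discriminant : Differentiable ℂ (discriminant hq) := fun z =>
  (hasDerivAt_discriminant hq z).differentiableAt

theorem continuous_monodromy : Continuous (monodromy hq) :=
  continuous_iff_continuousAt.2 fun z => (hasDerivAt_monodromy hq z).continuousAt

/-- Jacobi's formula: the trace of adj(M - μ)M' is the z-derivative of det(M - μ) at fixed μ, that
is (det M)' - μ(tr M)'. As det M is constant, only -μF' remains. On the eigenvector a the operator
acts as this scalar. -/
theorem adjugate_monodromyDeriv {z μ : ℂ} {a : ℂ × ℂ} (ha : monodromy hq z a = μ • a) :
    adjugate (monodromy hq z) μ (monodromyDeriv hq z a)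
      = (-μ * deriv (discriminant hq) z) • a := by
  rw [adjugate_apply_apply_of_eigen ha, (hasDerivAt_discriminant hq z).deriv]
  congr 1
  have hd := ((hasDerivAt_monodromy_apply_fst hq z (1, 0)).mul
    (hasDerivAt_monodromy_apply_snd hq z (0, 1))).sub
    ((hasDerivAt_monodromy_apply_fst hq z (0, 1)).mul
      (hasDerivAt_monodromy_apply_snd hq z (1, 0)))
  have hc : HasDerivAt (fun z => det (monodromy hq z)) 0 z := by
    simp only [det_monodromy]
    exact hasDerivAt_const z 1
  have := hd.unique hc
  simp only [tr]
  linear_combination this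

/-- The characteristic polynomial of the monodromy map at `e^{it}`. -/
theorem charpoly_monodromy (z : ℂ) (t : ℝ) :
    det (monodromy hq z) - tr (monodromy hq z) * Complex.exp (Complex.I * t)
        + Complex.exp (Complex.I * t) ^ 2
      = Complex.exp (Complex.I * t) * (2 * Real.cos t - discriminant hq z) := by
  rw [det_monodromy, discriminant, Complex.ofReal_cos, Complex.cos]
  have h1 : Complex.exp (t * Complex.I) = Complex.exp (Complex.I * t) := by rw [mul_comm]
  have h2 : Complex.exp (-t * Complex.I) * Complex.exp (Complex.I * t) = 1 := by
    rw [← Complex.exp_add]; simp [mul_comm]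
  rw [h1]
  linear_combination -h2

theorem charpoly_monodromy_eq_zero_iff (z : ℂ) (t : ℝ) :
    det (monodromy hq z) - tr (monodromy hq z) * Complex.exp (Complex.I * t)
        + Complex.exp (Complex.I * t) ^ 2 = 0 ↔ discriminant hq z = 2 * Real.cos t := by
  rw [charpoly_monodromy, mul_eq_zero, or_iff_right (Complex.exp_ne_zero _), sub_eq_zero, eq_comm]

end Hill

namespace Hill

/-! ### Resolvents and eigenvalues of `H_t` -/

theorem mem_fibreGraph_iff_exists (q : ℝ → ℂ) (t : ℝ) (y g : L2Unit) :
    (y, g) ∈ fibreGraph q t ↔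
      ∃ h : y ∈ (fibreOp q t).domain, fibreOp q t ⟨y, h⟩ = g := by
  rw [← fibreOp_graph, LinearPMap.mem_graph_iff]
  constructor
  · rintro ⟨⟨y', hy'⟩, h1, h2⟩
    obtain rfl : y' = y := h1
    exact ⟨hy', h2⟩
  · rintro ⟨h, rfl⟩
    exact ⟨⟨y, h⟩, rfl, rfl⟩

variable {q : ℝ → ℂ} (hq : IntervalIntegrable q volume 0 1)

/-- The initial values of the solution of the quasiperiodic boundary value problem. -/
noncomputable def resolventInitial (t : ℝ) (z : ℂ) : L2Unit →L[ℂ] ℂ × ℂ :=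
  -(det (monodromy hq z) - tr (monodromy hq z) * Complex.exp (Complex.I * t)
    + Complex.exp (Complex.I * t) ^ 2)⁻¹ •
    (adjugate (monodromy hq z) (Complex.exp (Complex.I * t))).comp (endSource hq z)

/-- The resolvent of `H_t` in terms of the initial value problem. -/
noncomputable def fibreResolvent (t : ℝ) (z : ℂ) : L2Unit →L[ℂ] L2Unit :=
  toL2.comp ((ContinuousLinearMap.fst ℂ CUnit CUnit).comp
    ((solver hq z).comp (initial.comp (resolventInitial hq t z) + source)))

theorem fibreResolvent_apply (t : ℝ) (z : ℂ) (h : L2Unit) :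
    fibreResolvent hq t z h = toL2 (sol hq z (resolventInitial hq t z h) h).1 := rfl

/-- The points with `F(z) ≠ 2 cos t` belong to the resolvent set of `H_t`. -/
theorem isResolvent_fibreResolvent {t : ℝ} {z : ℂ} (hz : discriminant hq z ≠ 2 * Real.cos t) :
    UnboundedOp.IsResolvent (fibreOp q t) z (fibreResolvent hq t z) := by
  have hD := mt (charpoly_monodromy_eq_zero_iff hq z t).1 hz
  set μ := Complex.exp (Complex.I * t) with hμ
  constructor
  · intro f
    obtain ⟨h, he⟩ := (mem_fibreGraph_iff_exists q t (fibreResolvent hq t z f)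
      (f + z • fibreResolvent hq t z f)).1 (by
        rw [mem_fibreGraph_iff hq t z]
        refine ⟨resolventInitial hq t z f, ?_, ?_⟩
        · rw [add_sub_cancel_right, fibreResolvent_apply]
        · rw [add_sub_cancel_right, endpoint_sol, ← hμ]
          -- The boundary condition is the linear system (M - μ)c = -`endSource` f, which Cramer's
          -- rule solves since its determinant is nonzero.
          have : resolventInitial hq t z f = -(det (monodromy hq z) - tr (monodromy hq z) * μ
            + μ ^ 2)⁻¹ • adjugate (monodromy hq z) μ (endSource hq z f) := rfl
          have h5 := inv_smul_smul₀ hD (endSource hq z f)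
          rw [this, map_smul, apply_adjugate]
          linear_combination (norm := module) (-1 : ℂ) • h5)
    refine ⟨h, ?_⟩
    rw [he, add_sub_cancel_right]
  · rintro ⟨y, hy⟩
    set g := fibreOp q t ⟨y, hy⟩ with hg
    obtain ⟨c, h1, h2⟩ := (mem_fibreGraph_iff hq t z y g).1
      ((mem_fibreGraph_iff_exists q t y g).2 ⟨hy, rfl⟩)
    change fibreResolvent hq t z (g - z • y) = y
    have hc : resolventInitial hq t z (g - z • y) = c := by
      change -(det (monodromy hq z) - tr (monodromy hq z) * μ
            + μ ^ 2)⁻¹ • adjugate (monodromy hq z) μ (endSource hq z (g - z • y)) = c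
      rw [endpoint_sol, ← hμ] at h2
      have h3 : endSource hq z (g - z • y) = -(monodromy hq z c - μ • c) := by
        rw [neg_sub, ← h2]; abel
      rw [h3, map_neg, adjugate_apply_sub, smul_neg, neg_smul, neg_neg, smul_smul,
        inv_mul_cancel₀ hD, one_smul]
    rw [fibreResolvent_apply, hc, ← h1]

theorem discriminant_eq_of_mem_spectrum {t : ℝ} {z : ℂ}
    (hz : z ∈ UnboundedOp.spectrum (fibreOp q t)) : discriminant hq z = 2 * Real.cos t := by
  by_contra h
  exact hz ⟨_, isResolvent_fibreResolvent hq h⟩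

/-- The eigenvectors of `H_t`. -/
theorem mem_fibreGraph_smul_iff (t : ℝ) (z : ℂ) (y : L2Unit) :
    (y, z • y) ∈ fibreGraph q t ↔ ∃ c : ℂ × ℂ, y = toL2 (sol hq z c 0).1 ∧
      monodromy hq z c = Complex.exp (Complex.I * t) • c := by
  rw [mem_fibreGraph_iff hq t z]
  simp only [sub_self, endpoint_sol, map_zero, add_zero]

end Hill

/-! ### Root subspaces and algebraic multiplicity -/

namespace UnboundedOp

variable {E : Type*} [NormedAddCommGroup E] [NormedSpace ℂ E]

theorem IsResolvent.eq_zero {T : E →ₗ.[ℂ] E} {z : ℂ} {R : E →L[ℂ] E} (hR : IsResolvent T z R)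
    {y : T.domain} (hy : T y = z • (y : E)) : (y : E) = 0 := by
  rw [← hR.2 y, hy, sub_self, map_zero]

theorem mem_kerPow_succ {T : E →ₗ.[ℂ] E} {z : ℂ} {n : ℕ} {v : E} :
    v ∈ kerPow T z (n + 1) ↔ ∃ h : v ∈ T.domain, T ⟨v, h⟩ - z • v ∈ kerPow T z n := by
  simp only [kerPow, Submodule.mem_map, Submodule.mem_comap]
  constructor
  · rintro ⟨⟨v, h⟩, hv, rfl⟩
    exact ⟨h, hv⟩
  · rintro ⟨h, hv⟩
    exact ⟨⟨v, h⟩, hv, rfl⟩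

/-- Each ker (T - z)ⁿ⁺¹ is the preimage of ker (T - z)ⁿ under T - z, so induction keeps all of them
inside a subspace stable under such preimages. With S = ⊥ it gives multiplicity zero, and with S the
span of an eigenvector it excludes associated vectors. -/
theorem rootSpace_le {T : E →ₗ.[ℂ] E} {z : ℂ} {S : Submodule ℂ E}
    (h : ∀ v : T.domain, T v - z • (v : E) ∈ S → (v : E) ∈ S) : rootSpace T z ≤ S := by
  refine iSup_le fun n => ?_
  induction n with
  | zero => exact bot_le
  | succ n ih =>
    intro v hv
    obtain ⟨hd, hv⟩ := mem_kerPow_succ.1 hv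
    exact h ⟨v, hd⟩ (ih hv)

theorem mem_rootSpace_of_eigen {T : E →ₗ.[ℂ] E} {z : ℂ} {v : E} (h : v ∈ T.domain)
    (hv : T ⟨v, h⟩ = z • v) : v ∈ rootSpace T z := by
  refine le_iSup (kerPow T z) 1 (mem_kerPow_succ.2 ⟨h, ?_⟩)
  rw [hv, sub_self]
  exact Submodule.zero_mem _

theorem IsResolvent.algMult_eq_zero {T : E →ₗ.[ℂ] E} {z : ℂ} {R : E →L[ℂ] E}
    (hR : IsResolvent T z R) : algMult T z = 0 := by
  have : rootSpace T z = ⊥ := by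
    refine le_bot_iff.1 (rootSpace_le fun v hv => ?_)
    exact hR.eq_zero (sub_eq_zero.1 ((Submodule.mem_bot ℂ).1 hv))
  rw [algMult, this, rank_bot, map_zero]

theorem IsSimpleEigenvalue.of_span {T : E →ₗ.[ℂ] E} {z : ℂ} {v : E} (hv0 : v ≠ 0)
    (h : rootSpace T z = Submodule.span ℂ {v}) : IsSimpleEigenvalue T z := by
  rw [IsSimpleEigenvalue, algMult, h]
  have := finrank_span_singleton (K := ℂ) hv0
  rw [← Module.finrank_eq_rank, this]
  simp

end UnboundedOp

/-! ### Multiple eigenvalues as critical points of the discriminant -/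

namespace Hill

variable {q : ℝ → ℂ} (hq : IntervalIntegrable q volume 0 1)

/-- An eigenvalue of `H_t` at which the derivative of the discriminant does not vanish is
simple. -/
theorem isSimpleEigenvalue_of_deriv_ne_zero {t : ℝ} {z : ℂ}
    (hz : discriminant hq z = 2 * Real.cos t) (hd : deriv (discriminant hq) z ≠ 0) :
    UnboundedOp.IsSimpleEigenvalue (fibreOp q t) z := by
  have hD := (charpoly_monodromy_eq_zero_iff hq z t).2 hz
  set μ := Complex.exp (Complex.I * t) with hμ
  have hμ0 : μ ≠ 0 := Complex.exp_ne_zero _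
  obtain ⟨a, ha0, ha⟩ := exists_eigen hD
  have hM := adjugate_monodromyDeriv hq ha
  have hne : -μ * deriv (discriminant hq) z ≠ 0 := mul_ne_zero (neg_ne_zero.2 hμ0) hd
  have hA : adjugate (monodromy hq z) μ ≠ 0 := fun h => by
    rw [h, zero_apply] at hM
    exact smul_ne_zero hne ha0 hM.symm
  have hψ0 : toL2 (sol hq z a 0).1 ≠ 0 := fun h =>
    ha0 (initial_eq_zero_of_toL2_sol_eq_zero hq h)
  refine UnboundedOp.IsSimpleEigenvalue.of_span hψ0 (le_antisymm ?_ ?_)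
  · refine UnboundedOp.rootSpace_le ?_
    rintro ⟨v, hv⟩ hk
    obtain ⟨k, hk⟩ := Submodule.mem_span_singleton.1 hk
    obtain ⟨b, h1, h2⟩ := (mem_fibreGraph_iff hq t z v _).1
      ((mem_fibreGraph_iff_exists q t v _).2 ⟨hv, rfl⟩)
    simp only at hk
    rw [← hk, endpoint_sol, map_smul, ← monodromyDeriv_apply, ← hμ] at h2
    have h3 : k • monodromyDeriv hq z a = -(monodromy hq z b - μ • b) := by
      rw [neg_sub, ← h2]; abel
    -- Suppose (H_t - z)v = kψ with ψ the eigenfunction of a. Applying the adjugate to the boundary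
    -- condition gives k(-μF'(z))a on the left and det(M - μ) b = 0 on the right. Since F'(z) ≠ 0, k
    -- = 0 and v is itself an eigenfunction.
    have h4 := congrArg (adjugate (monodromy hq z) μ) h3
    rw [map_smul, hM, map_neg, adjugate_apply_sub, hD, zero_smul, neg_zero, smul_smul] at h4
    have hk0 : k = 0 := by
      have := (smul_eq_zero.1 h4).resolve_right ha0
      exact (mul_eq_zero.1 this).resolve_right hne
    rw [hk0, zero_smul, add_zero] at h2
    obtain ⟨k', hk'⟩ := exists_smul_of_eigen hA ha0 ha h2
    refine Submodule.mem_span_singleton.2 ⟨k', ?_⟩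
    simp only
    rw [h1, ← hk, hk0, zero_smul, hk']
    simp only [sol, map_zero, add_zero, map_smul, Prod.smul_fst]
  · rw [Submodule.span_singleton_le_iff_mem]
    obtain ⟨h, he⟩ := (mem_fibreGraph_iff_exists q t _ _).1
      ((mem_fibreGraph_smul_iff hq t z _).2 ⟨a, rfl, ha⟩)
    exact UnboundedOp.mem_rootSpace_of_eigen h he

/-- A multiple eigenvalue of `H_t` is a critical point of the discriminant. -/
theorem discriminant_of_isMultipleEigenvalue {t : ℝ} {z : ℂ}
    (hz : UnboundedOp.IsMultipleEigenvalue (fibreOp q t) z) :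
    discriminant hq z = 2 * Real.cos t ∧ deriv (discriminant hq) z = 0 := by
  rw [UnboundedOp.IsMultipleEigenvalue] at hz
  have h1 : discriminant hq z = 2 * Real.cos t := by
    by_contra h
    rw [(isResolvent_fibreResolvent hq h).algMult_eq_zero] at hz
    simp at hz
  refine ⟨h1, ?_⟩
  by_contra h
  have := isSimpleEigenvalue_of_deriv_ne_zero hq h1 h
  rw [UnboundedOp.IsSimpleEigenvalue] at this
  rw [this] at hz
  exact absurd hz (by decide)

end Hill

namespace Hill

/-! ### A half-line of resolvent points, and density of the domain -/

theorem exp_mul_conj (t : ℝ) :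
    Complex.exp (Complex.I * t) * starRingEnd ℂ (Complex.exp (Complex.I * t)) = 1 := by
  rw [Complex.mul_conj, Complex.normSq_eq_norm_sq, mul_comm, Complex.norm_exp_ofReal_mul_I]
  simp

/-- A Sobolev inequality: the maximum of `|f|²` is controlled by `∫ |f|²` and `∫ |f'|²`. -/
theorem norm_sq_le_integral {f f₁ : ℝ → ℂ} (hf : Continuous f) (hf₁ : Continuous f₁)
    (h : IsPrimitiveOn 0 1 f f₁) {k : ℝ} (hk : 0 < k) {x : ℝ} (hx : x ∈ Icc (0 : ℝ) 1) :
    ‖f x‖ ^ 2 ≤ (1 + k) * (∫ s in (0 : ℝ)..1, ‖f s‖ ^ 2) +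
      k⁻¹ * ∫ s in (0 : ℝ)..1, ‖f₁ s‖ ^ 2 := by
  -- At its minimum |f|² is at most its mean. The increase from there to x is at most ∫ 2|f||f'|,
  -- split by 2|f||f'| ≤ k|f|² + k⁻¹|f'|².
  obtain ⟨x₀, hx₀, hmin⟩ := isCompact_Icc.exists_isMinOn (nonempty_Icc.2 zero_le_one)
    (f := fun s => ‖f s‖ ^ 2) (by fun_prop : ContinuousOn _ (Icc (0 : ℝ) 1))
  have h0 : ‖f x₀‖ ^ 2 ≤ ∫ s in (0 : ℝ)..1, ‖f s‖ ^ 2 := by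
    have := intervalIntegral.integral_mono_on (μ := volume) (a := 0) (b := 1) zero_le_one
      (f := fun _ => ‖f x₀‖ ^ 2) (g := fun s => ‖f s‖ ^ 2) intervalIntegrable_const
      (Continuous.intervalIntegrable (by fun_prop) _ _) fun s hs => hmin hs
    simpa using this
  have hp := h.mul zero_le_one h.conj
  set g : ℝ → ℂ := fun s => f₁ s * starRingEnd ℂ (f s) + f s * starRingEnd ℂ (f₁ s) with hg
  have hgc : Continuous g := by
    have hc := Complex.continuous_conj
    exact (hf₁.mul (hc.comp hf)).add (hf.mul (hc.comp hf₁))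
  have hdiff : f x * starRingEnd ℂ (f x) - f x₀ * starRingEnd ℂ (f x₀) = ∫ s in x₀..x, g s := by
    rw [hp.eq x hx, hp.eq x₀ hx₀, add_sub_add_left_eq_sub]
    exact intervalIntegral.integral_interval_sub_left (hgc.intervalIntegrable _ _)
      (hgc.intervalIntegrable _ _)
  have hb : ‖∫ s in x₀..x, g s‖ ≤ ∫ s in (0 : ℝ)..1, ‖g s‖ := by
    refine intervalIntegral.norm_integral_le_abs_integral_norm.trans ?_
    rw [← abs_of_nonneg (a := ∫ s in (0 : ℝ)..1, ‖g s‖)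
      (intervalIntegral.integral_nonneg zero_le_one fun _ _ => norm_nonneg _)]
    refine intervalIntegral.abs_integral_mono_interval ?_ (ae_of_all _ fun _ => norm_nonneg _)
      (hgc.norm.intervalIntegrable _ _)
    rw [uIoc_of_le zero_le_one]
    intro s hs
    rw [mem_uIoc] at hs
    rcases hs with hs | hs
    · exact ⟨hx₀.1.trans_lt hs.1, hs.2.trans hx.2⟩
    · exact ⟨hx.1.trans_lt hs.1, hs.2.trans hx₀.2⟩
  have hg2 : ∫ s in (0 : ℝ)..1, ‖g s‖ ≤
      ∫ s in (0 : ℝ)..1, (k * ‖f s‖ ^ 2 + k⁻¹ * ‖f₁ s‖ ^ 2) := by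
    refine intervalIntegral.integral_mono_on zero_le_one (hgc.norm.intervalIntegrable _ _)
      (Continuous.intervalIntegrable (by fun_prop) _ _) fun s _ => ?_
    have h1 : ‖g s‖ ≤ 2 * (‖f s‖ * ‖f₁ s‖) := by
      refine (norm_add_le _ _).trans (le_of_eq ?_)
      rw [norm_mul, norm_mul, RCLike.norm_conj, RCLike.norm_conj]; ring
    have h2 : 0 ≤ k⁻¹ * (k * ‖f s‖ - ‖f₁ s‖) ^ 2 := by positivity
    have h3 : k⁻¹ * (k * ‖f s‖ - ‖f₁ s‖) ^ 2 =
        k * ‖f s‖ ^ 2 + k⁻¹ * ‖f₁ s‖ ^ 2 - 2 * (‖f s‖ * ‖f₁ s‖) := by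
      field_simp; ring
    linarith
  rw [intervalIntegral.integral_add (Continuous.intervalIntegrable (by fun_prop) _ _)
    (Continuous.intervalIntegrable (by fun_prop) _ _), intervalIntegral.integral_const_mul,
    intervalIntegral.integral_const_mul] at hg2
  have hn : ‖f x‖ ^ 2 - ‖f x₀‖ ^ 2 ≤ ‖∫ s in x₀..x, g s‖ := by
    rw [← hdiff, Complex.mul_conj, Complex.mul_conj, Complex.normSq_eq_norm_sq,
      Complex.normSq_eq_norm_sq, ← Complex.ofReal_sub, Complex.norm_real]
    exact le_abs_self _
  linarith

variable {q : ℝ → ℂ} (hq : IntervalIntegrable q volume 0 1)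

/-- Real points far to the left are eigenvalues of no `H_t`. -/
theorem exists_forall_discriminant_ne :
    ∃ K : ℝ, ∀ x : ℝ, x < -K → ∀ t : ℝ, discriminant hq (x : ℂ) ≠ 2 * Real.cos t := by
  set Q : ℝ := ∫ s in (0 : ℝ)..1, ‖q s‖ with hQ
  have hQ0 : 0 ≤ Q := intervalIntegral.integral_nonneg zero_le_one fun _ _ => norm_nonneg _
  -- With A = ∫|f'|² and B = ∫|f|², an eigenfunction satisfies A + ∫q|f|² = xB. The Sobolev
  -- inequality with k = Q + 1 bounds |∫q|f|²| by Q(2 + Q)B + A, so A cancels and x ≥ -Q(2 + Q).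
  refine ⟨Q * (2 + Q), fun x hx t heq => ?_⟩
  obtain ⟨a, ha0, ha⟩ := exists_eigen ((charpoly_monodromy_eq_zero_iff hq x t).2 heq)
  have hAC := sol_twiceAC hq x a 0
  have hend : endpoint (sol hq x a 0) = Complex.exp (Complex.I * t) • a := by
    rw [endpoint_sol, map_zero, add_zero, ha]
  set f := ext (sol hq x a 0).1 with hf
  set f₁ := ext (sol hq x a 0).2 with hf₁
  have hfc : Continuous f := continuous_ext _
  have hf₁c : Continuous f₁ := continuous_ext _
  have h0 : f 0 = a.1 := sol_fst_zero hq x a 0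
  have h0' : f₁ 0 = a.2 := sol_snd_zero hq x a 0
  rw [endpoint_apply, Prod.ext_iff] at hend
  have e1 : f 1 = Complex.exp (Complex.I * t) * f 0 := by rw [h0]; exact hend.1
  have e2 : f₁ 1 = Complex.exp (Complex.I * t) * f₁ 0 := by rw [h0']; exact hend.2
  have hp := (hAC.isPrimitiveOn_deriv.mul zero_le_one
    (hAC.isPrimitiveOn zero_le_one).conj).integral_eq zero_le_one
  -- The boundary terms of the integration by parts cancel because |e^{it}| = 1.
  have hb : f₁ 1 * starRingEnd ℂ (f 1) - f₁ 0 * starRingEnd ℂ (f 0) = 0 := by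
    rw [e1, e2, map_mul]
    linear_combination (f₁ 0 * starRingEnd ℂ (f 0)) * exp_mul_conj t
  rw [hb] at hp
  have hqf : IntervalIntegrable (fun s => q s * ((‖f s‖ ^ 2 : ℝ) : ℂ)) volume 0 1 :=
    hq.mul_continuousOn (Continuous.continuousOn (by fun_prop))
  have hform : (∫ s in (0 : ℝ)..1, q s * ((‖f s‖ ^ 2 : ℝ) : ℂ)) +
      (((∫ s in (0 : ℝ)..1, ‖f₁ s‖ ^ 2) - x * ∫ s in (0 : ℝ)..1, ‖f s‖ ^ 2 : ℝ) : ℂ) = 0 := by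
    rw [← hp, ← intervalIntegral.integral_const_mul, ← intervalIntegral.integral_sub
      (Continuous.intervalIntegrable (by fun_prop) _ _)
      (Continuous.intervalIntegrable (by fun_prop) _ _), ← intervalIntegral.integral_ofReal,
      ← intervalIntegral.integral_add hqf (Continuous.intervalIntegrable (by fun_prop) _ _)]
    refine intervalIntegral_congr_ae_unit ?_ (right_mem_Icc.2 zero_le_one)
    filter_upwards [Lp.coeFn_zero ℂ 2 (volume.restrict (Ioc (0 : ℝ) 1))] with s hs
    rw [hs]
    have n1 : f s * starRingEnd ℂ (f s) = ((‖f s‖ ^ 2 : ℝ) : ℂ) := by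
      rw [Complex.mul_conj, Complex.normSq_eq_norm_sq]
    have n2 : f₁ s * starRingEnd ℂ (f₁ s) = ((‖f₁ s‖ ^ 2 : ℝ) : ℂ) := by
      rw [Complex.mul_conj, Complex.normSq_eq_norm_sq]
    simp only [Pi.zero_apply, sub_zero]
    rw [mul_assoc, n1, n2]
    push_cast
    ring
  set A : ℝ := ∫ s in (0 : ℝ)..1, ‖f₁ s‖ ^ 2 with hA
  set B : ℝ := ∫ s in (0 : ℝ)..1, ‖f s‖ ^ 2 with hB
  have hA0 : 0 ≤ A := intervalIntegral.integral_nonneg zero_le_one fun _ _ => by positivity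
  have hB0 : 0 ≤ B := intervalIntegral.integral_nonneg zero_le_one fun _ _ => by positivity
  have hsup : ∀ s ∈ Icc (0 : ℝ) 1, ‖f s‖ ^ 2 ≤ (1 + (Q + 1)) * B + (Q + 1)⁻¹ * A :=
    fun s hs => norm_sq_le_integral hfc hf₁c (hAC.isPrimitiveOn zero_le_one) (by linarith) hs
  have hnorm : ‖∫ s in (0 : ℝ)..1, q s * ((‖f s‖ ^ 2 : ℝ) : ℂ)‖ ≤
      Q * ((1 + (Q + 1)) * B + (Q + 1)⁻¹ * A) := by
    rw [hQ, ← intervalIntegral.integral_mul_const]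
    refine intervalIntegral.norm_integral_le_of_norm_le zero_le_one (ae_of_all _ fun s hs => ?_)
      (hq.norm.mul_const _)
    rw [norm_mul, Complex.norm_real, Real.norm_of_nonneg (by positivity)]
    exact mul_le_mul_of_nonneg_left (hsup s (Ioc_subset_Icc_self hs)) (norm_nonneg _)
  rw [eq_neg_of_add_eq_zero_left hform, norm_neg, Complex.norm_real] at hnorm
  have h1 := (le_abs_self _).trans hnorm
  have h2 : Q * ((Q + 1)⁻¹ * A) ≤ A := by
    have : Q * (Q + 1)⁻¹ ≤ 1 := by
      rw [← div_eq_mul_inv, div_le_one (by linarith)]; linarith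
    nlinarith
  have hBpos : 0 < B := integral_norm_sq_sol_pos hq ha0
  nlinarith

/-- The Lagrange identity: the operators `H_t` for `q` and its conjugate are formally adjoint. -/
theorem inner_fibreGraph {t : ℝ} {u F v G : L2Unit} (hu : (u, F) ∈ fibreGraph q t)
    (hv : (v, G) ∈ fibreGraph (fun x => starRingEnd ℂ (q x)) t) :
    inner ℂ G u = inner ℂ v F := by
  obtain ⟨f, f₁, f₂, hf, f0, f1, hfu, hfF⟩ := hu
  obtain ⟨g, g₁, g₂, hg, g0, g1, hgv, hgG⟩ := hv
  have hp := (((hf.isPrimitiveOn zero_le_one).mul zero_le_one hg.isPrimitiveOn_deriv.conj).sub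
    zero_le_one (hf.isPrimitiveOn_deriv.mul zero_le_one
      (hg.isPrimitiveOn zero_le_one).conj)).integral_eq zero_le_one
  have hb : f 1 * starRingEnd ℂ (g₁ 1) - f₁ 1 * starRingEnd ℂ (g 1)
      - (f 0 * starRingEnd ℂ (g₁ 0) - f₁ 0 * starRingEnd ℂ (g 0)) = 0 := by
    rw [f0, f1, g0, g1, map_mul, map_mul]
    linear_combination
      (f 0 * starRingEnd ℂ (g₁ 0) - f₁ 0 * starRingEnd ℂ (g 0)) * exp_mul_conj t
  rw [hb, intervalIntegral.integral_of_le zero_le_one] at hp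
  rw [← sub_eq_zero, L2.inner_def, L2.inner_def,
    ← integral_sub (L2.integrable_inner G u) (L2.integrable_inner v F), ← neg_eq_zero,
    ← integral_neg, ← hp]
  refine integral_congr_ae ?_
  filter_upwards [hfu, hfF, hgv, hgG] with x e1 e2 e3 e4
  simp only [RCLike.inner_apply] at *
  rw [e1, e2, e3, e4]
  simp only [map_add, map_neg, map_mul, Complex.conj_conj]
  ring

theorem intervalIntegrable_conj (hq : IntervalIntegrable q volume 0 1) :
    IntervalIntegrable (fun x => starRingEnd ℂ (q x)) volume 0 1 :=
  (IsPrimitiveOn.of_integral hq 0).conj.integrable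

/-- The operator `H_t` is densely defined. -/
theorem dense_domain_fibreOp (hq : IntervalIntegrable q volume 0 1) (t : ℝ) :
    Dense ((fibreOp q t).domain : Set L2Unit) := by
  have hq' := intervalIntegrable_conj hq
  obtain ⟨K, hK⟩ := exists_forall_discriminant_ne hq
  obtain ⟨K', hK'⟩ := exists_forall_discriminant_ne hq'
  -- A real point common to the resolvent sets for q and for its conjugate; being real, it is its
  -- own conjugate in the Lagrange identity.
  obtain ⟨x, hx⟩ : ∃ x : ℝ, x < -max K K' := exists_lt _
  have hR := isResolvent_fibreResolvent hq
    (hK x (hx.trans_le (neg_le_neg (le_max_left K K'))) t)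
  have hR' := isResolvent_fibreResolvent hq'
    (hK' x (hx.trans_le (neg_le_neg (le_max_right K K'))) t)
  rw [Submodule.dense_iff_topologicalClosure_eq_top, Submodule.topologicalClosure_eq_top_iff,
    Submodule.eq_bot_iff]
  intro g hg
  obtain ⟨hv, hve⟩ := hR'.1 g
  set v := fibreResolvent hq' t x g
  have hvg : (v, g + (x : ℂ) • v) ∈ fibreGraph (fun x => starRingEnd ℂ (q x)) t :=
    (mem_fibreGraph_iff_exists _ t _ _).2 ⟨hv, by rw [← hve]; abel⟩
  -- If g is orthogonal to the domain and v solves the conjugate problem with right side g, then ⟨v,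
  -- f⟩ = ⟨v, (H_t - x)Rf⟩ = ⟨g, Rf⟩ = 0 for every f, where R is the resolvent of H_t at x. So v =
  -- 0, and g = 0.
  have hv0 : v = 0 := by
    refine ext_inner_right ℂ fun f => ?_
    obtain ⟨hu, hue⟩ := hR.1 f
    have hug : (fibreResolvent hq t x f, f + (x : ℂ) • fibreResolvent hq t x f) ∈ fibreGraph q t :=
      (mem_fibreGraph_iff_exists _ t _ _).2 ⟨hu, by nth_rewrite 2 [← hue]; abel⟩
    have h := inner_fibreGraph hug hvg
    have hperp : inner ℂ g (fibreResolvent hq t x f) = 0 :=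
      Submodule.inner_left_of_mem_orthogonal hu hg
    rw [inner_add_left, inner_add_right, inner_smul_left, inner_smul_right, hperp,
      Complex.conj_ofReal, zero_add] at h
    rw [inner_zero_left]
    linear_combination -h
  obtain ⟨h0, h1⟩ := (mem_fibreGraph_iff_exists _ t _ _).1 hvg
  have : (⟨v, h0⟩ : (fibreOp (fun x => starRingEnd ℂ (q x)) t).domain) = 0 := Subtype.ext hv0
  rw [this, LinearPMap.map_zero, hv0, smul_zero, add_zero] at h1
  exact h1.symm

end Hill

namespace Hill

/-! ### A lower bound for the pairing of normalized eigenfunctions -/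

variable {q : ℝ → ℂ} (hq : IntervalIntegrable q volume 0 1)

theorem norm_adjugate_apply_le (L : ℂ × ℂ →L[ℂ] ℂ × ℂ) {μ : ℂ} (hμ : ‖μ‖ = 1) (v : ℂ × ℂ) :
    ‖adjugate L μ v‖ ≤ 2 * (‖L‖ + 1) * ‖v‖ := by
  have h1 : ‖L (1, 0)‖ ≤ ‖L‖ := by simpa using L.le_opNorm (1, 0)
  have h2 : ‖L (0, 1)‖ ≤ ‖L‖ := by simpa using L.le_opNorm (0, 1)
  have hv1 := norm_fst_le v
  have hv2 := norm_snd_le v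
  have h0 := norm_nonneg L
  rw [adjugate_apply, Prod.norm_def]
  have key : ∀ x y a b : ℂ, ‖x‖ ≤ ‖L‖ → ‖y‖ ≤ ‖L‖ → ‖a‖ ≤ ‖v‖ → ‖b‖ ≤ ‖v‖ →
      ‖(x - μ) * a - y * b‖ ≤ 2 * (‖L‖ + 1) * ‖v‖ := fun x y a b hx hy ha hb => by
    calc ‖(x - μ) * a - y * b‖ ≤ ‖x - μ‖ * ‖a‖ + ‖y‖ * ‖b‖ := by
          rw [← norm_mul, ← norm_mul]; exact norm_sub_le _ _
      _ ≤ (‖L‖ + 1) * ‖v‖ + (‖L‖ + 1) * ‖v‖ := by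
          have : ‖x - μ‖ ≤ ‖L‖ + 1 := (norm_sub_le _ _).trans (by rw [hμ]; linarith)
          have : ‖y‖ ≤ ‖L‖ + 1 := by linarith
          gcongr
      _ = _ := by ring
  exact max_le (key _ _ _ _ ((norm_snd_le _).trans h2) ((norm_fst_le _).trans h2) hv1 hv2)
    (key _ _ _ _ ((norm_fst_le _).trans h1) ((norm_snd_le _).trans h1) hv2 hv1)

theorem norm_exp_I_mul (t : ℝ) : ‖Complex.exp (Complex.I * t)‖ = 1 := by
  rw [mul_comm, Complex.norm_exp_ofReal_mul_I]

/-- The bound for `|F'(z)| / |α|`. -/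
noncomputable def pairingBound (z : ℂ) : ℝ :=
  2 * (‖monodromy hq z‖ + 1) * ‖endSource hq z‖ * (‖toL2‖ * (‖solver hq z‖ * ‖initial‖))

theorem continuous_endSource : Continuous (endSource hq) :=
  continuous_const.clm_comp ((continuous_solver hq).clm_comp continuous_const)

theorem continuous_pairingBound : Continuous (pairingBound hq) := by
  have h1 := continuous_monodromy hq
  have h2 := continuous_endSource hq
  have h3 := continuous_solver hq
  unfold pairingBound
  fun_prop

theorem sol_zero_right (z : ℂ) (c : ℂ × ℂ) : sol hq z c 0 = solver hq z (initial c) := by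
  simp [sol]

/-- Ψs is orthogonal to the range of H_t - z. If F'(z) ≠ 0, that range contains Ψs - cΨ for a
suitable c, so 1 = c⟨Ψs, Ψ⟩, while |c F'(z)| is bounded by norms continuous in z. Only the defining
relation of the adjoint is used, not its form as a differential operator. -/
theorem norm_deriv_discriminant_le {t : ℝ} {z : ℂ} {Ψ Ψs : L2Unit}
    (hΨ : UnboundedOp.IsNormalizedEigenvector (fibreOp q t) z Ψ)
    (hΨs : UnboundedOp.IsNormalizedEigenvector (fibreOp q t).adjoint (starRingEnd ℂ z) Ψs) :
    ‖deriv (discriminant hq) z‖ ≤ pairingBound hq z * ‖inner ℂ Ψs Ψ‖ := by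
  obtain ⟨hΨ1, hΨd, hΨe⟩ := hΨ
  obtain ⟨hΨs1, hΨsd, hΨse⟩ := hΨs
  have hnn : 0 ≤ pairingBound hq z := by unfold pairingBound; positivity
  by_cases hd : deriv (discriminant hq) z = 0
  · rw [hd, norm_zero]; positivity
  obtain ⟨a, hΨa, ha⟩ := (mem_fibreGraph_smul_iff hq t z Ψ).1
    ((mem_fibreGraph_iff_exists q t _ _).2 ⟨hΨd, hΨe⟩)
  have hμ1 := norm_exp_I_mul t
  set μ := Complex.exp (Complex.I * t) with hμ
  have hμ0 : μ ≠ 0 := Complex.exp_ne_zero _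
  have hane : a ≠ 0 := by
    rintro rfl
    rw [hΨa, sol_zero_right] at hΨ1
    simp at hΨ1
  have hM := adjugate_monodromyDeriv hq ha
  rw [monodromyDeriv_apply, ← hΨa] at hM
  have hne : -μ * deriv (discriminant hq) z ≠ 0 := mul_ne_zero (neg_ne_zero.2 hμ0) hd
  have hA : adjugate (monodromy hq z) μ ≠ 0 := fun h => by
    rw [h, zero_apply] at hM
    exact smul_ne_zero hne hane hM.symm
  have hD : det (monodromy hq z) - tr (monodromy hq z) * μ + μ ^ 2 = 0 := by
    have := adjugate_apply_sub (L := monodromy hq z) (μ := μ) a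
    rw [ha, sub_self, map_zero] at this
    exact (smul_eq_zero.1 this.symm).resolve_right hane
  obtain ⟨k, hk⟩ := exists_smul_of_eigen hA hane ha
    (b := adjugate (monodromy hq z) μ (endSource hq z Ψs))
    (by rw [apply_adjugate, hD, zero_smul, add_zero])
  -- Solvability of (H_t - z)u = h requires the adjugate to kill `endSource` h. It sends the end
  -- values of Ψs to ka and those of Ψ to -μF'(z)a, so this quotient balances the two.
  set c := k / (-μ * deriv (discriminant hq) z) with hc
  obtain ⟨b, hb⟩ := exists_apply_sub_eq hA (v := -endSource hq z (Ψs - c • Ψ)) (by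
    rw [map_neg, map_sub, map_smul, map_sub, map_smul, hk, hM, smul_smul, hc,
      div_mul_cancel₀ _ hne, sub_self, neg_zero])
  set h := Ψs - c • Ψ with hh
  obtain ⟨hud, hue⟩ := (mem_fibreGraph_iff_exists q t (toL2 (sol hq z b h).1)
    (h + z • toL2 (sol hq z b h).1)).1 (by
      rw [mem_fibreGraph_iff hq t z]
      refine ⟨b, by rw [add_sub_cancel_right], ?_⟩
      rw [add_sub_cancel_right, endpoint_sol, ← hμ]
      linear_combination (norm := module) hb)
  have hadj := (LinearPMap.adjoint_isFormalAdjoint (dense_domain_fibreOp hq t)) ⟨Ψs, hΨsd⟩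
    ⟨_, hud⟩
  rw [hΨse, hue] at hadj
  simp only [inner_smul_left, inner_add_right, inner_smul_right, Complex.conj_conj] at hadj
  have hperp : inner ℂ Ψs h = 0 := by linear_combination -hadj
  rw [hh, inner_sub_right, inner_smul_right, inner_self_eq_norm_sq_to_K, hΨs1, sub_eq_zero] at hperp
  have hn : 1 = ‖c‖ * ‖inner ℂ Ψs Ψ‖ := by
    rw [← norm_mul, ← hperp]; simp
  have hcn : ‖c‖ * ‖deriv (discriminant hq) z‖ = ‖k‖ := by
    rw [hc, norm_div, norm_mul, norm_neg, hμ1, one_mul, div_mul_cancel₀]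
    exact norm_ne_zero_iff.2 hd
  have hka : ‖k‖ * ‖a‖ ≤ 2 * (‖monodromy hq z‖ + 1) * ‖endSource hq z‖ := by
    rw [← norm_smul, ← hk]
    refine (norm_adjugate_apply_le _ hμ1 _).trans ?_
    have : ‖endSource hq z Ψs‖ ≤ ‖endSource hq z‖ := by
      simpa [hΨs1] using (endSource hq z).le_opNorm Ψs
    gcongr
  -- Normalization of Ψ keeps its initial vector a away from zero, which turns the bound on ‖ka‖
  -- into one on |k|.
  have ha1 : 1 ≤ (‖toL2‖ * (‖solver hq z‖ * ‖initial‖)) * ‖a‖ := by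
    calc (1 : ℝ) = ‖toL2 (solver hq z (initial a)).1‖ := by rw [← sol_zero_right, ← hΨa, hΨ1]
      _ ≤ ‖toL2‖ * ‖(solver hq z (initial a)).1‖ := toL2.le_opNorm _
      _ ≤ ‖toL2‖ * (‖solver hq z‖ * (‖initial‖ * ‖a‖)) := by
          gcongr
          refine (norm_fst_le _).trans (((solver hq z).le_opNorm _).trans ?_)
          gcongr
          exact initial.le_opNorm a
      _ = _ := by ring
  set X := ‖toL2‖ * (‖solver hq z‖ * ‖initial‖) with hX
  have hX0 : 0 ≤ X := by positivity
  have hkb : ‖k‖ ≤ pairingBound hq z := by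
    calc ‖k‖ ≤ ‖k‖ * (X * ‖a‖) := le_mul_of_one_le_right (norm_nonneg _) ha1
      _ = (‖k‖ * ‖a‖) * X := by ring
      _ ≤ 2 * (‖monodromy hq z‖ + 1) * ‖endSource hq z‖ * X := by gcongr
  calc ‖deriv (discriminant hq) z‖ = (‖c‖ * ‖inner ℂ Ψs Ψ‖) * ‖deriv (discriminant hq) z‖ := by
        rw [← hn, one_mul]
    _ = ‖k‖ * ‖inner ℂ Ψs Ψ‖ := by rw [← hcn]; ring
    _ ≤ _ := by gcongr

end Hill

/-! ### Resolvents and spectral projections of unbounded operators -/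

namespace UnboundedOp

variable {E : Type*} [NormedAddCommGroup E] [NormedSpace ℂ E]

theorem IsResolvent.apply_eigen {T : E →ₗ.[ℂ] E} {z w : ℂ} {R : E →L[ℂ] E}
    (hR : IsResolvent T z R) (hzw : w ≠ z) {v : E} (hv : v ∈ T.domain)
    (he : T ⟨v, hv⟩ = w • v) : R v = (w - z)⁻¹ • v := by
  have h := hR.2 ⟨v, hv⟩
  simp only at h
  rw [he, ← sub_smul, map_smul] at h
  rw [← h, smul_smul, inv_mul_cancel₀ (sub_ne_zero.2 hzw), one_smul, h]

/-- The resolvent is continuous. -/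
theorem continuousOn_resolvent [CompleteSpace E] {T : E →ₗ.[ℂ] E} {s : Set ℂ}
    {R : ℂ → E →L[ℂ] E} (hR : ∀ z ∈ s, IsResolvent T z (R z)) : ContinuousOn R s := by
  intro z₀ hz₀
  have h0 := hR z₀ hz₀
  have hc : Continuous fun z : ℂ => 1 - (z - z₀) • R z₀ := by fun_prop
  have hu : IsUnit (1 - (z₀ - z₀) • R z₀) := by simp
  have hev : ∀ᶠ z in 𝓝 z₀, IsUnit (1 - (z - z₀) • R z₀) :=
    hc.continuousAt.eventually (Units.isOpen.mem_nhds hu)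
  have hinv : ContinuousAt (fun z : ℂ => R z₀ * Ring.inverse (1 - (z - z₀) • R z₀)) z₀ := by
    refine continuousAt_const.mul ?_
    obtain ⟨u, hu'⟩ := hu
    refine ContinuousAt.comp (g := Ring.inverse) ?_ hc.continuousAt
    rw [← hu']
    exact NormedRing.inverse_continuousAt u
  have heq : ∀ᶠ z in 𝓝[s] z₀, R z = R z₀ * Ring.inverse (1 - (z - z₀) • R z₀) := by
    filter_upwards [mem_nhdsWithin_of_mem_nhds hev, self_mem_nhdsWithin] with z hz hzs
    have h1 := hR z hzs
    -- The first resolvent identity. It expresses R z through R z₀ and the inverse of an operator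
    -- close to 1.
    have hres : R z * (1 - (z - z₀) • R z₀) = R z₀ := by
      ext f
      obtain ⟨hd, he⟩ := h0.1 f
      have h2 := h1.2 ⟨R z₀ f, hd⟩
      simp only at h2
      have h3 : T ⟨R z₀ f, hd⟩ - z • R z₀ f = f - (z - z₀) • R z₀ f := by
        rw [← sub_add_cancel (T ⟨R z₀ f, hd⟩) (z₀ • R z₀ f), he]; module
      rw [h3] at h2
      simpa using h2
    calc R z = R z * ((1 - (z - z₀) • R z₀) * Ring.inverse (1 - (z - z₀) • R z₀)) := by
          rw [Ring.mul_inverse_cancel _ hz, mul_one]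
      _ = _ := by rw [← mul_assoc, hres]
  have hz0 : R z₀ = R z₀ * Ring.inverse (1 - (z₀ - z₀) • R z₀) := by simp
  refine (hinv.continuousWithinAt (s := s)).congr_of_eventuallyEq heq hz0

/-- The circle integral of a resolvent, applied to an eigenvector. -/
theorem circleIntegral_resolvent_apply [CompleteSpace E] {T : E →ₗ.[ℂ] E} {w w' : ℂ} {r : ℝ}
    (hr : 0 < r) {R : ℂ → E →L[ℂ] E} (hR : ∀ z ∈ Metric.sphere w r, IsResolvent T z (R z))
    {v : E} (hv : v ∈ T.domain) (he : T ⟨v, hv⟩ = w' • v) (hw' : w' ∉ Metric.sphere w r) :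
    (∮ z in C(w, r), R z) v = (∮ z in C(w, r), (w' - z)⁻¹) • v := by
  have hint : CircleIntegrable R w r := (continuousOn_resolvent hR).circleIntegrable hr.le
  have h1 : (∮ z in C(w, r), R z) v = ∮ z in C(w, r), R z v := by
    simp only [circleIntegral]
    rw [← ContinuousLinearMap.apply_apply (𝕜 := ℂ) v,
      ← ContinuousLinearMap.intervalIntegral_comp_comm _ hint.out]
    simp
  rw [h1, ← circleIntegral.integral_smul_const]
  exact circleIntegral.integral_congr hr.le fun z hz =>
    (hR z hz).apply_eigen (by rintro rfl; exact hw' hz) hv he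

theorem circleIntegral_sub_inv_self {w : ℂ} {r : ℝ} (hr : 0 < r) :
    (∮ z in C(w, r), (w - z)⁻¹) = -(2 * (Real.pi : ℂ) * Complex.I) := by
  rw [← circleIntegral.integral_sub_center_inv w hr.ne']
  simp only [circleIntegral, ← intervalIntegral.integral_neg]
  congr 1; ext θ
  rw [← neg_sub, inv_neg, smul_neg]

theorem circleIntegral_sub_inv_of_notMem {w w' : ℂ} {r : ℝ} (hr : 0 < r)
    (h : w' ∉ Metric.closedBall w r) : (∮ z in C(w, r), (w' - z)⁻¹) = 0 := by
  have hne : ∀ z ∈ Metric.closedBall w r, w' - z ≠ 0 := fun z hz h0 =>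
    h (sub_eq_zero.1 h0 ▸ hz)
  refine Complex.circleIntegral_eq_zero_of_differentiable_on_off_countable hr.le
    countable_empty (ContinuousOn.inv₀ (by fun_prop) hne) fun z hz => ?_
  exact DifferentiableAt.inv (by fun_prop) (hne z (Metric.ball_subset_closedBall hz.1))

theorem IsSpectralProjection.apply_eigen [CompleteSpace E] {T : E →ₗ.[ℂ] E} {w : ℂ}
    {P : E →L[ℂ] E} (hP : IsSpectralProjection T w P) {v : E} (hv : v ∈ T.domain)
    (he : T ⟨v, hv⟩ = w • v) : P v = v := by
  obtain ⟨r, hr, -, R, hR, rfl⟩ := hP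
  rw [smul_apply, circleIntegral_resolvent_apply hr hR hv he (by simp [hr.ne]),
    circleIntegral_sub_inv_self hr, smul_smul, neg_mul_neg,
    inv_mul_cancel₀ Complex.two_pi_I_ne_zero, one_smul]

theorem mem_spectrum_of_eigen {T : E →ₗ.[ℂ] E} {w : ℂ} {v : E} (hv0 : v ≠ 0)
    (hv : v ∈ T.domain) (he : T ⟨v, hv⟩ = w • v) : w ∈ spectrum T := by
  rintro ⟨R, hR⟩
  exact hv0 (hR.eq_zero (y := ⟨v, hv⟩) he)

/-- The other eigenvalue lies outside the closed disc, so (w' - z)⁻¹ is holomorphic there and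
Cauchy's theorem gives zero. Together with the residue at w itself, this is all that is needed of
the Riesz projection. -/
theorem IsSpectralProjection.apply_eigen_of_ne [CompleteSpace E] {T : E →ₗ.[ℂ] E} {w w' : ℂ}
    {P : E →L[ℂ] E} (hP : IsSpectralProjection T w P) (hne : w' ≠ w) {v : E}
    (hv : v ∈ T.domain) (he : T ⟨v, hv⟩ = w' • v) : P v = 0 := by
  by_cases hv0 : v = 0
  · rw [hv0, map_zero]
  obtain ⟨r, hr, hs, R, hR, rfl⟩ := hP
  have hw' : w' ∉ Metric.closedBall w r := fun h =>
    hne (hs ⟨h, mem_spectrum_of_eigen hv0 hv he⟩)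
  rw [smul_apply, circleIntegral_resolvent_apply hr hR hv he
    (fun h => hw' (Metric.sphere_subset_closedBall h)), circleIntegral_sub_inv_of_notMem hr hw',
    zero_smul, smul_zero]

theorem exists_isSpectralProjection {T : E →ₗ.[ℂ] E} {w : ℂ}
    (h : ∀ᶠ z in 𝓝[≠] w, z ∈ resolventSet T) : ∃ P, IsSpectralProjection T w P := by
  rw [eventually_nhdsWithin_iff, Metric.eventually_nhds_iff] at h
  obtain ⟨ε, hε, h⟩ := h
  have hres : ∀ z, dist z w ≤ ε / 2 → z ≠ w → z ∈ resolventSet T := fun z hz hne =>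
    h (by linarith) hne
  classical
  let R : ℂ → E →L[ℂ] E := fun z => if hz : z ∈ resolventSet T then hz.choose else 0
  refine ⟨_, ε / 2, by positivity, ?_, R, fun z hz => ?_, rfl⟩
  · rintro z ⟨hz, hs⟩
    by_contra hne
    exact hs (hres z hz hne)
  · have hz' : z ∈ resolventSet T := hres z hz.le (by
      rintro rfl
      have : (0 : ℝ) = ε / 2 := by simpa using hz
      linarith)
    simp only [R, dif_pos hz']
    exact hz'.choose_spec

end UnboundedOp

namespace Hill

/-! ### Analytic functions near a critical point -/

theorem exists_pow_factor {f : ℂ → ℂ} {w : ℂ} (hf : AnalyticAt ℂ f w)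
    (hne : ¬ ∀ᶠ z in 𝓝 w, f z = f w) :
    ∃ (m : ℕ) (g : ℂ → ℂ), 0 < m ∧ AnalyticAt ℂ g w ∧ g w ≠ 0 ∧
      ∀ᶠ z in 𝓝 w, f z = f w + (z - w) ^ m * g z := by
  have hf' : AnalyticAt ℂ (fun z => f z - f w) w := hf.sub analyticAt_const
  obtain ⟨m, g, hg, hg0, h⟩ := hf'.exists_eventuallyEq_pow_smul_nonzero_iff.2 (fun h => hne (by
    filter_upwards [h] with z hz using sub_eq_zero.1 hz))
  refine ⟨m, g, Nat.pos_of_ne_zero ?_, hg, hg0, ?_⟩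
  · rintro rfl
    have := h.self_of_nhds
    rw [sub_self, pow_zero, one_smul] at this
    exact hg0 this.symm
  · filter_upwards [h] with z hz
    rw [smul_eq_mul] at hz
    linear_combination hz

/-- Near a point, `|f - f(w)|^p` with some `p < 1` is dominated by `|f'|`. -/
theorem exists_rpow_norm_sub_le_norm_deriv {f : ℂ → ℂ} {w : ℂ} (hf : AnalyticAt ℂ f w)
    (hne : ¬ ∀ᶠ z in 𝓝 w, f z = f w) :
    ∃ (p C : ℝ), 0 ≤ p ∧ p < 1 ∧ 0 < C ∧
      ∀ᶠ z in 𝓝 w, ‖f z - f w‖ ^ p ≤ C * ‖deriv f z‖ := by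
  obtain ⟨m, g, hm, hg, hg0, h⟩ := exists_pow_factor hf hne
  obtain ⟨n, rfl⟩ : ∃ n, m = n + 1 := ⟨m - 1, by omega⟩
  have hd : ∀ᶠ z in 𝓝 w, deriv f z =
      (z - w) ^ n * ((n + 1) * g z + (z - w) * deriv g z) := by
    filter_upwards [h.eventually_nhds, hg.eventually_analyticAt] with z hz hgz
    rw [EventuallyEq.deriv_eq hz]
    have h1 : HasDerivAt (fun z => (z - w) ^ (n + 1)) (((n + 1 : ℕ) : ℂ) * (z - w) ^ n * 1) z :=
      ((hasDerivAt_id z).sub_const w).pow (n + 1)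
    rw [((h1.fun_mul hgz.differentiableAt.hasDerivAt).const_add (f w)).deriv]
    push_cast
    ring
  have hcont : ContinuousAt (fun z => ‖((n : ℂ) + 1) * g z + (z - w) * deriv g z‖) w := by
    have := hg.continuousAt
    have := hg.deriv.continuousAt
    fun_prop
  have hlow : ∀ᶠ z in 𝓝 w, ‖g w‖ / 2 < ‖((n : ℂ) + 1) * g z + (z - w) * deriv g z‖ := by
    refine hcont.eventually (lt_mem_nhds ?_)
    have h1 : ‖((n : ℂ) + 1) * g w + (w - w) * deriv g w‖ = ((n : ℝ) + 1) * ‖g w‖ := by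
      rw [sub_self, zero_mul, add_zero, norm_mul]
      congr 1
      exact_mod_cast Complex.norm_natCast (n + 1)
    have h2 : 0 < ‖g w‖ := norm_pos_iff.2 hg0
    have h3 : (0 : ℝ) ≤ n := Nat.cast_nonneg n
    change ‖g w‖ / 2 < ‖((n : ℂ) + 1) * g w + (w - w) * deriv g w‖
    rw [h1]
    nlinarith
  have hup : ∀ᶠ z in 𝓝 w, ‖g z‖ < ‖g w‖ + 1 :=
    hg.continuousAt.norm.eventually (gt_mem_nhds (lt_add_one _))
  have hgpos : 0 < ‖g w‖ := norm_pos_iff.2 hg0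
  -- If f - f(w) has a zero of order n + 1, it is of size |z - w|^(n+1) and f' of size |z - w|^n;
  -- the exponent n/(n + 1) < 1 compares them.
  set p : ℝ := n / (n + 1 : ℝ) with hp
  have hn0 : (0 : ℝ) ≤ n := Nat.cast_nonneg n
  refine ⟨p, (‖g w‖ + 1) ^ p * (2 / ‖g w‖), by positivity, ?_, by positivity, ?_⟩
  · rw [hp, div_lt_one (by positivity)]; linarith
  filter_upwards [h, hd, hlow, hup] with z h1 h2 h3 h4
  have e1 : ‖f z - f w‖ ≤ ‖z - w‖ ^ (n + 1) * (‖g w‖ + 1) := by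
    rw [h1, add_sub_cancel_left, norm_mul, norm_pow]
    gcongr
  have e2 : (‖z - w‖ ^ (n + 1)) ^ p = ‖z - w‖ ^ n := by
    rw [← Real.rpow_natCast, ← Real.rpow_mul (norm_nonneg _), ← Real.rpow_natCast]
    congr 1
    rw [hp]; push_cast; field_simp
  calc ‖f z - f w‖ ^ p ≤ (‖z - w‖ ^ (n + 1) * (‖g w‖ + 1)) ^ p := by gcongr
    _ = (‖g w‖ + 1) ^ p * (2 / ‖g w‖) * (‖z - w‖ ^ n * (‖g w‖ / 2)) := by
        rw [Real.mul_rpow (by positivity) (by positivity), e2]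
        field_simp
    _ ≤ (‖g w‖ + 1) ^ p * (2 / ‖g w‖) * ‖deriv f z‖ := by
        rw [h2, norm_mul, norm_pow]
        gcongr

/-- Near a critical point every value close to the critical value is taken at least twice. -/
theorem exists_two_preimages {f : ℂ → ℂ} {w : ℂ} (hf : AnalyticAt ℂ f w)
    (hne : ¬ ∀ᶠ z in 𝓝 w, f z = f w) (hd : deriv f w = 0) {U : Set ℂ} (hU : U ∈ 𝓝 w) :
    ∀ᶠ v in 𝓝[≠] (f w), ∃ z₁ ∈ U, ∃ z₂ ∈ U, z₁ ≠ z₂ ∧ f z₁ = v ∧ f z₂ = v := by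
  obtain ⟨m, g, hm, hg, hg0, h⟩ := exists_pow_factor hf hne
  -- Order 1 would give f'(w) = g(w) ≠ 0.
  have hm1 : 1 < m := by
    refine lt_of_le_of_ne hm fun h1 => hg0 ?_
    subst h1
    have h2 := EventuallyEq.deriv_eq h
    have h3 : HasDerivAt (fun z => (z - w) ^ 1) 1 w := by
      simpa using (hasDerivAt_id w).sub_const w
    rw [((h3.fun_mul hg.differentiableAt.hasDerivAt).const_add (f w)).deriv, hd] at h2
    simpa using h2.symm
  obtain ⟨c, hc⟩ := IsAlgClosed.exists_pow_nat_eq (g w) hm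
  -- An analytic m-th root of g near w: the principal power is applied to g/g(w), which is close to
  -- 1. With k = (z - w)G the function becomes f(w) + k^m.
  let G : ℂ → ℂ := fun z => c * (g z / g w) ^ ((m : ℂ)⁻¹)
  have hGm : ∀ z, G z ^ m = g z := fun z => by
    simp only [G]
    rw [mul_pow, Complex.cpow_nat_inv_pow _ hm.ne', hc, mul_div_cancel₀ _ hg0]
  have hGa : AnalyticAt ℂ G w := by
    refine analyticAt_const.mul ((hg.div analyticAt_const hg0).cpow analyticAt_const ?_)
    rw [Pi.div_apply, div_self hg0]
    exact Complex.one_mem_slitPlane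
  have hGw : G w ≠ 0 := fun h0 => hg0 (by rw [← hGm w, h0, zero_pow hm.ne'])
  let k : ℂ → ℂ := fun z => (z - w) * G z
  have hka : AnalyticAt ℂ k w := (analyticAt_id.sub analyticAt_const).mul hGa
  have hkw : k w = 0 := by simp [k]
  have hkd : HasDerivAt k (G w) w := by
    have := ((hasDerivAt_id w).sub_const w).fun_mul hGa.differentiableAt.hasDerivAt
    rw [one_mul, id, sub_self, zero_mul, add_zero] at this
    exact this
  -- k'(w) = G(w) ≠ 0, so k is not locally constant and the open mapping theorem applies.
  have hopen : 𝓝 (0 : ℂ) ≤ map k (𝓝 w) := by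
    rw [← hkw]
    refine (hka.eventually_constant_or_nhds_le_map_nhds).resolve_left fun hconst => ?_
    have h2 : deriv k w = 0 := by
      rw [EventuallyEq.deriv_eq (f := fun _ => k w) hconst]; simp
    exact hGw (hkd.deriv ▸ h2)
  have hV : U ∩ {z | f z = f w + (z - w) ^ m * g z} ∈ 𝓝 w := inter_mem hU h
  have him := hopen (image_mem_map hV)
  obtain ⟨ρ, hρ, hball⟩ := Metric.mem_nhds_iff.1 him
  have hnear : ∀ᶠ v in 𝓝[≠] (f w), ‖v - f w‖ < ρ ^ m := by
    refine mem_nhdsWithin_of_mem_nhds ?_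
    filter_upwards [Metric.ball_mem_nhds (f w) (pow_pos hρ m)] with v hv
    rwa [mem_ball_iff_norm] at hv
  filter_upwards [hnear, self_mem_nhdsWithin] with v hv hvne
  obtain ⟨ζ, hζ⟩ := IsAlgClosed.exists_pow_nat_eq (v - f w) hm
  have hζ0 : ζ ≠ 0 := by
    rintro rfl
    rw [zero_pow hm.ne'] at hζ
    exact hvne (sub_eq_zero.1 hζ.symm)
  have hω := Complex.isPrimitiveRoot_exp m hm.ne'
  set ω := Complex.exp (2 * Real.pi * Complex.I / m)
  have key : ∀ ξ : ℂ, ξ ^ m = v - f w → ∃ z ∈ U, k z = ξ ∧ f z = v := fun ξ hξ => by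
    have hξn : ‖ξ‖ < ρ := by
      rw [← hξ, norm_pow] at hv
      exact lt_of_pow_lt_pow_left₀ m hρ.le hv
    obtain ⟨z, ⟨hzU, hz⟩, hkz⟩ := hball (by rwa [mem_ball_zero_iff] : ξ ∈ Metric.ball 0 ρ)
    refine ⟨z, hzU, hkz, ?_⟩
    have : (z - w) ^ m * g z = ξ ^ m := by rw [← hkz, ← hGm z, ← mul_pow]
    rw [hz, this, hξ]; ring
  obtain ⟨z₁, hz₁, hk₁, hf₁⟩ := key ζ hζ
  -- ζ and ωζ are distinct m-th roots of v - f(w), since m > 1 and ζ ≠ 0. Their preimages under k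
  -- differ as well.
  obtain ⟨z₂, hz₂, hk₂, hf₂⟩ := key (ω * ζ) (by rw [mul_pow, hω.pow_eq_one, one_mul, hζ])
  refine ⟨z₁, hz₁, z₂, hz₂, ?_, hf₁, hf₂⟩
  rintro rfl
  rw [hk₁] at hk₂
  exact hω.ne_one hm1 (mul_right_cancel₀ hζ0 (by rw [one_mul]; exact hk₂.symm))

/-! ### Unbounded spectral projections -/

variable {q : ℝ → ℂ} (hq : IntervalIntegrable q volume 0 1)

/-- By the identity theorem F would be the constant 2 cos t on ℂ, against the half-line on which it
never takes that value. -/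
theorem not_eventually_discriminant_eq {w : ℂ} {t : ℝ} (hw : discriminant hq w = 2 * Real.cos t) :
    ¬ ∀ᶠ z in 𝓝 w, discriminant hq z = discriminant hq w := by
  intro h
  have ha : AnalyticOnNhd ℂ (discriminant hq) univ := fun z _ =>
    (differentiable_discriminant hq).analyticAt z
  have hb : AnalyticOnNhd ℂ (fun _ : ℂ => discriminant hq w) univ := fun z _ => analyticAt_const
  have heq := ha.eq_of_eventuallyEq hb h
  obtain ⟨K, hK⟩ := exists_forall_discriminant_ne hq
  obtain ⟨x, hx⟩ : ∃ x : ℝ, x < -K := exists_lt _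
  refine hK x hx t ?_
  rw [heq, hw]

theorem hasDerivAt_two_mul_cos (t : ℝ) :
    HasDerivAt (fun t : ℝ => (2 * Real.cos t : ℂ)) (-(2 * Real.sin t : ℂ)) t := by
  have := ((Real.hasDerivAt_cos t).ofReal_comp).const_mul (2 : ℂ)
  rwa [Complex.ofReal_neg, mul_neg] at this

/-- The eigenfunction of `H_t` whose initial values are given by the adjugate of `M - e^{it}`. -/
noncomputable def blochVector (e : ℂ × ℂ) (x : ℂ × ℝ) : L2Unit :=
  toL2 (sol hq x.1 (adjugate (monodromy hq x.1) (Complex.exp (Complex.I * x.2)) e) 0).1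

theorem continuous_blochVector (e : ℂ × ℂ) : Continuous (blochVector hq e) := by
  unfold blochVector
  simp only [sol_zero_right, adjugate_apply]
  have h1 : Continuous fun x : ℂ × ℝ => monodromy hq x.1 (1, 0) :=
    ((continuous_monodromy hq).comp continuous_fst).clm_apply continuous_const
  have h2 : Continuous fun x : ℂ × ℝ => monodromy hq x.1 (0, 1) :=
    ((continuous_monodromy hq).comp continuous_fst).clm_apply continuous_const
  have h3 : Continuous fun x : ℂ × ℝ => Complex.exp (Complex.I * x.2) := by fun_prop
  refine toL2.continuous.comp (continuous_fst.comp
    (((continuous_solver hq).comp continuous_fst).clm_apply (initial.continuous.comp ?_)))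
  exact (((h2.snd.sub h3).mul continuous_const).sub (h2.fst.mul continuous_const)).prodMk
    (((h1.fst.sub h3).mul continuous_const).sub (h1.snd.mul continuous_const))

theorem blochVector_eigen (e : ℂ × ℂ) {z : ℂ} {t : ℝ} (hz : discriminant hq z = 2 * Real.cos t) :
    ∃ h : blochVector hq e (z, t) ∈ (fibreOp q t).domain,
      fibreOp q t ⟨blochVector hq e (z, t), h⟩ = z • blochVector hq e (z, t) := by
  rw [← mem_fibreGraph_iff_exists, mem_fibreGraph_smul_iff hq]
  refine ⟨_, rfl, ?_⟩
  rw [apply_adjugate, (charpoly_monodromy_eq_zero_iff hq z t).2 hz, zero_smul, add_zero]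

/-- A zero adjugate means M = μ and F = 2μ, but F = 2 cos t is real and Im μ = sin t. This is where
the quasimomenta 0 and π are excluded; there M may be scalar. -/
theorem adjugate_ne_zero_of_sin_ne_zero {z : ℂ} {t : ℝ} (hz : discriminant hq z = 2 * Real.cos t)
    (ht : Real.sin t ≠ 0) : adjugate (monodromy hq z) (Complex.exp (Complex.I * t)) ≠ 0 := by
  intro h
  have h1 := congrArg (fun L : ℂ × ℂ →L[ℂ] ℂ × ℂ => L (1, 0)) h
  have h2 := congrArg (fun L : ℂ × ℂ →L[ℂ] ℂ × ℂ => L (0, 1)) h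
  simp only [adjugate_apply, zero_apply, Prod.mk_eq_zero, mul_one, mul_zero, sub_zero] at h1 h2
  have h3 : 2 * Complex.exp (Complex.I * t) = 2 * Real.cos t := by
    rw [← hz, discriminant, tr]
    linear_combination -h1.1 - h2.2
  have h4 := congrArg Complex.im h3
  rw [mul_comm Complex.I] at h4
  simp [Complex.exp_im] at h4
  exact ht h4

/-- Two simple eigenvalues of the same H_s merge at w with a common nonzero limit of their Bloch
functions, so a projection separating these nearly equal vectors has large norm. -/
theorem not_bounded_projections {w : ℂ} {t : ℝ} (ht : t ∈ Ioo (0 : ℝ) (2 * Real.pi))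
    (hw : discriminant hq w = 2 * Real.cos t) (hd : deriv (discriminant hq) w = 0)
    (hs : Real.sin t ≠ 0) {ε : ℝ} (hε : 0 < ε) :
    ¬ ∃ C : ℝ, ∀ t ∈ Ico (0 : ℝ) (2 * Real.pi), ∀ z ∈ Metric.ball w ε,
      UnboundedOp.IsSimpleEigenvalue (fibreOp q t) z →
        ∀ P : L2Unit →L[ℂ] L2Unit, UnboundedOp.IsSpectralProjection (fibreOp q t) z P →
          ‖P‖ ≤ C := by
  rintro ⟨C, hC⟩
  have hF : AnalyticAt ℂ (discriminant hq) w := (differentiable_discriminant hq).analyticAt w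
  have hne := not_eventually_discriminant_eq hq hw
  obtain ⟨e, he⟩ : ∃ e, adjugate (monodromy hq w) (Complex.exp (Complex.I * t)) e ≠ 0 := by
    by_contra! h
    exact adjugate_ne_zero_of_sin_ne_zero hq hw hs (ContinuousLinearMap.ext h)
  set ψ := blochVector hq e with hψ
  have hψ0 : ψ (w, t) ≠ 0 := fun h => he (initial_eq_zero_of_toL2_sol_eq_zero hq h)
  have hpos : 0 < ‖ψ (w, t)‖ := norm_pos_iff.2 hψ0
  -- If ‖P‖ ≤ C, the two Bloch functions, each within δ of ψ(w, t), give ‖ψ(w, t)‖ ≤ (2|C| + 1)δ.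
  -- The factor 4(|C| + 1) makes this impossible.
  set δ := ‖ψ (w, t)‖ / (4 * (|C| + 1)) with hδ
  have hδ0 : 0 < δ := by positivity
  have hnear : ∀ᶠ x in 𝓝 (w, t), dist (ψ x) (ψ (w, t)) < δ :=
    (continuous_blochVector hq e).continuousAt.eventually (Metric.ball_mem_nhds _ hδ0)
  rw [nhds_prod_eq, eventually_prod_iff] at hnear
  obtain ⟨pz, hpz, pt, hpt, hnear⟩ := hnear
  obtain ⟨p, C', hp0, -, hC', hloj⟩ := exists_rpow_norm_sub_le_norm_deriv hF hne
  have hU : {z | pz z} ∩ Metric.ball w ε ∩ {z | ‖discriminant hq z - discriminant hq w‖ ^ p ≤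
      C' * ‖deriv (discriminant hq) z‖} ∈ 𝓝 w :=
    inter_mem (inter_mem hpz (Metric.ball_mem_nhds w hε)) hloj
  have hpre := exists_two_preimages hF hne hd hU
  have hcosne : ∀ᶠ s in 𝓝[≠] t, (2 * Real.cos s : ℂ) ≠ 2 * Real.cos t :=
    (hasDerivAt_two_mul_cos t).eventually_ne (neg_ne_zero.2 (mul_ne_zero two_ne_zero
      (Complex.ofReal_ne_zero.2 hs)))
  have htend : Tendsto (fun s : ℝ => (2 * Real.cos s : ℂ)) (𝓝[≠] t) (𝓝[≠] (discriminant hq w)) := by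
    rw [hw]
    refine tendsto_nhdsWithin_iff.2 ⟨?_, hcosne⟩
    exact (hasDerivAt_two_mul_cos t).continuousAt.tendsto.mono_left nhdsWithin_le_nhds
  -- t is interior to (0, 2π), so nearby s stay in the range over which the projections are assumed
  -- bounded.
  obtain ⟨s, ⟨hpre, hsne⟩, hps, hs2⟩ := (((htend.eventually hpre).and hcosne).and
    (mem_nhdsWithin_of_mem_nhds (inter_mem hpt (Ioo_mem_nhds ht.1 ht.2)))).exists
  obtain ⟨z₁, ⟨⟨hz₁, hz₁ε⟩, hl₁⟩, z₂, ⟨⟨hz₂, -⟩, -⟩, hz, hF₁, hF₂⟩ := hpre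
  -- The inequality |F - F(w)|^p ≤ C'|F'| shows that near w only values equal to F(w) can be
  -- critical. Hence z₁ is simple.
  have hd₁ : deriv (discriminant hq) z₁ ≠ 0 := by
    intro h0
    have h1 : 0 < ‖discriminant hq z₁ - discriminant hq w‖ := by
      rw [hF₁, hw]; exact norm_pos_iff.2 (sub_ne_zero.2 hsne)
    have h2 := Real.rpow_pos_of_pos h1 p
    simp only [mem_ofPred_eq, h0, norm_zero, mul_zero] at hl₁
    linarith
  have hsimple := isSimpleEigenvalue_of_deriv_ne_zero hq hF₁ hd₁
  obtain ⟨P, hP⟩ := UnboundedOp.exists_isSpectralProjection (T := fibreOp q s) (w := z₁) (by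
    filter_upwards [((differentiable_discriminant hq z₁).hasDerivAt).eventually_ne
      (c := (2 * Real.cos s : ℂ)) hd₁] with z hz
    exact ⟨_, isResolvent_fibreResolvent hq hz⟩)
  have hPC := hC s ⟨hs2.1.le, hs2.2⟩ z₁ hz₁ε hsimple P hP
  obtain ⟨hv₁, he₁⟩ := blochVector_eigen hq e hF₁
  obtain ⟨hv₂, he₂⟩ := blochVector_eigen hq e hF₂
  have hP₁ := hP.apply_eigen hv₁ he₁
  have hP₂ := hP.apply_eigen_of_ne hz.symm hv₂ he₂
  rw [← hψ] at hP₁ hP₂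
  have hle : ‖ψ (z₁, s)‖ ≤ |C| * ‖ψ (z₁, s) - ψ (z₂, s)‖ := by
    calc ‖ψ (z₁, s)‖ = ‖P (ψ (z₁, s) - ψ (z₂, s))‖ := by rw [map_sub, hP₁, hP₂, sub_zero]
      _ ≤ ‖P‖ * ‖ψ (z₁, s) - ψ (z₂, s)‖ := P.le_opNorm _
      _ ≤ _ := by
        gcongr
        exact hPC.trans (le_abs_self C)
  have d₁ := hnear hz₁ hps
  have d₂ := hnear hz₂ hps
  rw [dist_eq_norm] at d₁ d₂
  have h12 : ‖ψ (z₁, s) - ψ (z₂, s)‖ ≤ 2 * δ := by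
    calc ‖ψ (z₁, s) - ψ (z₂, s)‖ = ‖(ψ (z₁, s) - ψ (w, t)) - (ψ (z₂, s) - ψ (w, t))‖ := by
          congr 1; abel
      _ ≤ 2 * δ := (norm_sub_le _ _).trans (by linarith)
  have h1 : ‖ψ (w, t)‖ ≤ ‖ψ (z₁, s)‖ + δ := by
    have := norm_sub_norm_le (ψ (w, t)) (ψ (z₁, s))
    rw [norm_sub_rev] at this
    linarith
  have hδe : δ * (4 * (|C| + 1)) = ‖ψ (w, t)‖ := by rw [hδ]; field_simp
  have h3 : |C| * ‖ψ (z₁, s) - ψ (z₂, s)‖ ≤ |C| * (2 * δ) := by gcongr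
  have h4 : 0 ≤ |C| * δ := by positivity
  nlinarith

/-! ### Integrability of the reciprocal pairing -/

theorem lintegral_rpow_dist_lt_top (s η K : ℝ) (hη : 0 < η) {p : ℝ} (hp : p < 1) :
    ∫⁻ t in puncturedNhd s η, ENNReal.ofReal (K * |t - s| ^ (-p)) < ⊤ := by
  have h0 : IntervalIntegrable (fun x : ℝ => K * x ^ (-p)) volume 0 η :=
    (intervalIntegral.intervalIntegrable_rpow' (by linarith)).const_mul K
  have hr : IntervalIntegrable (fun x : ℝ => K * (x - s) ^ (-p)) volume s (s + η) := by
    simpa [add_comm] using h0.comp_sub_right s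
  have hl : IntervalIntegrable (fun x : ℝ => K * (s - x) ^ (-p)) volume (s - η) s := by
    simpa using (h0.comp_sub_left s).symm
  have key : ∀ {S : Set ℝ} {g : ℝ → ℝ}, MeasurableSet S → IntegrableOn g S volume →
      (∀ t ∈ S, K * |t - s| ^ (-p) = g t) →
      ∫⁻ t in S, ENNReal.ofReal (K * |t - s| ^ (-p)) < ⊤ := fun {S g} hS hg h => by
    rw [setLIntegral_congr_fun (g := fun t => ENNReal.ofReal (g t)) hS
      fun t ht => by simp only; rw [h t ht]]
    exact hg.lintegral_lt_top
  refine (lintegral_union_le _ _ _).trans_lt (ENNReal.add_lt_top.2 ⟨?_, ?_⟩)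
  · refine key measurableSet_Ioo
      (((intervalIntegrable_iff_integrableOn_Ioo_of_le (sub_le_self s hη.le)).1 hl)) fun t ht => ?_
    rw [abs_sub_comm, abs_of_pos (sub_pos.2 ht.2)]
  · refine key measurableSet_Ioo
      (((intervalIntegrable_iff_integrableOn_Ioo_of_le (le_add_of_nonneg_right hη.le)).1 hr))
      fun t ht => ?_
    rw [abs_of_pos (sub_pos.2 ht.1)]

theorem measurableSet_puncturedNhd (s δ : ℝ) : MeasurableSet (puncturedNhd s δ) :=
  measurableSet_Ioo.union measurableSet_Ioo

theorem puncturedNhd_eq {s η : ℝ} (hη : 0 < η) :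
    puncturedNhd s η = Metric.ball s η ∩ {s}ᶜ := by
  ext t
  simp only [puncturedNhd, Real.ball_eq_Ioo, mem_union, mem_Ioo, mem_inter_iff, mem_compl_iff,
    mem_singleton_iff]
  constructor
  · rintro (h | h)
    · exact ⟨⟨h.1, h.2.trans (lt_add_of_pos_right s hη)⟩, h.2.ne⟩
    · exact ⟨⟨(sub_lt_self s hη).trans h.1, h.2⟩, h.1.ne'⟩
  · rintro ⟨h1, h2⟩
    rcases lt_or_gt_of_ne h2 with h | h
    · exact Or.inl ⟨h1.1, h⟩
    · exact Or.inr ⟨h, h1.2⟩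

/-- Along a branch of simple eigenvalues that tends to a point over `s` with `sin s ≠ 0`, the
reciprocal of the pairing of normalized eigenfunctions is integrable. -/
theorem exists_lintegral_inv_pairing_lt_top {w : ℂ} {s δ : ℝ} (hδ : 0 < δ)
    (hw : discriminant hq w = 2 * Real.cos s) (hs : Real.sin s ≠ 0) {ev : ℝ → ℂ}
    {Ψ Ψs : ℝ → L2Unit} (hbr : IsSimpleBranch q s δ ev Ψ Ψs) (hev : Tendsto ev (𝓝[≠] s) (𝓝 w)) :
    ∃ η ∈ Ioc 0 δ, ∫⁻ t in puncturedNhd s η, ‖inner ℂ (Ψs t) (Ψ t)‖ₑ⁻¹ < ⊤ := by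
  have hF : AnalyticAt ℂ (discriminant hq) w := (differentiable_discriminant hq).analyticAt w
  obtain ⟨p, C, hp0, hp1, hC, hloj⟩ :=
    exists_rpow_norm_sub_le_norm_deriv hF (not_eventually_discriminant_eq hq hw)
  have hB : ∀ᶠ z in 𝓝 w, pairingBound hq z < pairingBound hq w + 1 :=
    (continuous_pairingBound hq).continuousAt.eventually (gt_mem_nhds (lt_add_one _))
  -- The derivative of 2 cos at s has modulus 2|sin s|; half of it survives as a lower bound for the
  -- difference quotients nearby.
  have hslope : ∀ᶠ t in 𝓝[≠] s, |Real.sin s| * |t - s| ≤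
      ‖(2 * Real.cos t : ℂ) - 2 * Real.cos s‖ := by
    have h1 := (hasDerivAt_iff_tendsto_slope.1 (hasDerivAt_two_mul_cos s)).norm
    have h2 : |Real.sin s| < ‖-(2 * Real.sin s : ℂ)‖ := by
      rw [norm_neg, norm_mul, Complex.norm_real, Real.norm_eq_abs, Complex.norm_ofNat]
      linarith [abs_pos.2 hs]
    filter_upwards [h1.eventually (lt_mem_nhds h2), self_mem_nhdsWithin] with t ht hts
    have hts' : 0 < |t - s| := abs_pos.2 (sub_ne_zero.2 hts)
    rw [slope_def_module, norm_smul, norm_inv, Real.norm_eq_abs, inv_mul_eq_div,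
      lt_div_iff₀ hts'] at ht
    exact ht.le
  have hgood : ∀ᶠ t in 𝓝[≠] s, t ∈ puncturedNhd s δ := by
    rw [puncturedNhd_eq hδ]
    exact inter_mem (mem_nhdsWithin_of_mem_nhds (Metric.ball_mem_nhds s hδ)) self_mem_nhdsWithin
  set B := pairingBound hq w + 1 with hBdef
  have hB0 : 0 < B := by
    have : 0 ≤ pairingBound hq w := by unfold pairingBound; positivity
    linarith
  set K := C * B * |Real.sin s| ^ (-p) with hK
  have hall : ∀ᶠ t in 𝓝[≠] s, ‖inner ℂ (Ψs t) (Ψ t)‖ₑ⁻¹ ≤ ENNReal.ofReal (K * |t - s| ^ (-p)) := by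
    filter_upwards [hev.eventually hloj, hev.eventually hB, hslope, hgood,
      self_mem_nhdsWithin] with t h1 h2 h3 h4 h5
    have hts : 0 < |t - s| := abs_pos.2 (sub_ne_zero.2 h5)
    have hFt : discriminant hq (ev t) = 2 * Real.cos t := by
      obtain ⟨hn, hd, he⟩ := hbr.eigen t h4
      refine discriminant_eq_of_mem_spectrum hq (UnboundedOp.mem_spectrum_of_eigen ?_ hd he)
      exact norm_ne_zero_iff.1 (by rw [hn]; exact one_ne_zero)
    have h6 := norm_deriv_discriminant_le hq (hbr.eigen t h4) (hbr.adjoint_eigen t h4)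
    rw [hFt, hw] at h1
    set α := ‖inner ℂ (Ψs t) (Ψ t)‖ with hα
    have hα0 : 0 ≤ α := norm_nonneg _
    have h7 : |Real.sin s| ^ p * |t - s| ^ p ≤ C * B * α := by
      rw [← Real.mul_rpow (abs_nonneg _) (abs_nonneg _)]
      calc (|Real.sin s| * |t - s|) ^ p ≤ ‖(2 * Real.cos t : ℂ) - 2 * Real.cos s‖ ^ p := by gcongr
        _ ≤ C * ‖deriv (discriminant hq) (ev t)‖ := h1
        _ ≤ C * (B * α) := by
            gcongr
            exact h6.trans (by gcongr)
        _ = _ := by ring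
    have hsp : 0 < |Real.sin s| ^ p := Real.rpow_pos_of_pos (abs_pos.2 hs) p
    have htp : 0 < |t - s| ^ p := Real.rpow_pos_of_pos hts p
    -- A vanishing pairing would make the integrand infinite; the lower bound just obtained rules it
    -- out for t ≠ s.
    have hαpos : 0 < α := by
      by_contra hneg
      have : α = 0 := le_antisymm (not_lt.1 hneg) hα0
      rw [this, mul_zero] at h7
      exact absurd h7 (not_le.2 (mul_pos hsp htp))
    have h8 : α⁻¹ ≤ K * |t - s| ^ (-p) := by
      rw [hK, Real.rpow_neg (abs_nonneg _), Real.rpow_neg (abs_nonneg _), inv_le_iff_one_le_mul₀ hαpos]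
      calc (1 : ℝ) = (|Real.sin s| ^ p * |t - s| ^ p) *
            ((|Real.sin s| ^ p)⁻¹ * (|t - s| ^ p)⁻¹) := by field_simp
        _ ≤ (C * B * α) * ((|Real.sin s| ^ p)⁻¹ * (|t - s| ^ p)⁻¹) := by gcongr
        _ = _ := by ring
    rw [← ofReal_norm, ← hα, ← ENNReal.ofReal_inv_of_pos hαpos]
    exact ENNReal.ofReal_le_ofReal h8
  rw [eventually_nhdsWithin_iff, Metric.eventually_nhds_iff_ball] at hall
  obtain ⟨η₀, hη₀, hall⟩ := hall
  have hη : 0 < min η₀ δ := lt_min hη₀ hδ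
  refine ⟨min η₀ δ, ⟨hη, min_le_right _ _⟩, ?_⟩
  refine lt_of_le_of_lt ?_ (lintegral_rpow_dist_lt_top s (min η₀ δ) K hη hp1)
  refine setLIntegral_mono' (measurableSet_puncturedNhd _ _) fun t ht => ?_
  rw [puncturedNhd_eq hη] at ht
  exact hall t (Metric.ball_subset_ball (min_le_left _ _) ht.1) ht.2

/-- The branch may sit over another quasimomentum s, such as -t modulo 2π. But F(w) fixes cos s =
cos t, hence sin² s = sin² t ≠ 0. -/
theorem not_isEssentialSpectralSingularity {w : ℂ} {t : ℝ}
    (hw : discriminant hq w = 2 * Real.cos t) (hs : Real.sin t ≠ 0) :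
    ¬ IsEssentialSpectralSingularity q w := by
  rintro ⟨-, s, -, hws, δ, hδ, ev, Ψ, Ψs, hbr, hev, hint⟩
  have hFs := discriminant_eq_of_mem_spectrum hq hws
  have hcos : Real.cos s = Real.cos t := by
    have : (2 * Real.cos s : ℂ) = 2 * Real.cos t := by rw [← hFs, hw]
    exact_mod_cast mul_left_cancel₀ two_ne_zero this
  have hsin : Real.sin s ≠ 0 := by
    intro h0
    have h1 := Real.sin_sq_add_cos_sq s
    have h2 := Real.sin_sq_add_cos_sq t
    rw [h0, hcos] at h1
    exact hs (pow_eq_zero_iff two_ne_zero |>.1 (by linarith))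
  obtain ⟨η, hη, hlt⟩ := exists_lintegral_inv_pairing_lt_top hq hδ hFs hsin hbr hev
  exact hlt.ne (hint η hη)

end Hill

namespace Hill

/-! ### Quasiperiodic extension -/

theorem IsPrimitiveOn.trans {𝕜 : Type*} [RCLike 𝕜] {a b c : ℝ} {u U : ℝ → 𝕜}
    (h₁ : IsPrimitiveOn a b u U) (h₂ : IsPrimitiveOn b c u U) (hab : a ≤ b) (hbc : b ≤ c) :
    IsPrimitiveOn a c u U := by
  refine ⟨h₁.integrable.trans h₂.integrable, fun x hx => ?_⟩
  rcases le_total x b with hxb | hxb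
  · exact h₁.eq x ⟨hx.1, hxb⟩
  · have hI : IntervalIntegrable U volume b x := h₂.integrable.mono_set (by
      rw [uIcc_of_le hxb, uIcc_of_le hbc]; exact Icc_subset_Icc_right hx.2)
    rw [h₂.eq x ⟨hxb, hx.2⟩, h₁.eq b ⟨hab, le_rfl⟩, add_assoc,
      intervalIntegral.integral_add_adjacent_intervals h₁.integrable hI]

theorem IsPrimitiveOn.comp_sub_right {𝕜 : Type*} [RCLike 𝕜] {a b : ℝ} {u U : ℝ → 𝕜}
    (h : IsPrimitiveOn a b u U) (d : ℝ) :
    IsPrimitiveOn (a + d) (b + d) (fun x => u (x - d)) (fun x => U (x - d)) := by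
  refine ⟨h.integrable.comp_sub_right d, fun x hx => ?_⟩
  rw [intervalIntegral.integral_comp_sub_right (fun x => U x), add_sub_cancel_right]
  exact h.eq (x - d) ⟨by linarith [hx.1], by linarith [hx.2]⟩

/-- The extension of a function on `[0, 1)` with `u (x + 1) = μ u x`. -/
noncomputable def quasiExt (μ : ℂ) (u : ℝ → ℂ) (x : ℝ) : ℂ := μ ^ ⌊x⌋ * u (Int.fract x)

theorem quasiExt_of_mem_Ico (μ : ℂ) (u : ℝ → ℂ) (n : ℤ) {x : ℝ} (hx : x ∈ Ico (n : ℝ) (n + 1)) :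
    quasiExt μ u x = μ ^ n * u (x - n) := by
  have : ⌊x⌋ = n := Int.floor_eq_iff.2 hx
  rw [quasiExt, Int.fract, this]

theorem quasiExt_of_mem_Icc {μ : ℂ} (hμ : μ ≠ 0) {u : ℝ → ℂ} (h1 : u 1 = μ * u 0) (n : ℤ) {x : ℝ}
    (hx : x ∈ Icc (n : ℝ) (n + 1)) : quasiExt μ u x = μ ^ n * u (x - n) := by
  rcases hx.2.lt_or_eq with h | rfl
  · exact quasiExt_of_mem_Ico μ u n ⟨hx.1, h⟩
  · have h2 := quasiExt_of_mem_Ico μ u (n + 1) (x := n + 1) (by push_cast; simp)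
    rw [h2]
    push_cast
    rw [sub_self, add_sub_cancel_left, h1, zpow_add_one₀ hμ]
    ring

/-- Unit cells are glued one after another. The condition u(1) = μu(0) makes the extension
continuous at the integers; U needs no matching there, since one point per cell is negligible. -/
theorem IsPrimitiveOn.quasiExt {μ : ℂ} (hμ : μ ≠ 0) {u U : ℝ → ℂ} (h : IsPrimitiveOn 0 1 u U)
    (h1 : u 1 = μ * u 0) {a b : ℝ} (hab : a ≤ b) :
    IsPrimitiveOn a b (quasiExt μ u) (quasiExt μ U) := by
  have hcell : ∀ n : ℤ, IsPrimitiveOn (n : ℝ) (n + 1) (Hill.quasiExt μ u) (Hill.quasiExt μ U) :=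
    fun n => by
      have h2 := (h.comp_sub_right n).const_mul (μ ^ n)
      rw [zero_add, add_comm] at h2
      refine h2.congr (by linarith) (fun x hx => quasiExt_of_mem_Icc hμ h1 n hx) ?_
      have hb : ∀ᵐ x : ℝ, x ≠ n + 1 := by simp [ae_iff, measure_singleton]
      filter_upwards [ae_restrict_mem measurableSet_Ioc, ae_restrict_of_ae hb] with x hx hne
      exact quasiExt_of_mem_Ico μ U n ⟨hx.1.le, lt_of_le_of_ne hx.2 hne⟩
  have hmany : ∀ (n : ℤ) (k : ℕ), IsPrimitiveOn (n : ℝ) (n + k) (Hill.quasiExt μ u)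
      (Hill.quasiExt μ U) := fun n k => by
    induction k with
    | zero => exact ⟨by simp, fun x hx => by
        have : x = n := le_antisymm (by simpa using hx.2) hx.1
        rw [this]; simp⟩
    | succ k ih =>
      have h3 := hcell (n + k)
      push_cast at h3 ⊢
      rw [← add_assoc]
      exact ih.trans h3 (le_add_of_nonneg_right (Nat.cast_nonneg k)) (by linarith)
  obtain ⟨k, hk⟩ := exists_nat_ge (b - ⌊a⌋)
  exact (hmany ⌊a⌋ k).mono (Int.floor_le a) hab (by linarith)

theorem norm_quasiExt {μ : ℂ} (hμ : ‖μ‖ = 1) (u : ℝ → ℂ) (x : ℝ) :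
    ‖quasiExt μ u x‖ = ‖u (Int.fract x)‖ := by
  rw [quasiExt, norm_mul, norm_zpow, hμ, one_zpow, one_mul]

theorem continuous_of_isPrimitiveOn {u U : ℝ → ℂ}
    (h : ∀ a b : ℝ, a ≤ b → IsPrimitiveOn a b u U) : Continuous u := by
  rw [continuous_iff_continuousAt]
  intro x
  exact ((h (x - 1) (x + 1) (by linarith)).continuousOn (by linarith)).continuousAt
    (Icc_mem_nhds (by linarith) (by linarith))

/-! ### A cut-off function -/

/-- A smooth cut-off function on `ℝ`: it vanishes off `[0, n + 2]` and is `1` on `[1, n + 1]`. -/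
noncomputable def cutoff (n : ℕ) (x : ℝ) : ℝ :=
  Real.smoothTransition x * Real.smoothTransition (n + 2 - x)

theorem contDiff_cutoff (n : ℕ) : ContDiff ℝ 2 (cutoff n) :=
  Real.smoothTransition.contDiff.mul
    (Real.smoothTransition.contDiff.comp (contDiff_const.sub contDiff_id))

theorem cutoff_eq_zero (n : ℕ) {x : ℝ} (hx : x ∉ Icc (0 : ℝ) (n + 2)) : cutoff n x = 0 := by
  rw [cutoff]
  rcases lt_or_ge x 0 with h | h
  · rw [Real.smoothTransition.zero_of_nonpos h.le, zero_mul]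
  · rw [Real.smoothTransition.zero_of_nonpos (x := n + 2 - x) ?_, mul_zero]
    by_contra hc
    exact hx ⟨h, by linarith⟩

theorem cutoff_eq_one (n : ℕ) {x : ℝ} (hx : x ∈ Icc (1 : ℝ) (n + 1)) : cutoff n x = 1 := by
  rw [cutoff, Real.smoothTransition.one_of_one_le hx.1,
    Real.smoothTransition.one_of_one_le (by linarith [hx.2]), one_mul]

/-- Both derivatives are continuous and vanish off [0, 1], hence are bounded by compact support. -/
theorem exists_bound_of_contDiff_of_eq {S : ℝ → ℝ} (hS : ContDiff ℝ 2 S)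
    (h0 : ∀ x < 0, S x = 0) (h1 : ∀ x > 1, S x = 1) :
    (∃ C, ∀ x, |deriv S x| ≤ C) ∧ ∃ C, ∀ x, |deriv (deriv S) x| ≤ C := by
  have hd : ∀ x ∉ Icc (0 : ℝ) 1, deriv S =ᶠ[𝓝 x] fun _ => 0 := fun x hx => by
    rcases lt_or_ge x 0 with h | h
    · have : S =ᶠ[𝓝 x] fun _ => 0 := by
        filter_upwards [Iio_mem_nhds h] with y hy using h0 y hy
      filter_upwards [this.deriv] with y hy
      simp [hy]
    · have h' : 1 < x := by
        by_contra hc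
        exact hx ⟨h, not_lt.1 hc⟩
      have : S =ᶠ[𝓝 x] fun _ => 1 := by
        filter_upwards [Ioi_mem_nhds h'] with y hy using h1 y hy
      filter_upwards [this.deriv] with y hy
      simp [hy]
  have hS1 : ContDiff ℝ 1 (deriv S) := (contDiff_succ_iff_deriv (n := 1)).1 hS |>.2.2
  constructor
  · obtain ⟨C, hC⟩ := hS1.continuous.bounded_above_of_compact_support
      (HasCompactSupport.intro isCompact_Icc fun x hx => (hd x hx).self_of_nhds)
    exact ⟨C, hC⟩
  · obtain ⟨C, hC⟩ := (hS1.continuous_deriv le_rfl).bounded_above_of_compact_support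
      (HasCompactSupport.intro isCompact_Icc fun x hx => by
        rw [(hd x hx).deriv_eq]; simp)
    exact ⟨C, hC⟩

/-- The derivatives of the cut-off functions are bounded uniformly, and live on two intervals. -/
theorem exists_cutoff_bound :
    ∃ D : ℝ, 0 ≤ D ∧ ∀ (n : ℕ) (x : ℝ),
      |deriv (cutoff n) x| ≤ D ∧ |deriv (deriv (cutoff n)) x| ≤ D := by
  set S := Real.smoothTransition with hSdef
  have hS : ContDiff ℝ 2 S := Real.smoothTransition.contDiff
  obtain ⟨⟨C₁, hC₁⟩, C₂, hC₂⟩ := exists_bound_of_contDiff_of_eq hS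
    (fun x hx => Real.smoothTransition.zero_of_nonpos hx.le)
    (fun x hx => Real.smoothTransition.one_of_one_le hx.le)
  have hS1 : ContDiff ℝ 1 (deriv S) := (contDiff_succ_iff_deriv (n := 1)).1 hS |>.2.2
  have hb : ∀ x, |S x| ≤ 1 := fun x => by
    rw [abs_of_nonneg (Real.smoothTransition.nonneg x)]
    exact Real.smoothTransition.le_one x
  have hC₁0 : 0 ≤ C₁ := (abs_nonneg _).trans (hC₁ 0)
  have hC₂0 : 0 ≤ C₂ := (abs_nonneg _).trans (hC₂ 0)
  have hdS : ∀ x, HasDerivAt S (deriv S x) x := fun x =>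
    (hS.differentiable (by norm_num) x).hasDerivAt
  have hddS : ∀ x, HasDerivAt (deriv S) (deriv (deriv S) x) x := fun x =>
    (hS1.differentiable (by norm_num) x).hasDerivAt
  have habs : ∀ a b A B : ℝ, |a| ≤ A → |b| ≤ B → |a * b| ≤ A * B := fun a b A B h1 h2 => by
    rw [abs_mul]; gcongr
    exact (abs_nonneg _).trans h1
  -- By Leibniz and |S| ≤ 1 the derivatives of S(x)S(n + 2 - x) are at most 2C₁ and 2C₂ + 2C₁². The
  -- sum covers both and is independent of n.
  refine ⟨2 * C₁ + 2 * C₂ + 2 * C₁ * C₁, by positivity, fun n x => ?_⟩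
  have hsub : ∀ x, HasDerivAt (fun x : ℝ => (n : ℝ) + 2 - x) (-1) x := fun x =>
    (hasDerivAt_id x).const_sub _
  have e1 : deriv (cutoff n) = fun x => deriv S x * S (n + 2 - x) -
      S x * deriv S (n + 2 - x) := by
    funext x
    have := (hdS x).fun_mul ((hdS (n + 2 - x)).comp x (hsub x))
    rw [show deriv (cutoff n) x = _ from this.deriv]
    simp only [Function.comp]
    ring
  have e2 : deriv (deriv (cutoff n)) x = deriv (deriv S) x * S (n + 2 - x) -
      2 * (deriv S x * deriv S (n + 2 - x)) + S x * deriv (deriv S) (n + 2 - x) := by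
    rw [e1]
    have h1 := (hddS x).fun_mul ((hdS (n + 2 - x)).comp x (hsub x))
    have h2 := (hdS x).fun_mul ((hddS (n + 2 - x)).comp x (hsub x))
    refine Eq.trans (h1.fun_sub h2).deriv ?_
    simp only [Function.comp]
    ring
  constructor
  · rw [e1]
    have b1 := habs _ _ _ _ (hC₁ x) (hb (n + 2 - x))
    have b2 := habs _ _ _ _ (hb x) (hC₁ (n + 2 - x))
    have : 0 ≤ C₁ * C₁ := by positivity
    calc _ ≤ |deriv S x * S (n + 2 - x)| + |S x * deriv S (n + 2 - x)| := abs_sub _ _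
      _ ≤ _ := by linarith
  · rw [e2]
    have b1 := habs _ _ _ _ (hC₂ x) (hb (n + 2 - x))
    have b2 := habs _ _ _ _ (hb x) (hC₂ (n + 2 - x))
    have b3 := habs _ _ _ _ (hC₁ x) (hC₁ (n + 2 - x))
    rw [abs_le] at b1 b2 b3 ⊢
    constructor <;> linarith [b1.1, b1.2, b2.1, b2.2, b3.1, b3.2]

theorem deriv_cutoff_eq_zero (n : ℕ) {x : ℝ}
    (hx : x ∉ Icc (0 : ℝ) 1 ∪ Icc (n + 1 : ℝ) (n + 2)) :
    deriv (cutoff n) x = 0 ∧ deriv (deriv (cutoff n)) x = 0 := by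
  have hconst : ∃ c : ℝ, cutoff n =ᶠ[𝓝 x] fun _ => c := by
    by_cases h1 : x ∈ Icc (1 : ℝ) (n + 1)
    · refine ⟨1, ?_⟩
      have h2 : x ∈ Ioo (1 : ℝ) (n + 1) := by
        refine ⟨lt_of_le_of_ne h1.1 ?_, lt_of_le_of_ne h1.2 ?_⟩
        · rintro rfl; exact hx (Or.inl ⟨zero_le_one, le_rfl⟩)
        · rintro rfl; exact hx (Or.inr ⟨le_rfl, by linarith⟩)
      filter_upwards [Ioo_mem_nhds h2.1 h2.2] with y hy
      exact cutoff_eq_one n (Ioo_subset_Icc_self hy)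
    · refine ⟨0, ?_⟩
      have h2 : x ∉ Icc (0 : ℝ) (n + 2) := fun h => by
        rcases le_or_gt x 1 with h3 | h3
        · exact hx (Or.inl ⟨h.1, h3⟩)
        · rcases le_or_gt x (n + 1) with h4 | h4
          · exact h1 ⟨h3.le, h4⟩
          · exact hx (Or.inr ⟨h4.le, h.2⟩)
      filter_upwards [isClosed_Icc.isOpen_compl.mem_nhds h2] with y hy
      exact cutoff_eq_zero n hy
  obtain ⟨c, hc⟩ := hconst
  have hd : deriv (cutoff n) =ᶠ[𝓝 x] fun _ => 0 := by
    filter_upwards [hc.deriv] with y hy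
    simp [hy]
  exact ⟨hd.self_of_nhds, by rw [hd.deriv_eq]; simp⟩

theorem isPrimitiveOn_of_contDiff {g : ℝ → ℝ} (hg : ContDiff ℝ 1 g) {a b : ℝ} :
    IsPrimitiveOn a b (fun x => (g x : ℂ)) (fun x => ((deriv g x : ℝ) : ℂ)) := by
  have hc : Continuous fun x => ((deriv g x : ℝ) : ℂ) :=
    Complex.continuous_ofReal.comp (hg.continuous_deriv le_rfl)
  refine ⟨hc.intervalIntegrable _ _, fun x _ => ?_⟩
  rw [intervalIntegral.integral_eq_sub_of_hasDerivAt (f := fun x => (g x : ℂ))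
    (fun y _ => ((hg.differentiable (by norm_num) y).hasDerivAt).ofReal_comp)
    (hc.intervalIntegrable _ _)]
  ring

/-! ### Bloch waves and the spectrum of `H` -/

theorem norm_sq_toLp {g : ℝ → ℂ} (hg : MemLp g 2 volume) :
    ‖hg.toLp g‖ ^ 2 = ∫ x, ‖g x‖ ^ 2 := by
  have h := L2.inner_def (𝕜 := ℂ) (hg.toLp g) (hg.toLp g)
  rw [inner_self_eq_norm_sq_to_K] at h
  have h2 : (∫ x, inner ℂ (hg.toLp g x) (hg.toLp g x)) = ((∫ x, ‖g x‖ ^ 2 : ℝ) : ℂ) := by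
    rw [← integral_complex_ofReal]
    refine integral_congr_ae ?_
    filter_upwards [hg.coeFn_toLp] with x hx
    rw [hx, inner_self_eq_norm_sq_to_K]
    push_cast; rfl
  rw [h2] at h
  exact Complex.ofReal_injective (by rw [← h]; push_cast; rfl)

variable {q : ℝ → ℂ} (hq : IntervalIntegrable q volume 0 1)

/-- The spectra of the operators `H_t` are contained in the spectrum of `H`. -/
theorem mem_spectrum_lineOp (hper : Function.Periodic q 1) {w : ℂ} {t : ℝ}
    (hw : discriminant hq w = 2 * Real.cos t) : w ∈ UnboundedOp.spectrum (lineOp q) := by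
  rintro ⟨R, hR⟩
  obtain ⟨a, ha0, ha⟩ := exists_eigen ((charpoly_monodromy_eq_zero_iff hq w t).2 hw)
  have hμ1 := norm_exp_I_mul t
  set μ := Complex.exp (Complex.I * t) with hμ
  have hμ0 : μ ≠ 0 := Complex.exp_ne_zero _
  have hAC := sol_twiceAC hq w a 0
  have hend : endpoint (sol hq w a 0) = μ • a := by rw [endpoint_sol, map_zero, add_zero, ha]
  set Y := sol hq w a 0 with hY
  have h0 : ext Y.1 0 = a.1 := sol_fst_zero hq w a 0
  have h0' : ext Y.2 0 = a.2 := sol_snd_zero hq w a 0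
  rw [endpoint_apply, Prod.ext_iff] at hend
  have e1 : ext Y.1 1 = μ * ext Y.1 0 := by rw [h0]; exact hend.1
  have e2 : ext Y.2 1 = μ * ext Y.2 0 := by rw [h0']; exact hend.2
  have hp1' : IsPrimitiveOn 0 1 (ext Y.2) (fun s => (q s - w) * ext Y.1 s) := by
    refine hAC.isPrimitiveOn_deriv.congr zero_le_one (fun _ _ => rfl) ?_
    filter_upwards [Lp.coeFn_zero ℂ 2 (volume.restrict (Ioc (0 : ℝ) 1))] with s hs
    rw [hs]; simp
  set f := quasiExt μ (ext Y.1) with hf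
  set f₁ := quasiExt μ (ext Y.2) with hf₁
  have hpf : ∀ a b : ℝ, a ≤ b → IsPrimitiveOn a b f f₁ := fun a b hab =>
    (hAC.isPrimitiveOn zero_le_one).quasiExt hμ0 e1 hab
  have hpf₁ : ∀ a b : ℝ, a ≤ b → IsPrimitiveOn a b f₁ (fun x => (q x - w) * f x) :=
    fun a b hab => by
      refine (hp1'.quasiExt hμ0 e2 hab).congr hab (fun _ _ => rfl) (ae_of_all _ fun x => ?_)
      have hqx : q (Int.fract x) = q x := by
        simpa using hper.sub_zsmul_eq (x := x) ⌊x⌋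
      simp only [hf, quasiExt, hqx]
      ring
  have hfc : Continuous f := continuous_of_isPrimitiveOn hpf
  have hf₁c : Continuous f₁ := continuous_of_isPrimitiveOn hpf₁
  have hfb : ∀ x, ‖f x‖ ≤ ‖Y.1‖ := fun x => by
    rw [hf, norm_quasiExt hμ1]; exact norm_ext_le _ _
  have hf₁b : ∀ x, ‖f₁ x‖ ≤ ‖Y.2‖ := fun x => by
    rw [hf₁, norm_quasiExt hμ1]; exact norm_ext_le _ _
  obtain ⟨D, hD0, hD⟩ := exists_cutoff_bound
  set K := D * ‖Y.1‖ + 2 * (D * ‖Y.2‖) with hK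
  have hK0 : 0 ≤ K := by positivity
  set c := ∫ s in (0 : ℝ)..1, ‖f s‖ ^ 2 with hc
  have hcpos : 0 < c := by
    have h1 : c = ∫ s in (0 : ℝ)..1, ‖ext Y.1 s‖ ^ 2 := by
      refine intervalIntegral.integral_congr fun s hs => ?_
      rw [uIcc_of_le zero_le_one] at hs
      have := quasiExt_of_mem_Icc hμ0 e1 0 (x := s) (by simpa using hs)
      simp only [hf]
      rw [this]; simp
    rw [h1]
    exact integral_norm_sq_sol_pos hq ha0
  -- A Weyl sequence: with f the Bloch wave, (H - w)(χf) = r = -χ''f - 2χ'f' is bounded by K and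
  -- lives on two unit intervals. So ‖r‖² ≤ 2K² for all n, while ‖χf‖² ≥ nc, which no bounded R with
  -- R r = χf allows.
  have hmain : ∀ n : ℕ, n * c ≤ ‖R‖ ^ 2 * (2 * K ^ 2) := fun n => by
    have hχ := contDiff_cutoff n
    have hχ1 : ContDiff ℝ 1 (deriv (cutoff n)) :=
      (contDiff_succ_iff_deriv (n := 1)).1 hχ |>.2.2
    set χ : ℝ → ℂ := fun x => (cutoff n x : ℂ) with hχdef
    set χ₁ : ℝ → ℂ := fun x => ((deriv (cutoff n) x : ℝ) : ℂ) with hχ₁def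
    set χ₂ : ℝ → ℂ := fun x => ((deriv (deriv (cutoff n)) x : ℝ) : ℂ) with hχ₂def
    have hχc : Continuous χ := Complex.continuous_ofReal.comp hχ.continuous
    have hχ₁c : Continuous χ₁ := Complex.continuous_ofReal.comp hχ1.continuous
    have hχ₂c : Continuous χ₂ := Complex.continuous_ofReal.comp (hχ1.continuous_deriv le_rfl)
    set r : ℝ → ℂ := fun x => -(χ₂ x * f x) - 2 * (χ₁ x * f₁ x) with hr
    have hr0 : ∀ x ∉ Icc (0 : ℝ) 1 ∪ Icc (n + 1 : ℝ) (n + 2), r x = 0 := fun x hx => by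
      obtain ⟨d1, d2⟩ := deriv_cutoff_eq_zero n hx
      simp [hr, hχ₁def, hχ₂def, d1, d2]
    have hg2 : MemLp (fun x => χ x * f x) 2 volume := by
      refine (hχc.mul hfc).memLp_of_hasCompactSupport ?_
      refine HasCompactSupport.intro (K := Icc (0 : ℝ) (n + 2)) isCompact_Icc fun x hx => ?_
      simp [hχdef, cutoff_eq_zero n hx]
    have hrc : Continuous r := by fun_prop
    have hr2 : MemLp r 2 volume :=
      hrc.memLp_of_hasCompactSupport
        (HasCompactSupport.intro (isCompact_Icc.union isCompact_Icc) hr0)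
    have hmem : (hg2.toLp _, hr2.toLp _ + w • hg2.toLp _) ∈ lineGraph q := by
      refine ⟨fun x => χ x * f x, fun x => χ₁ x * f x + χ x * f₁ x,
        fun x => (χ₂ x * f x + χ₁ x * f₁ x) + (χ₁ x * f₁ x + χ x * ((q x - w) * f x)),
        fun a b hab => ?_, hg2.coeFn_toLp, ?_⟩
      · have hcp : IsPrimitiveOn a b χ χ₁ := isPrimitiveOn_of_contDiff (hχ.of_le (by norm_num))
        have hcp₁ : IsPrimitiveOn a b χ₁ χ₂ := isPrimitiveOn_of_contDiff hχ1
        exact (hcp.mul hab (hpf a b hab)).twiceAC ((hcp₁.mul hab (hpf a b hab)).add hab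
          (hcp.mul hab (hpf₁ a b hab)))
      · filter_upwards [hg2.coeFn_toLp, hr2.coeFn_toLp,
          Lp.coeFn_add (hr2.toLp r) (w • hg2.toLp _), Lp.coeFn_smul w (hg2.toLp _)]
          with x x1 x2 x3 x4
        rw [x3, Pi.add_apply, x4, Pi.smul_apply, x1, x2, smul_eq_mul]
        simp only [hr]
        ring
    have hRr : R (hr2.toLp r) = hg2.toLp _ := by
      rw [← lineOp_graph, LinearPMap.mem_graph_iff] at hmem
      obtain ⟨y, hy1, hy2⟩ := hmem
      have h3 := hR.2 y
      simp only at hy1 hy2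
      rw [hy2, hy1, add_sub_cancel_right] at h3
      exact h3
    have hle : ‖hg2.toLp _‖ ^ 2 ≤ ‖R‖ ^ 2 * ‖hr2.toLp r‖ ^ 2 := by
      rw [← hRr, ← mul_pow]
      gcongr
      exact R.le_opNorm _
    rw [norm_sq_toLp, norm_sq_toLp] at hle
    have hlow : n * c ≤ ∫ x, ‖χ x * f x‖ ^ 2 := by
      have hper' : Function.Periodic (fun x => ‖f x‖ ^ 2) 1 := fun x => by
        simp only [hf, norm_quasiExt hμ1, Int.fract_add_one]
      have h1 : ∫ x in (1 : ℝ)..(1 + n), ‖f x‖ ^ 2 = n * c := by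
        have := hper'.intervalIntegral_add_zsmul_eq n 1 (fun _ _ =>
          Continuous.intervalIntegrable (by fun_prop) _ _)
        have h5 := hper'.intervalIntegral_add_eq 1 0
        rw [zero_add] at h5
        rw [h5] at this
        simpa using this
      rw [← h1, intervalIntegral.integral_of_le (by simp)]
      have h2 : ∫ x in Ioc (1 : ℝ) (1 + n), ‖f x‖ ^ 2 =
          ∫ x in Ioc (1 : ℝ) (1 + n), ‖χ x * f x‖ ^ 2 := by
        refine setIntegral_congr_fun measurableSet_Ioc fun x hx => ?_
        simp only [hχdef]
        rw [cutoff_eq_one n ⟨hx.1.le, by linarith [hx.2]⟩]; simp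
      rw [h2]
      exact setIntegral_le_integral ((memLp_two_iff_integrable_sq_norm hg2.1).1 hg2)
        (ae_of_all _ fun _ => by positivity)
    have hup : ∫ x, ‖r x‖ ^ 2 ≤ 2 * K ^ 2 := by
      set A := Icc (0 : ℝ) 1 ∪ Icc (n + 1 : ℝ) (n + 2) with hA
      have hAm : MeasurableSet A := measurableSet_Icc.union measurableSet_Icc
      have hAv : volume A ≤ 2 := by
        refine (measure_union_le _ _).trans ?_
        rw [Real.volume_Icc, Real.volume_Icc]
        norm_num
      have h1 : ∫ x, ‖r x‖ ^ 2 = ∫ x in A, ‖r x‖ ^ 2 := by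
        rw [setIntegral_eq_integral_of_forall_compl_eq_zero]
        intro x hx
        rw [hr0 x hx]; simp
      have hAlt : volume A < ⊤ := lt_of_le_of_lt hAv (by simp)
      have h2 : ‖∫ x in A, ‖r x‖ ^ 2‖ ≤ K ^ 2 * volume.real A := by
        refine norm_setIntegral_le_of_norm_le_const hAlt fun x _ => ?_
        have hrb : ‖r x‖ ≤ K := by
          obtain ⟨d1, d2⟩ := hD n x
          calc ‖r x‖ ≤ ‖χ₂ x‖ * ‖f x‖ + 2 * (‖χ₁ x‖ * ‖f₁ x‖) := by
                refine (norm_sub_le _ _).trans (le_of_eq ?_)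
                rw [norm_neg, norm_mul, norm_mul, norm_mul, Complex.norm_ofNat]
            _ ≤ K := by
                have b1 : ‖χ₂ x‖ ≤ D := by simpa [hχ₂def] using d2
                have b2 : ‖χ₁ x‖ ≤ D := by simpa [hχ₁def] using d1
                have b3 := hfb x
                have b4 := hf₁b x
                rw [hK]
                gcongr
        rw [Real.norm_of_nonneg (by positivity)]
        gcongr
      have h3 : volume.real A ≤ 2 := ENNReal.toReal_mono (by simp) hAv
      rw [h1]
      refine (le_abs_self _).trans (h2.trans ?_)
      nlinarith [sq_nonneg K]
    calc n * c ≤ _ := hlow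
      _ ≤ _ := hle
      _ ≤ _ := by gcongr
  obtain ⟨n, hn⟩ := exists_nat_gt (‖R‖ ^ 2 * (2 * K ^ 2) / c)
  rw [div_lt_iff₀ hcpos] at hn
  exact absurd (hmain n) (not_le.2 hn)

end Hill

/-! ### The theorem -/

theorem theorem14 (q : ℝ → ℂ) (hper : Function.Periodic q 1)
    (hint : IntervalIntegrable q MeasureTheory.volume 0 1)
    (t₀ : ℝ) (ht₀ : ∀ n : ℤ, t₀ ≠ n * Real.pi) (w : ℂ)
    (hw : UnboundedOp.IsMultipleEigenvalue (Hill.fibreOp q t₀) w) :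
    Hill.IsSpectralSingularity q w ∧ ¬ Hill.IsEssentialSpectralSingularity q w := by
  obtain ⟨hF, hd⟩ := Hill.discriminant_of_isMultipleEigenvalue hint hw
  have hsin : Real.sin t₀ ≠ 0 := fun h => by
    obtain ⟨n, hn⟩ := Real.sin_eq_zero_iff.1 h
    exact ht₀ n hn.symm
  refine ⟨⟨Hill.mem_spectrum_lineOp hint hper hF, fun ε hε => ?_⟩,
    Hill.not_isEssentialSpectralSingularity hint hF hsin⟩
  -- The projections range over quasimomenta in [0, 2π), so t₀ is reduced modulo 2π. The
  -- representative is not 0 since its sine is nonzero, and this puts it in the open interval.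
  set t := toIcoMod Real.two_pi_pos 0 t₀ with ht
  have htm : t ∈ Ico (0 : ℝ) (2 * Real.pi) := by
    simpa using toIcoMod_mem_Ico Real.two_pi_pos 0 t₀
  have htt : t = t₀ - (toIcoDiv Real.two_pi_pos 0 t₀ : ℤ) * (2 * Real.pi) := by
    rw [ht, toIcoMod, zsmul_eq_mul]
  have hcos : Real.cos t = Real.cos t₀ := by rw [htt, Real.cos_sub_int_mul_two_pi]
  have hsin' : Real.sin t ≠ 0 := by rwa [htt, Real.sin_sub_int_mul_two_pi]
  have ht0 : 0 < t := lt_of_le_of_ne htm.1 fun h => hsin' (by rw [← h, Real.sin_zero])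
  exact Hill.not_bounded_projections hint ⟨ht0, htm.2⟩ (by rw [hF, hcos]) hd hsin' hε
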